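/- **Setting.** Let $M$ be either $\mathbb R^n$ with its Euclidean metric or a closed (compact, boundaryless) smooth Riemannian manifold. Let $X$ be a $C^1$ vector field on $M$ without zeros that generates a global flow $\Phi(t,x)$. For $d>0$, a map $\Psi:\mathbb R\times M\to M$ is a *$d$-method* if $\Psi(0,x)=x$ and $\operatorname{dist}(\Psi(t+s,x),\Phi(s,\Psi(t,x)))<d$ for all $x\in M$, $t\in\mathbb R$, $s\in[-1,1]$. It is *smooth* if it is $C^\infty$ on $\mathbb R\times M$. Let $\mathrm{Rep}(\delta)$ be the set of increasing homeomorphisms $\alpha$ of $\mathbb R$ with $\alpha(0)=0$ and $\left|\frac{\alpha(t)-\alpha(s)}{t-s}-1\right|\le\delta$ for $t\ne s$. A point $p$ is *inversely shadowed with constants* $L,d_0>0$ if for every $0<d\le d_0$ and every smooth $d$-method $\Psi$ there are $\hat p\in M$ and $\alpha\in\mathrm{Rep}(Ld)$ with $\operatorname{dist}(\Phi(t,p),\Psi(\alpha(t),\hat p))<Ld$ for all $t\in\mathbb R$. The flow has the *Lipschitz inverse shadowing property* if every point $p$ is inversely shadowed with some constants $L,d_0>0$. On a closed manifold these constants may depend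 on $p$; on $\mathbb R^n$ we require one pair $L,d_0$ that serves all points. For $M=\mathbb R^n$, *condition (UB)* says: 1. $\left\|\frac{\partial\Phi(s,x)}{\partial x}\right\|$ is bounded over $x\in\mathbb R^n$, $s\in[-1,1]$; 2. $|X|$ is bounded; 3. there is a nondecreasing $g_1:[0,\infty)\to[0,\infty)$ with $g_1(r)/r\to0$ as $r\to0^+$ such that $$\left|\Phi(t+h_1,x+h_2)-\Phi(t,x)-h_1X(\Phi(t,x))-\tfrac{\partial\Phi(t,x)}{\partial x}h_2\right|\le g_1(|h_1|+|h_2|)$$ for all $x\in\mathbb R^n$, $t\in[-1,1]$, $h_1\in[-1,1]$ and $|h_2|<1$. For $p\in M$ put $f=\Phi(1,\cdot)$, $p_k=f^k(p)$ and $A_k=Df(p_k):T_{p_k}M\to T_{p_{k+1}}M$ for $k\in\mathbb Z$. Let $V_k$ be the orthogonal complement of $X(p_k)$ in $T_{p_k}M$, let $P_k$ be the orthogonal projection of $T_{p_k}M$ onto $V_k$, and let $B_k=P_{k+1}A_k:V_k\to V_{k+1}$. **Theorem.** Suppose that $\Phi$ has the Lipschitz inverse shadowing property and, if $M=\mathbb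 R^n$, satisfies (UB). (No such condition is needed if $M$ is closed.) Then there is a constant $L_1$ such that for every point $p\in M$ the following hold. (a) For every sequence $z_k\in T_{p_k}M$, $k\in\mathbb Z$, with $|z_k|\le1$ and every natural number $N$ there are real numbers $s_k$ such that the system $$x_{k+1}=A_kx_k+X(p_{k+1})s_k+z_{k+1},\qquad -N\le k\le N-1,$$ has a solution $x_k\in T_{p_k}M$ with $|x_k|\le L_1$ for $-N\le k\le N$. (b) For every sequence $b_k\in V_k$, $k\in\mathbb Z$, with $|b_k|\le1$ the system $v_{k+1}=B_kv_k+b_{k+1}$, $k\in\mathbb Z$, has a solution $v_k\in V_k$ with $|v_k|\le L_1$ for all $k\in\mathbb Z$. -/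

import Mathlib

open Set Filter Topology Bundle Manifold
open scoped ContDiff NNReal

noncomputable section

namespace InvShadow

section Shadowing

variable {M : Type*} [EMetricSpace M]

/-- `Ψ : ℝ × M → M` is a `d`-method for the flow `Φ`: it starts at the identity, and along every
trajectory of `Ψ` the flow is followed with an error less than `d` over times `s ∈ [-1, 1]`. -/
def IsMethod (Φ : Flow ℝ M) (Ψ : ℝ → M → M) (d : ℝ) : Prop :=
  (∀ x, Ψ 0 x = x) ∧
    ∀ t : ℝ, ∀ s ∈ Icc (-1 : ℝ) 1, ∀ x : M,
      edist (Ψ (t + s) x) (Φ s (Ψ t x)) < ENNReal.ofReal d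

/-- `Rep(δ)`: increasing homeomorphisms `α` of the line with `α 0 = 0` and all difference quotients
within `δ` of `1`. -/
def Rep (δ : ℝ) : Set (ℝ ≃ₜ ℝ) :=
  {α | StrictMono α ∧ α 0 = 0 ∧ ∀ t s : ℝ, t ≠ s → |(α t - α s) / (t - s) - 1| ≤ δ}

variable {E : Type*} [NormedAddCommGroup E] [NormedSpace ℝ E]
  {H : Type*} [TopologicalSpace H] (I : ModelWithCorners ℝ E H) [ChartedSpace H M]

/-- Every smooth `d`-method with `d ≤ d₀` has a trajectory which, up to a reparametrisation in
`Rep(L d)`, stays at distance less than `L d` from the exact trajectory of `p`. -/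
def InverseShadowsAt (Φ : Flow ℝ M) (p : M) (L d₀ : ℝ) : Prop :=
  ∀ d : ℝ, 0 < d → d ≤ d₀ → ∀ Ψ : ℝ → M → M,
    IsMethod Φ Ψ d →
    ContMDiff (𝓘(ℝ, ℝ).prod I) I ∞ (fun q : ℝ × M ↦ Ψ q.1 q.2) →
    ∃ q : M, ∃ α ∈ Rep (L * d), ∀ t : ℝ, edist (Φ t p) (Ψ (α t) q) < ENNReal.ofReal (L * d)

/-- Lipschitz inverse shadowing with respect to smooth methods; the constants may depend on the
point. -/
def LISP (Φ : Flow ℝ M) : Prop :=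
  ∀ p : M, ∃ L d₀ : ℝ, 0 < L ∧ 0 < d₀ ∧ InverseShadowsAt I Φ p L d₀

/-- Lipschitz inverse shadowing with respect to smooth methods, with constants that serve all
points. -/
def UniformLISP (Φ : Flow ℝ M) : Prop :=
  ∃ L d₀ : ℝ, 0 < L ∧ 0 < d₀ ∧ ∀ p : M, InverseShadowsAt I Φ p L d₀

end Shadowing

section Linearized

variable {E : Type*} [NormedAddCommGroup E] [NormedSpace ℝ E]
  {H : Type*} [TopologicalSpace H] (I : ModelWithCorners ℝ E H)
  {M : Type*} [EMetricSpace M] [ChartedSpace H M]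

/-- The differential of `f` at `x`, as a map into the tangent space at `y`, where `f x = y`. -/
def mfderivTo (f : M → M) {x y : M} (h : f x = y) : TangentSpace I x →L[ℝ] TangentSpace I y :=
  h ▸ mfderiv I I f x

/-- The orbit `p_k = f^k(p)` of the time-one map `f = Φ(1, ·)`. -/
def orbit (Φ : Flow ℝ M) (p : M) (k : ℤ) : M := Φ (k : ℝ) p

theorem orbit_succ (Φ : Flow ℝ M) (p : M) (k : ℤ) :
    Φ 1 (orbit Φ p k) = orbit Φ p (k + 1) := by
  unfold orbit
  rw [← Φ.map_add]
  push_cast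
  rw [add_comm]

/-- `A_k = Df(p_k) : T_{p_k} M → T_{p_{k+1}} M`. -/
def stepDeriv (Φ : Flow ℝ M) (p : M) (k : ℤ) :
    TangentSpace I (orbit Φ p k) →L[ℝ] TangentSpace I (orbit Φ p (k + 1)) :=
  mfderivTo I (Φ 1) (orbit_succ Φ p k)

variable [RiemannianBundle (fun x : M ↦ TangentSpace I x)]

/-- The orthogonal complement of `X(x)` in the tangent space at `x`. -/
def normalSpace (X : (x : M) → TangentSpace I x) (x : M) : Submodule ℝ (TangentSpace I x) :=
  (Submodule.span ℝ {X x})ᗮ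

/-- The orthogonal projection of the tangent space at `x` with kernel spanned by `X(x)`. -/
def normalProj (X : (x : M) → TangentSpace I x) (x : M) :
    TangentSpace I x →L[ℝ] TangentSpace I x :=
  (Submodule.span ℝ {X x})ᗮ.starProjection

/-- For every point `p`, every inhomogeneity `z` along its orbit with `|z_k| ≤ 1` and every `N`,
the system `x_{k+1} = A_k x_k + X(p_{k+1}) s_k + z_{k+1}`, `-N ≤ k ≤ N - 1`, has for suitable reals
`s_k` a solution with `|x_k| ≤ L₁` for `-N ≤ k ≤ N`. -/
def SolvableOnIntervals (X : (x : M) → TangentSpace I x) (Φ : Flow ℝ M) (L₁ : ℝ) : Prop :=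
  ∀ (p : M) (z : (k : ℤ) → TangentSpace I (orbit Φ p k)), (∀ k, ‖z k‖ ≤ 1) →
    ∀ N : ℕ, ∃ (s : ℤ → ℝ) (x : (k : ℤ) → TangentSpace I (orbit Φ p k)),
      (∀ k ∈ Icc (-(N : ℤ)) (N - 1),
        x (k + 1) = stepDeriv I Φ p k (x k) + s k • X (orbit Φ p (k + 1)) + z (k + 1)) ∧
      ∀ k ∈ Icc (-(N : ℤ)) N, ‖x k‖ ≤ L₁

/-- For every point `p` and every inhomogeneity `b_k ∈ V_k` with `|b_k| ≤ 1`, the system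
`v_{k+1} = B_k v_k + b_{k+1}`, `k ∈ ℤ`, where `B_k = P_{k+1} A_k : V_k → V_{k+1}`, has a solution
`v_k ∈ V_k` with `|v_k| ≤ L₁` for all `k`. -/
def ProjectedSolvable (X : (x : M) → TangentSpace I x) (Φ : Flow ℝ M) (L₁ : ℝ) : Prop :=
  ∀ (p : M) (b : (k : ℤ) → TangentSpace I (orbit Φ p k)),
    (∀ k, b k ∈ normalSpace I X (orbit Φ p k)) → (∀ k, ‖b k‖ ≤ 1) →
    ∃ v : (k : ℤ) → TangentSpace I (orbit Φ p k),
      (∀ k, v k ∈ normalSpace I X (orbit Φ p k)) ∧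
      (∀ k, v (k + 1) =
        normalProj I X (orbit Φ p (k + 1)) (stepDeriv I Φ p k (v k)) + b (k + 1)) ∧
      ∀ k, ‖v k‖ ≤ L₁

end Linearized

/-- Condition (UB) for the flow `Φ` of the vector field `X` on `ℝⁿ`. -/
structure UniformlyBounded {n : ℕ}
    (X : EuclideanSpace ℝ (Fin n) → EuclideanSpace ℝ (Fin n))
    (Φ : Flow ℝ (EuclideanSpace ℝ (Fin n))) : Prop where
  deriv_bounded : ∃ Q₁ : ℝ, ∀ x, ∀ s ∈ Icc (-1 : ℝ) 1, ‖fderiv ℝ (Φ s) x‖ ≤ Q₁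
  field_bounded : ∃ Q₂ : ℝ, ∀ x, ‖X x‖ ≤ Q₂
  taylor : ∃ g : ℝ≥0 → ℝ≥0, Monotone g ∧ Tendsto (fun r ↦ g r / r) (𝓝[>] 0) (𝓝 0) ∧
    ∀ x, ∀ t ∈ Icc (-1 : ℝ) 1, ∀ h₁ ∈ Icc (-1 : ℝ) 1, ∀ h₂ : EuclideanSpace ℝ (Fin n), ‖h₂‖ < 1 →
      ‖Φ (t + h₁) (x + h₂) - Φ t x - h₁ • X (Φ t x) - fderiv ℝ (Φ t) x h₂‖₊ ≤ g (‖h₁‖₊ + ‖h₂‖₊)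

end InvShadow

end

/-! The flow is perturbed near `p` so that shadowing is forced to solve the linear system. Each
`z_{j+1}` is pulled back by the linearized flow to a vector `w_j` at `p`. Let `ξ` be a path in the
tangent space at `p` that gains `w_j` between the times `j` and `j + 1` and rests near integers, and
let `κ v` shift the points near `p` by `v`. Then `(t, x) ↦ Φ t (κ (d ξ(t)) x)` becomes, after
smoothing, a method with error `O(d)`: at time `t` only the `w_j` with `j` near `t` are moving, and
`DΦ(t)` carries those to vectors of bounded length. A trajectory of this method that stays close to
the orbit of `p` starts at a point with coordinate `u = O(d)`, and at integer times it is compared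
with `Φ k (Φ τ_k p)`, where `τ_k` comes from the reparametrization. Linearizing at `p`, with `d`
small depending on `N`, gives `|DΦ(k)(u + d ξ(k) - τ_k X(p))| ≤ const · d` for `|k| ≤ N`. Divided by
`d`, these images are the `x_k`, and the increments of `-τ_k / d` are the `s_k`
(`exists_small_linear_combination`, `exists_bounded_solution`). The constant depends only on `L` and
on a Lipschitz constant of `Φ t` for `|t| ≤ 2`.

With uniform shadowing constants this is already (a). On a closed manifold `L` depends on `p`, and
uniformity is recovered by duality. Solvability along one orbit amounts to an `ℓ¹` estimate for
functionals that vanish on `X` (`BoundedlySolvable.dualEstimate`); tested on cut-offs, it excludes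
nonzero bounded solutions of the adjoint equation (`DualEstimate.eq_zero_of_bounded`). This
qualitative fact, valid on every orbit, becomes by compactness of `M` an expansivity with a single
window size (`exists_adjointExpansive`). Expansivity yields the dual estimate with a uniform
constant (`exists_dualEstimate_of_adjointExpansive`), and Hahn-Banach turns that into (a)
(`DualEstimate.boundedlySolvable`).

For (b), `A_k X(p_k) = X(p_{k+1})`, so projection along `X` removes the terms with `s_k`; then `N →
∞` (`BoundedlySolvable.projected`).

`ControlledFlow` collects what the perturbation argument needs to know about the flow. On `ℝⁿ` it
follows from (UB); on a closed manifold, from the `C¹` dependence of the flow on initial points and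
a smoothing theorem for maps into `M`, both proved below. -/

noncomputable section

namespace InvShadow

/-! ### Duality: bounded solvability and bounded solutions of the adjoint equation. -/

section LinearSystems

/-- Both sides are the sum over all of `ℤ`, as `F` contains the supports of `u` and of its shift.
This is summation by parts without boundary terms. -/
theorem sum_shift_eq {F : Finset ℤ} {u : ℤ → ℝ} (h₀ : ∀ k ∉ F, u k = 0)
    (h₁ : ∀ k ∉ F, u (k + 1) = 0) : ∑ k ∈ F, u (k + 1) = ∑ k ∈ F, u k := by
  have e₀ : ∑' k, u k = ∑ k ∈ F, u k := tsum_eq_sum h₀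
  have e₁ : ∑' k, u (k + 1) = ∑ k ∈ F, u (k + 1) := tsum_eq_sum h₁
  rw [← e₀, ← e₁]
  exact (Equiv.addRight (1 : ℤ)).tsum_eq u

variable {T : ℤ → Type*} [∀ k, NormedAddCommGroup (T k)] [∀ k, InnerProductSpace ℝ (T k)]
  (A : ∀ k, T k →L[ℝ] T (k + 1)) (X : ∀ k, T k)

/-- The systems `x_{k+1} = A_k x_k + s_k X_{k+1} + z_{k+1}` on the intervals `[-N, N]`, with `z`
bounded by `1`, have solutions bounded by `L`. -/
def BoundedlySolvable (L : ℝ) : Prop :=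
  ∀ z : ∀ k, T k, (∀ k, ‖z k‖ ≤ 1) → ∀ N : ℕ, ∃ (s : ℤ → ℝ) (x : ∀ k, T k),
    (∀ k ∈ Icc (-(N : ℤ)) (N - 1), x (k + 1) = A k (x k) + s k • X (k + 1) + z (k + 1)) ∧
      ∀ k ∈ Icc (-(N : ℤ)) N, ‖x k‖ ≤ L

/-- The a priori estimate dual to `BoundedlySolvable`. -/
def DualEstimate (L : ℝ) : Prop :=
  ∀ φ : ∀ k, T k →L[ℝ] ℝ, (∀ k, φ k (X k) = 0) → ∀ F : Finset ℤ, (∀ k ∉ F, φ k = 0) →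
    (∀ k ∉ F, φ (k + 1) = 0) →
    ∑ k ∈ F, ‖φ k‖ ≤ L * ∑ k ∈ F, ‖φ k - (φ (k + 1)).comp (A k)‖

variable {A X}

theorem exists_norming {V : Type*} [NormedAddCommGroup V] [InnerProductSpace ℝ V] [CompleteSpace V]
    (φ : V →L[ℝ] ℝ) : ∃ x : V, ‖x‖ ≤ 1 ∧ φ x = ‖φ‖ := by
  set u := (InnerProductSpace.toDual ℝ V).symm φ with hu
  have h1 : ∀ y, φ y = inner ℝ u y := fun y ↦ by simp [hu]
  have h2 : ‖u‖ = ‖φ‖ := by simp [hu]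
  rcases eq_or_ne u 0 with h | h
  · refine ⟨0, by simp, ?_⟩
    rw [← h2, h]
    simp
  · refine ⟨‖u‖⁻¹ • u, by rw [norm_smul]; simp [h], ?_⟩
    have : ‖u‖ ≠ 0 := by simpa using h
    rw [h1, real_inner_smul_right, real_inner_self_eq_norm_sq, ← h2]
    field_simp

theorem exists_natCast_Icc (F : Finset ℤ) : ∃ N : ℕ, ∀ k ∈ F, k ∈ Icc (-(N : ℤ)) (N - 1) := by
  refine ⟨F.sup (fun k ↦ k.natAbs + 1), fun k hk ↦ ?_⟩
  have : k.natAbs + 1 ≤ F.sup (fun k ↦ k.natAbs + 1) :=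
    Finset.le_sup (f := fun k : ℤ ↦ k.natAbs + 1) hk
  constructor <;> omega

/-- Take `z` norming for `φ` and pair the solution with `φ`. The terms with `X` drop out, and
summation by parts moves the difference operator from `x` to `φ`, where `‖x k‖ ≤ L` applies. -/
theorem BoundedlySolvable.dualEstimate [∀ k, CompleteSpace (T k)] {L : ℝ}
    (h : BoundedlySolvable A X L) : DualEstimate A X L := by
  intro φ hX F h₀ h₁
  choose z hz hφz using fun k ↦ exists_norming (φ k)
  obtain ⟨N, hN⟩ := exists_natCast_Icc F
  obtain ⟨s, x, hx, hL⟩ := h z hz N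
  calc ∑ k ∈ F, ‖φ k‖ = ∑ k ∈ F, φ k (z k) := by simp_rw [hφz]
    _ = ∑ k ∈ F, φ (k + 1) (z (k + 1)) :=
        (sum_shift_eq (u := fun k ↦ φ k (z k)) (fun k hk ↦ by simp [h₀ k hk])
          (fun k hk ↦ by simp [h₁ k hk])).symm
    _ = ∑ k ∈ F, (φ (k + 1) (x (k + 1)) - φ (k + 1) (A k (x k))) := by
        refine Finset.sum_congr rfl fun k hk ↦ ?_
        rw [hx k (hN k hk)]
        simp [hX]
    _ = ∑ k ∈ F, (φ k - (φ (k + 1)).comp (A k)) (x k) := by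
        rw [Finset.sum_sub_distrib, sum_shift_eq (u := fun k ↦ φ k (x k))
          (fun k hk ↦ by simp [h₀ k hk]) (fun k hk ↦ by simp [h₁ k hk]), ← Finset.sum_sub_distrib]
        rfl
    _ ≤ ∑ k ∈ F, L * ‖φ k - (φ (k + 1)).comp (A k)‖ := by
        refine Finset.sum_le_sum fun k hk ↦ (le_abs_self _).trans ?_
        refine ((φ k - (φ (k + 1)).comp (A k)).le_opNorm (x k)).trans ?_
        rw [mul_comm]
        gcongr
        have := hN k hk
        exact hL k ⟨this.1, by have := this.2; omega⟩
    _ = _ := by rw [Finset.mul_sum]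

/-- A bounded solution of the adjoint homogeneous system vanishes. -/
theorem DualEstimate.eq_zero_of_bounded {L : ℝ} (hL : 0 ≤ L) (h : DualEstimate A X L)
    {ψ : ∀ k, T k →L[ℝ] ℝ} (hX : ∀ k, ψ k (X k) = 0) (hψ : ∀ k, ψ k = (ψ (k + 1)).comp (A k))
    {C : ℝ} (hC : ∀ k, ‖ψ k‖ ≤ C) : ψ 0 = 0 := by
  have hC0 : 0 ≤ C := (norm_nonneg _).trans (hC 0)
  set S : ℕ → ℝ := fun m ↦ ∑ k ∈ Finset.Icc (-(m : ℤ)) m, ‖ψ k‖ with hS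
  -- The dual estimate is tested on `c k • ψ k` with a tent `c` of slope `1 / (2 m)` that is at
  -- least `1 / 2` on `[-m, m]`. As `ψ` solves the adjoint equation, only the differences of `c`
  -- remain on the right.
  have key : ∀ m : ℕ, 0 < m → S m ≤ L / m * S (2 * m) := by
    intro m hm
    have hm' : (0 : ℝ) < m := by exact_mod_cast hm
    set c : ℤ → ℝ := fun k ↦ max 0 (1 - |(k : ℝ)| / (2 * m)) with hc
    have hc0 : ∀ k, 0 ≤ c k := fun k ↦ le_max_left _ _
    have hcz : ∀ k : ℤ, 2 * (m : ℤ) ≤ |k| → c k = 0 := by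
      intro k hk
      apply max_eq_left
      have : 2 * (m : ℝ) ≤ |(k : ℝ)| := by exact_mod_cast hk
      rw [sub_nonpos, le_div_iff₀ (by positivity)]
      linarith
    have hcd : ∀ k, |c k - c (k + 1)| ≤ 1 / (2 * m) := by
      intro k
      have h1 : |c k - c (k + 1)| ≤ |(1 - |(k : ℝ)| / (2 * m)) - (1 - |((k + 1 : ℤ) : ℝ)| / (2 * m))| := by
        have := abs_max_sub_max_le_abs (1 - |(k : ℝ)| / (2 * m))
          (1 - |((k + 1 : ℤ) : ℝ)| / (2 * m)) 0
        simpa only [hc, max_comm] using this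
      refine h1.trans ?_
      have h2 : (1 - |(k : ℝ)| / (2 * m)) - (1 - |((k + 1 : ℤ) : ℝ)| / (2 * m))
          = (|((k + 1 : ℤ) : ℝ)| - |(k : ℝ)|) / (2 * m) := by ring
      rw [h2, abs_div, abs_of_pos (show (0 : ℝ) < 2 * m by positivity)]
      gcongr
      refine (abs_abs_sub_abs_le_abs_sub _ _).trans ?_
      push_cast
      simp
    have hmain := h (fun k ↦ c k • ψ k) (fun k ↦ by simp [hX])
      (Finset.Icc (-((2 * m : ℕ) : ℤ)) (2 * m : ℕ))
      (fun k hk ↦ by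
        rw [hcz k, zero_smul]
        rw [Finset.mem_Icc, not_and_or] at hk
        rw [le_abs]; push_cast at hk; omega)
      (fun k hk ↦ by
        rw [hcz (k + 1), zero_smul]
        rw [Finset.mem_Icc, not_and_or] at hk
        rw [le_abs]; push_cast at hk; omega)
    have hleft : S m / 2 ≤ ∑ k ∈ Finset.Icc (-((2 * m : ℕ) : ℤ)) (2 * m : ℕ), ‖c k • ψ k‖ := by
      rw [hS, Finset.sum_div]
      refine (Finset.sum_le_sum (g := fun k ↦ ‖c k • ψ k‖) fun k hk ↦ ?_).trans
        (Finset.sum_le_sum_of_subset_of_nonneg ?_ fun _ _ _ ↦ norm_nonneg _)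
      · rw [norm_smul, Real.norm_of_nonneg (hc0 k)]
        have : 1 / 2 ≤ c k := by
          refine le_trans ?_ (le_max_right _ _)
          have : |(k : ℝ)| ≤ m := by
            rw [Finset.mem_Icc] at hk
            have : |k| ≤ m := abs_le.mpr hk
            exact_mod_cast this
          have : |(k : ℝ)| / (2 * m) ≤ 1 / 2 := by
            rw [div_le_iff₀ (by positivity)]; linarith
          linarith
        have := norm_nonneg (ψ k)
        nlinarith
      · intro k hk
        rw [Finset.mem_Icc] at hk ⊢
        push_cast
        omega
    have hright : ∑ k ∈ Finset.Icc (-((2 * m : ℕ) : ℤ)) (2 * m : ℕ),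
        ‖c k • ψ k - (c (k + 1) • ψ (k + 1)).comp (A k)‖ ≤ 1 / (2 * m) * S (2 * m) := by
      rw [hS, Finset.mul_sum]
      refine Finset.sum_le_sum fun k _ ↦ ?_
      have : c k • ψ k - (c (k + 1) • ψ (k + 1)).comp (A k) = (c k - c (k + 1)) • ψ k := by
        rw [ContinuousLinearMap.smul_comp, ← hψ]
        ext v
        simp [sub_mul]
      rw [this, norm_smul, Real.norm_eq_abs]
      gcongr
      exact hcd k
    have : S m / 2 ≤ L * (1 / (2 * m) * S (2 * m)) :=
      hleft.trans (hmain.trans (mul_le_mul_of_nonneg_left hright hL))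
    have h3 : L / m * S (2 * m) = 2 * (L * (1 / (2 * m) * S (2 * m))) := by field_simp
    rw [h3]; linarith
  have hSb : ∀ m : ℕ, S m ≤ C * (2 * m + 1) := by
    intro m
    refine (Finset.sum_le_sum fun k _ ↦ hC k).trans ?_
    rw [Finset.sum_const, nsmul_eq_mul, Int.card_Icc, mul_comm]
    gcongr
    have : ((m : ℤ) + 1 - -(m : ℤ)).toNat = 2 * m + 1 := by omega
    rw [this]; push_cast; rfl
  -- `key` is used twice: the linear growth of `S` improves to boundedness (with `4 m + 1 ≤ 5 m`),
  -- and boundedness then to decay like `1 / m`.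
  have hSb' : ∀ m : ℕ, 0 < m → S m ≤ 5 * L * C := by
    intro m hm
    have hm' : (1 : ℝ) ≤ m := by exact_mod_cast hm
    refine (key m hm).trans ?_
    calc L / m * S (2 * m) ≤ L / m * (C * (5 * m)) := by
          gcongr
          refine (hSb _).trans ?_
          gcongr
          push_cast
          linarith
      _ = 5 * L * C := by field_simp
  have hfin : ∀ m : ℕ, 0 < m → ‖ψ 0‖ ≤ (L * (5 * L * C)) / m := by
    intro m hm
    have hm' : (0 : ℝ) < m := by exact_mod_cast hm
    calc ‖ψ 0‖ ≤ S m := Finset.single_le_sum (f := fun k ↦ ‖ψ k‖) (fun _ _ ↦ norm_nonneg _)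
          (by rw [Finset.mem_Icc]; omega)
      _ ≤ L / m * S (2 * m) := key m hm
      _ ≤ L / m * (5 * L * C) := by gcongr; exact hSb' _ (by omega)
      _ = _ := by ring
  have hlim : Tendsto (fun m : ℕ ↦ (L * (5 * L * C)) / (m : ℝ)) atTop (𝓝 0) :=
    tendsto_const_div_atTop_nhds_zero_nat _
  have : ‖ψ 0‖ ≤ 0 := ge_of_tendsto hlim (eventually_atTop.mpr ⟨1, fun m hm ↦ hfin m hm⟩)
  simpa using this

end LinearSystems

/-! ### A uniform dual estimate from expansivity of the adjoint system. -/

section LinearSystems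

/-- There is a summable weight on `ℤ` which varies slowly on the scale `N`. -/
theorem exists_slow_weight (N : ℕ) : ∃ θ : ℝ, 0 < θ ∧ θ < 1 ∧ 3 / 4 ≤ θ ^ N := by
  have h : Tendsto (fun θ : ℝ ↦ θ ^ N) (𝓝[<] 1) (𝓝 1) := by
    have := ((continuous_pow N).tendsto (1 : ℝ)).mono_left (nhdsWithin_le_nhds (s := Iio 1))
    simpa using this
  have h1 : ∀ᶠ θ : ℝ in 𝓝[<] 1, 3 / 4 < θ ^ N := h.eventually (lt_mem_nhds (by norm_num))
  have h2 : ∀ᶠ θ : ℝ in 𝓝[<] 1, 0 < θ :=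
    (lt_mem_nhds (by norm_num : (0 : ℝ) < 1)).filter_mono nhdsWithin_le_nhds
  obtain ⟨θ, h3, h4, h5⟩ := (h1.and (h2.and self_mem_nhdsWithin)).exists
  exact ⟨θ, h4, h5, h3.le⟩

/-- The bound on `a` enters only qualitatively: iterating the window inequality halves its
contribution each time, so `K` depends on `N` alone. What remains is dominated by a convolution of
`g` with a summable weight. -/
theorem sum_le_of_window_estimate (N : ℕ) : ∃ K : ℝ, 0 ≤ K ∧ ∀ (C : ℝ) (a g : ℤ → ℝ) (F : Finset ℤ),
    0 ≤ C → (∀ k, 0 ≤ g k) → (∀ k ∉ F, g k = 0) → BddAbove (range a) →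
    (∀ j : ℤ, ∃ k : ℤ, |k - j| ≤ (N : ℤ) ∧ a j ≤ a k / 2 + C * ∑ i ∈ Finset.Icc (j - N) (j + N), g i) →
    ∑ j ∈ F, a j ≤ K * C * ∑ k ∈ F, g k := by
  obtain ⟨θ, hθ0, hθ1, hθN⟩ := exists_slow_weight N
  have hsumm : Summable fun m : ℤ ↦ θ ^ m.natAbs := by
    apply Summable.of_nat_of_neg <;>
    simpa using summable_geometric_of_lt_one hθ0.le hθ1
  set W := ∑' m : ℤ, θ ^ m.natAbs with hW
  have hW0 : 0 ≤ W := tsum_nonneg fun m ↦ by positivity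
  refine ⟨4 * W, by positivity, fun C a g F hC hg hgF hbdd hwin ↦ ?_⟩
  -- Since `3 / 4 ≤ θ ^ N`, the majorant `b` loses at most the factor `3 / 4` within a window, and
  -- it dominates `3 / 4` of every window sum of `g`.
  set b : ℤ → ℝ := fun j ↦ ∑ l ∈ F, θ ^ (j - l).natAbs * g l with hb
  have hb0 : ∀ j, 0 ≤ b j := fun j ↦ Finset.sum_nonneg fun l _ ↦ mul_nonneg (by positivity) (hg l)
  have hpow : ∀ m n : ℤ, |m - n| ≤ N → 3 / 4 * θ ^ m.natAbs ≤ θ ^ n.natAbs := by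
    intro m n hmn
    calc 3 / 4 * θ ^ m.natAbs ≤ θ ^ N * θ ^ m.natAbs := by gcongr
      _ = θ ^ (N + m.natAbs) := (pow_add _ _ _).symm
      _ ≤ θ ^ n.natAbs := by
        apply pow_le_pow_of_le_one hθ0.le hθ1.le
        rw [abs_le] at hmn
        omega
  have hbk : ∀ j k : ℤ, |k - j| ≤ N → 3 / 4 * b k ≤ b j := by
    intro j k hk
    rw [hb, Finset.mul_sum]
    refine Finset.sum_le_sum fun l _ ↦ ?_
    rw [← mul_assoc]
    refine mul_le_mul_of_nonneg_right (hpow _ _ ?_) (hg l)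
    simpa using hk
  have hwb : ∀ j : ℤ, 3 / 4 * ∑ i ∈ Finset.Icc (j - N) (j + N), g i ≤ b j := by
    intro j
    have h1 : ∑ i ∈ Finset.Icc (j - N) (j + N), g i
        = ∑ i ∈ F with i ∈ Finset.Icc (j - (N : ℤ)) (j + N), g i := by
      symm
      apply Finset.sum_subset
      · intro i hi
        exact (Finset.mem_filter.mp hi).2
      · intro i hi hi'
        apply hgF
        intro hF
        exact hi' (Finset.mem_filter.mpr ⟨hF, hi⟩)
    rw [h1, Finset.mul_sum]
    refine (Finset.sum_le_sum (g := fun l ↦ θ ^ (j - l).natAbs * g l) fun i hi ↦ ?_).trans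
      (Finset.sum_le_sum_of_subset_of_nonneg (Finset.filter_subset _ _)
        fun l _ _ ↦ mul_nonneg (by positivity) (hg l))
    refine mul_le_mul_of_nonneg_right ?_ (hg i)
    have := hpow 0 (j - i) (by
      have := Finset.mem_Icc.mp (Finset.mem_filter.mp hi).2
      rw [abs_le]; omega)
    simpa using this
  obtain ⟨D, hD⟩ := hbdd
  -- The factor `4` reproduces itself: half of `4 C b k` is at most `(8 / 3) C b j`, and the window
  -- sum adds at most `(4 / 3) C b j`.
  have hind : ∀ n : ℕ, ∀ j, a j ≤ |D| / 2 ^ n + 4 * C * b j := by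
    intro n
    induction n with
    | zero =>
      intro j
      have h1 : a j ≤ D := hD ⟨j, rfl⟩
      have h2 := le_abs_self D
      have h3 : 0 ≤ 4 * C * b j := by have := hb0 j; positivity
      simp only [pow_zero, div_one]
      linarith
    | succ n ih =>
      intro j
      obtain ⟨k, hk, hak⟩ := hwin j
      have h1 := ih k
      have h2 := mul_le_mul_of_nonneg_left (hbk j k hk) hC
      have h3 := mul_le_mul_of_nonneg_left (hwb j) hC
      have h4 : |D| / 2 ^ (n + 1) = |D| / 2 ^ n / 2 := by rw [pow_succ]; field_simp
      rw [h4]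
      linarith
  have hab : ∀ j, a j ≤ 4 * C * b j := by
    intro j
    have hlim : Tendsto (fun n : ℕ ↦ |D| / (2 : ℝ) ^ n + 4 * C * b j) atTop
        (𝓝 (0 + 4 * C * b j)) :=
      (tendsto_const_nhds.div_atTop (tendsto_pow_atTop_atTop_of_one_lt one_lt_two)).add_const _
    rw [zero_add] at hlim
    exact ge_of_tendsto' hlim fun n ↦ hind n j
  calc ∑ j ∈ F, a j ≤ ∑ j ∈ F, 4 * C * b j := Finset.sum_le_sum fun j _ ↦ hab j
    _ = 4 * C * ∑ l ∈ F, (∑ j ∈ F, θ ^ (j - l).natAbs) * g l := by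
        rw [← Finset.mul_sum, hb, Finset.sum_comm]
        simp_rw [Finset.sum_mul]
    _ ≤ 4 * C * ∑ l ∈ F, W * g l := by
        gcongr with l hl
        · exact hg l
        · have h1 : Summable fun j : ℤ ↦ θ ^ (j - l).natAbs :=
            hsumm.comp_injective (Equiv.subRight l).injective
          have h2 : ∑' j : ℤ, θ ^ (j - l).natAbs = W :=
            (Equiv.subRight l).tsum_eq fun m : ℤ ↦ θ ^ m.natAbs
          rw [← h2]
          exact h1.sum_le_tsum F fun _ _ ↦ by positivity
    _ = 4 * W * C * ∑ k ∈ F, g k := by rw [← Finset.mul_sum]; ring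

variable {T : ℤ → Type*} [∀ k, NormedAddCommGroup (T k)] [∀ k, InnerProductSpace ℝ (T k)]
  {A : ∀ k, T k →L[ℝ] T (k + 1)} {X : ∀ k, T k}

/-- On every window of radius `N`, a solution of the adjoint homogeneous system attains twice the
size it has in the centre. -/
def AdjointExpansive (A : ∀ k, T k →L[ℝ] T (k + 1)) (X : ∀ k, T k) (N : ℕ) : Prop :=
  ∀ (j : ℤ) (ψ : ∀ k, T k →L[ℝ] ℝ),
    (∀ k ∈ Icc (j - N) (j + N - 1), ψ k = (ψ (k + 1)).comp (A k)) →
    (∀ k ∈ Icc (j - N) (j + N), ψ k (X k) = 0) →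
    ∃ k ∈ Icc (j - N) (j + N), 2 * ‖ψ j‖ ≤ ‖ψ k‖

/-- Keep `φ` at the right end `J` and solve the adjoint equation exactly towards the left. Each step
multiplies the accumulated error by at most `Λ`, and vanishing on `X` persists because `A` maps `X`
to `X`. -/
theorem exists_adjoint_solution {Λ : ℝ} (hΛ : 1 ≤ Λ) (hA : ∀ k, ‖A k‖ ≤ Λ)
    (hAX : ∀ k, A k (X k) = X (k + 1)) (φ : ∀ k, T k →L[ℝ] ℝ) (hφ : ∀ k, φ k (X k) = 0) (J : ℤ)
    (m : ℕ) : ∃ ψ : ∀ k, T k →L[ℝ] ℝ,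
      (∀ k ∈ Icc (J - m) (J - 1), ψ k = (ψ (k + 1)).comp (A k)) ∧
      (∀ k ∈ Icc (J - m) J, ψ k (X k) = 0 ∧
        ‖φ k - ψ k‖ ≤ Λ ^ m * ∑ i ∈ Finset.Icc (J - m) J, ‖φ i - (φ (i + 1)).comp (A i)‖) := by
  induction m with
  | zero =>
    refine ⟨φ, fun k hk ↦ ?_, fun k _ ↦ ⟨hφ k, ?_⟩⟩
    · have := hk.1.trans hk.2
      simp at this
    · simp
  | succ m ih =>
    obtain ⟨ψ, h1, h2⟩ := ih
    set i₀ : ℤ := J - ↑(m + 1) with hi₀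
    have hi₀' : i₀ + 1 = J - m := by rw [hi₀]; push_cast; ring
    refine ⟨Function.update ψ i₀ ((ψ (i₀ + 1)).comp (A i₀)), fun k hk ↦ ?_, fun k hk ↦ ?_⟩
    · have hne : k + 1 ≠ i₀ := by have := hk.1; omega
      rw [Function.update_of_ne hne]
      rcases eq_or_ne k i₀ with rfl | hk'
      · rw [Function.update_self]
      · rw [Function.update_of_ne hk']
        apply h1
        have := hk.1
        exact ⟨by omega, hk.2⟩
    · set G : ℤ → ℝ := fun i ↦ ‖φ i - (φ (i + 1)).comp (A i)‖ with hG
      have hG0 : ∀ i, 0 ≤ G i := fun i ↦ norm_nonneg _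
      have hsplit : ∑ i ∈ Finset.Icc i₀ J, G i = G i₀ + ∑ i ∈ Finset.Icc (J - m) J, G i := by
        rw [← hi₀', ← Finset.sum_insert]
        · congr 1
          ext i
          simp only [Finset.mem_insert, Finset.mem_Icc]
          omega
        · simp
      have hS0 : 0 ≤ ∑ i ∈ Finset.Icc (J - m) J, G i := Finset.sum_nonneg fun i _ ↦ hG0 i
      have hΛm : 1 ≤ Λ ^ m := one_le_pow₀ hΛ
      have hΛm' : Λ ^ m ≤ Λ ^ (m + 1) := pow_le_pow_right₀ hΛ (Nat.le_succ m)
      rcases eq_or_ne k i₀ with rfl | hk'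
      · rw [Function.update_self]
        obtain ⟨h3, h4⟩ := h2 (i₀ + 1) (by constructor <;> omega)
        refine ⟨by simp [hAX, h3], ?_⟩
        have e : φ i₀ - (ψ (i₀ + 1)).comp (A i₀) = (φ i₀ - (φ (i₀ + 1)).comp (A i₀))
            + (φ (i₀ + 1) - ψ (i₀ + 1)).comp (A i₀) := by
          ext v; simp
        rw [hsplit, e]
        calc _ ≤ G i₀ + ‖φ (i₀ + 1) - ψ (i₀ + 1)‖ * ‖A i₀‖ :=
              (norm_add_le _ _).trans (add_le_add le_rfl (ContinuousLinearMap.opNorm_comp_le _ _))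
          _ ≤ G i₀ + (Λ ^ m * ∑ i ∈ Finset.Icc (J - m) J, G i) * Λ := by
              gcongr
              exact hA _
          _ ≤ Λ ^ (m + 1) * (G i₀ + ∑ i ∈ Finset.Icc (J - m) J, G i) := by
              have h5 : G i₀ ≤ Λ ^ (m + 1) * G i₀ :=
                le_mul_of_one_le_left (hG0 _) (hΛm.trans hΛm')
              rw [mul_add, pow_succ]
              rw [pow_succ] at h5
              linarith
      · rw [Function.update_of_ne hk']
        obtain ⟨h3, h4⟩ := h2 k ⟨by have := hk.1; omega, hk.2⟩
        refine ⟨h3, h4.trans ?_⟩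
        rw [hsplit]
        have := hG0 i₀
        gcongr
        linarith

/-- Expansivity of the adjoint system with a window of size `N` implies the dual estimate, with a
constant which depends only on `N` and on the bound for the matrices. -/
theorem exists_dualEstimate_of_adjointExpansive (N : ℕ) (Λ : ℝ) (hΛ : 1 ≤ Λ) :
    ∃ L : ℝ, 0 ≤ L ∧ ∀ {T : ℤ → Type*} [∀ k, NormedAddCommGroup (T k)]
      [∀ k, InnerProductSpace ℝ (T k)] {A : ∀ k, T k →L[ℝ] T (k + 1)} {X : ∀ k, T k},
      (∀ k, ‖A k‖ ≤ Λ) → (∀ k, A k (X k) = X (k + 1)) → AdjointExpansive A X N →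
      DualEstimate A X L := by
  obtain ⟨K, hK0, hK⟩ := sum_le_of_window_estimate N
  refine ⟨K * (3 * Λ ^ (2 * N)), by positivity, ?_⟩
  intro T _ _ A X hA hAX hexp φ hX F h₀ h₁
  refine hK (3 * Λ ^ (2 * N)) (fun k ↦ ‖φ k‖) (fun k ↦ ‖φ k - (φ (k + 1)).comp (A k)‖) F
    (by positivity) (fun _ ↦ norm_nonneg _) (fun k hk ↦ by simp [h₀ k hk, h₁ k hk]) ?_ fun j ↦ ?_
  · refine ⟨∑ k ∈ F, ‖φ k‖, ?_⟩
    rintro _ ⟨k, rfl⟩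
    by_cases hk : k ∈ F
    · exact Finset.single_le_sum (f := fun k ↦ ‖φ k‖) (fun _ _ ↦ norm_nonneg _) hk
    · simp only [h₀ k hk, norm_zero]
      exact Finset.sum_nonneg fun _ _ ↦ norm_nonneg _
  -- On the window, `φ` is replaced by an exact solution up to an error `E`. Then `‖φ j‖ ≤ ‖ψ j‖ + E
  -- ≤ ‖ψ k‖ / 2 + E ≤ ‖φ k‖ / 2 + 3 E / 2`, and the constant `3` leaves room.
  · obtain ⟨ψ, h2, h3⟩ := exists_adjoint_solution hΛ hA hAX φ hX (j + N) (2 * N)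
    have e : j + (N : ℤ) - ↑(2 * N) = j - N := by push_cast; ring
    rw [e] at h2 h3
    obtain ⟨k, hk, hk2⟩ := hexp j ψ h2 fun k hk ↦ (h3 k hk).1
    refine ⟨k, by rw [abs_le]; have := hk.1; have := hk.2; omega, ?_⟩
    have h4 := (h3 k hk).2
    have h5 := (h3 j ⟨by omega, by omega⟩).2
    set E := Λ ^ (2 * N) * ∑ i ∈ Finset.Icc (j - (N : ℤ)) (j + N), ‖φ i - (φ (i + 1)).comp (A i)‖
      with hE
    have hE0 : 0 ≤ E := (norm_nonneg _).trans h4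
    have h6 : ‖φ j‖ ≤ ‖ψ j‖ + E := by
      have := norm_sub_norm_le (φ j) (ψ j); linarith
    have h7 : ‖ψ k‖ ≤ ‖φ k‖ + E := by
      have := norm_sub_norm_le (ψ k) (φ k); rw [norm_sub_rev] at this; linarith
    have h8 : 3 * Λ ^ (2 * N) * ∑ i ∈ Finset.Icc (j - (N : ℤ)) (j + N),
        ‖φ i - (φ (i + 1)).comp (A i)‖ = 3 * E := by rw [hE]; ring
    show ‖φ j‖ ≤ ‖φ k‖ / 2 + _
    rw [h8]
    linarith

end LinearSystems

/-! ### From the dual estimate back to bounded solutions, and the projected system on the whole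
line. -/

section LinearSystems

/-- Allows a dependent family to be prescribed at the indices `k + 1`, where the equations live,
without casts between `T k` and `T (k - 1 + 1)`. -/
theorem exists_pi_succ {P : ℤ → Type*} (f : ∀ k, P (k + 1)) :
    ∃ φ : ∀ k, P k, ∀ k, φ (k + 1) = f k :=
  ⟨Equiv.piCongrLeft P (Equiv.addRight (1 : ℤ)) f,
    fun k ↦ Equiv.piCongrLeft_apply_apply P (Equiv.addRight (1 : ℤ)) f k⟩

variable {T : ℤ → Type*} [∀ k, NormedAddCommGroup (T k)] [∀ k, InnerProductSpace ℝ (T k)]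
  {A : ∀ k, T k →L[ℝ] T (k + 1)} {X : ∀ k, T k}

/-- Otherwise the compact image of the `L`-ball under `x ↦ x_{k+1} - A_k x_k` misses the translate
by `z` of the sums of lines spanned by `X`. A separating functional has components `φ` vanishing on
`X`, and these violate the dual estimate. -/
theorem DualEstimate.boundedlySolvable [∀ k, FiniteDimensional ℝ (T k)] {L : ℝ} (hL : 0 ≤ L)
    (h : DualEstimate A X L) : BoundedlySolvable A X L := by
  classical
  intro z hz N
  have : ∀ k, ProperSpace (T k) := fun k ↦ FiniteDimensional.proper ℝ (T k)
  set F : Finset ℤ := Finset.Icc (-(N : ℤ)) N with hF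
  set κ : Finset ℤ := Finset.Icc (-(N : ℤ)) (N - 1) with hκ
  have hκF : κ ⊆ F := fun k hk ↦ by
    rw [hκ, Finset.mem_Icc] at hk
    rw [hF, Finset.mem_Icc]
    omega
  have hκF' : ∀ k ∈ κ, k + 1 ∈ F := fun k hk ↦ by
    rw [hκ, Finset.mem_Icc] at hk
    rw [hF, Finset.mem_Icc]
    omega
  let S : (∀ i : F, T i) →L[ℝ] (∀ k : κ, T (k + 1)) := ContinuousLinearMap.pi fun k ↦
    ContinuousLinearMap.proj (R := ℝ) (φ := fun i : F ↦ T i) ⟨k + 1, hκF' k k.2⟩ -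
      (A k).comp (ContinuousLinearMap.proj (R := ℝ) (φ := fun i : F ↦ T i) ⟨k, hκF k.2⟩)
  have hS : ∀ x k, S x k = x ⟨k + 1, hκF' k k.2⟩ - A k (x ⟨k, hκF k.2⟩) := fun x k ↦ rfl
  let W : Submodule ℝ (∀ k : κ, T (k + 1)) := Submodule.pi univ fun k ↦ Submodule.span ℝ {X (k + 1)}
  let zz : ∀ k : κ, T (k + 1) := fun k ↦ z (k + 1)
  by_contra hcon
  have hdisj : Disjoint (S '' Metric.closedBall 0 L) {g | g - zz ∈ W} := by
    rw [Set.disjoint_left]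
    rintro _ ⟨x, hx, rfl⟩ hW
    apply hcon
    have hW' : ∀ k : κ, ∃ s : ℝ, s • X (k + 1) = (S x - zz) k := fun k ↦
      Submodule.mem_span_singleton.mp (hW k (mem_univ k))
    choose s hs using hW'
    refine ⟨fun k ↦ if hk : k ∈ κ then s ⟨k, hk⟩ else 0,
      fun k ↦ if hk : k ∈ F then x ⟨k, hk⟩ else 0, fun k hk ↦ ?_, fun k hk ↦ ?_⟩
    · have hk' : k ∈ κ := Finset.mem_Icc.mpr hk
      simp only [dif_pos hk', dif_pos (hκF hk'), dif_pos (hκF' k hk')]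
      rw [hs ⟨k, hk'⟩]
      simp only [Pi.sub_apply, hS, zz]
      abel
    · have hk' : k ∈ F := Finset.mem_Icc.mpr hk
      simp only [dif_pos hk']
      rw [mem_closedBall_zero_iff, pi_norm_le_iff_of_nonneg hL] at hx
      exact hx ⟨k, hk'⟩
  have hconv : Convex ℝ {g | g - zz ∈ W} := by
    intro g₁ h₁ g₂ h₂ a b _ _ hab
    have : a • g₁ + b • g₂ - zz = a • (g₁ - zz) + b • (g₂ - zz) := by
      have : zz = (a + b) • zz := by rw [hab, one_smul]
      nth_rewrite 1 [this]
      module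
    show _ ∈ W
    rw [this]
    exact W.add_mem (W.smul_mem _ h₁) (W.smul_mem _ h₂)
  obtain ⟨f, u, v, hu, huv, hv⟩ := geometric_hahn_banach_compact_closed
    ((convex_closedBall (0 : ∀ i : F, T i) L).linear_image S.toLinearMap)
    ((isCompact_closedBall (0 : ∀ i : F, T i) L).image S.continuous) hconv
    (W.closed_of_finiteDimensional.preimage (continuous_id.sub continuous_const)) hdisj
  -- A linear functional bounded below on a translate of a subspace vanishes on the subspace.
  have hfW : ∀ w ∈ W, f w = 0 := by
    intro w hw
    by_contra hne
    have h1 := hv (zz + ((v - f zz) / f w) • w) (by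
      show _ ∈ W
      rw [add_sub_cancel_left]
      exact W.smul_mem _ hw)
    rw [map_add, map_smul, smul_eq_mul, div_mul_cancel₀ _ hne] at h1
    linarith
  obtain ⟨φ, hφ⟩ := exists_pi_succ (P := fun k ↦ T k →L[ℝ] ℝ) fun k ↦
    if hk : k ∈ κ then f.comp (ContinuousLinearMap.single ℝ (fun k : κ ↦ T (k + 1)) ⟨k, hk⟩) else 0
  have hφ1 : ∀ k (hk : k ∈ κ) (y : T (k + 1)),
      φ (k + 1) y = f (Pi.single (⟨k, hk⟩ : κ) y) := by
    intro k hk y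
    rw [hφ, dif_pos hk]
    rfl
  have hφ0 : ∀ k ∉ κ, φ (k + 1) = 0 := fun k hk ↦ by rw [hφ, dif_neg hk]
  have hf : ∀ y : ∀ k, T k, f (fun k : κ ↦ y (k + 1)) = ∑ k ∈ F, φ (k + 1) (y (k + 1)) := by
    intro y
    rw [← Finset.sum_subset hκF fun k _ hk ↦ by rw [hφ0 k hk]; rfl,
      ← Finset.univ_sum_single (fun k : κ ↦ y (k + 1)), map_sum,
      ← Finset.sum_coe_sort κ fun k ↦ φ (k + 1) (y (k + 1))]
    exact Finset.sum_congr rfl fun k _ ↦ (hφ1 k k.2 _).symm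
  have hsucc : ∀ k : ℤ, ∃ m : ℤ, k = m + 1 := fun k ↦ ⟨k - 1, by ring⟩
  have h₁ : ∀ k ∉ F, φ (k + 1) = 0 := fun k hk ↦ hφ0 k fun hk' ↦ hk (hκF hk')
  have h₀ : ∀ k ∉ F, φ k = 0 := by
    intro k hk
    obtain ⟨m, rfl⟩ := hsucc k
    exact hφ0 m fun hm ↦ hk (hκF' m hm)
  have hφX : ∀ k, φ k (X k) = 0 := by
    intro k
    obtain ⟨m, rfl⟩ := hsucc k
    by_cases hm : m ∈ κ
    · rw [hφ1 m hm]
      apply hfW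
      intro k _
      rcases eq_or_ne k ⟨m, hm⟩ with rfl | hne
      · rw [Pi.single_eq_same]
        exact Submodule.mem_span_singleton_self _
      · rw [Pi.single_eq_of_ne hne]
        exact Submodule.zero_mem _
    · rw [hφ0 m hm]; rfl
  choose y hy hgy using fun k ↦ exists_norming (φ k - (φ (k + 1)).comp (A k))
  have hshift : ∀ w : ∀ k, T k, ∑ k ∈ F, φ (k + 1) (w (k + 1)) = ∑ k ∈ F, φ k (w k) := fun w ↦
    sum_shift_eq (u := fun k ↦ φ k (w k)) (fun k hk ↦ by simp [h₀ k hk])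
      (fun k hk ↦ by simp [h₁ k hk])
  -- Norming vectors scaled by `L` lie in the ball, so the right-hand side of the dual estimate is a
  -- value of `f` on the compact set and hence less than `u`.
  have hval : f (S fun i ↦ L • y i) = L * ∑ k ∈ F, ‖φ k - (φ (k + 1)).comp (A k)‖ := by
    obtain ⟨w, hw⟩ := exists_pi_succ (P := T) fun k ↦ L • y (k + 1) - A k (L • y k)
    have e : (S fun i ↦ L • y i) = fun k : κ ↦ w (k + 1) := by
      ext k
      rw [hS, hw]
    rw [e, hf, Finset.mul_sum]
    calc ∑ k ∈ F, φ (k + 1) (w (k + 1))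
        = ∑ k ∈ F, φ (k + 1) (L • y (k + 1)) - ∑ k ∈ F, φ (k + 1) (A k (L • y k)) := by
          rw [← Finset.sum_sub_distrib]
          simp_rw [hw, map_sub]
      _ = ∑ k ∈ F, (φ k (L • y k) - φ (k + 1) (A k (L • y k))) := by
          rw [hshift fun k ↦ L • y k, Finset.sum_sub_distrib]
      _ = _ := by
          refine Finset.sum_congr rfl fun k _ ↦ ?_
          rw [← hgy k]
          simp
          ring
  have hlt : f (S fun i ↦ L • y i) < u := by
    apply hu
    refine ⟨_, ?_, rfl⟩
    rw [mem_closedBall_zero_iff, pi_norm_le_iff_of_nonneg hL]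
    intro i
    rw [norm_smul, Real.norm_of_nonneg hL]
    exact mul_le_of_le_one_right hL (hy i)
  have hzz : f zz ≤ L * ∑ k ∈ F, ‖φ k - (φ (k + 1)).comp (A k)‖ := by
    rw [hf z, hshift]
    refine (Finset.sum_le_sum fun k _ ↦ ?_).trans (h φ hφX F h₀ h₁)
    refine (le_abs_self _).trans (((φ k).le_opNorm (z k)).trans ?_)
    exact mul_le_of_le_one_right (norm_nonneg _) (hz k)
  have := hv zz (by simp [W.zero_mem])
  linarith

/-- A fixed nonprincipal ultrafilter gives limits for all indices `k` at once and replaces a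
diagonal choice of subsequences. -/
theorem exists_tendsto_hyperfilter {V : Type*} [NormedAddCommGroup V] [ProperSpace V] {v : ℕ → V}
    {C : ℝ} (h : ∀ᶠ n in (hyperfilter ℕ : Filter ℕ), ‖v n‖ ≤ C) :
    ∃ w, ‖w‖ ≤ C ∧ Tendsto v (hyperfilter ℕ) (𝓝 w) := by
  obtain ⟨w, hw, hlim⟩ := (isCompact_closedBall (0 : V) C).ultrafilter_le_nhds'
    ((hyperfilter ℕ).map v)
      (h.mono fun n hn ↦ show v n ∈ Metric.closedBall 0 C by simpa using hn)
  exact ⟨w, by simpa using hw, hlim⟩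

theorem eventually_hyperfilter_ge (n : ℕ) : ∀ᶠ m in (hyperfilter ℕ : Filter ℕ), n ≤ m :=
  (Nat.hyperfilter_le_atTop) (eventually_ge_atTop n)

/-- Bounded solvability of the systems modulo `X` on finite intervals implies bounded solvability
of the projected system on the whole line. -/
theorem BoundedlySolvable.projected [∀ k, FiniteDimensional ℝ (T k)] {L : ℝ}
    (h : BoundedlySolvable A X L) (hAX : ∀ k, A k (X k) = X (k + 1))
    (b : ∀ k, T k) (hb : ∀ k, b k ∈ (Submodule.span ℝ {X k})ᗮ) (hb1 : ∀ k, ‖b k‖ ≤ 1) :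
    ∃ v : ∀ k, T k, (∀ k, v k ∈ (Submodule.span ℝ {X k})ᗮ) ∧
      (∀ k, v (k + 1) = (Submodule.span ℝ {X (k + 1)})ᗮ.starProjection (A k (v k)) + b (k + 1)) ∧
      ∀ k, ‖v k‖ ≤ L := by
  have : ∀ k, ProperSpace (T k) := fun k ↦ FiniteDimensional.proper ℝ (T k)
  choose s x hx hxL using h b hb1
  set P : ∀ k, T k →L[ℝ] T k := fun k ↦ (Submodule.span ℝ {X k})ᗮ.starProjection with hP
  have hmem : ∀ k w, P k w ∈ (Submodule.span ℝ {X k})ᗮ := fun k w ↦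
    Submodule.starProjection_apply_mem _ _
  have hPX : ∀ k, P k (X k) = 0 := fun k ↦ by
    rw [hP, Submodule.starProjection_apply_eq_zero_iff]
    exact Submodule.le_orthogonal_orthogonal _ (Submodule.mem_span_singleton_self _)
  have hPb : ∀ k, P k (b k) = b k := fun k ↦ Submodule.starProjection_eq_self_iff.mpr (hb k)
  -- `w` and its projection differ by a multiple of `X k`, which `A k` sends to a multiple of `X (k
  -- + 1)`; so the projected sequence satisfies the projected system.
  have hPA : ∀ k w, P (k + 1) (A k (P k w)) = P (k + 1) (A k w) := by
    intro k w
    have h1 : w - P k w ∈ Submodule.span ℝ {X k} := by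
      have := Submodule.sub_starProjection_mem_orthogonal (K := (Submodule.span ℝ {X k})ᗮ) w
      rwa [Submodule.orthogonal_orthogonal] at this
    obtain ⟨a, ha⟩ := Submodule.mem_span_singleton.mp h1
    have h2 : w = P k w + a • X k := by rw [ha]; abel
    conv_rhs => rw [h2]
    simp [hAX, hPX]
  have hlim : ∀ k, ∃ w : T k, ‖w‖ ≤ L ∧ Tendsto (fun N ↦ P k (x N k)) (hyperfilter ℕ) (𝓝 w) := by
    intro k
    apply exists_tendsto_hyperfilter
    filter_upwards [eventually_hyperfilter_ge k.natAbs] with N hN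
    refine ((Submodule.norm_starProjection_apply_le _ _)).trans (hxL N k ?_)
    constructor <;> omega
  choose v hv hvlim using hlim
  refine ⟨v, fun k ↦ ?_, fun k ↦ ?_, hv⟩
  · exact (Submodule.isClosed_orthogonal _).mem_of_tendsto (hvlim k)
      (Eventually.of_forall fun N ↦ hmem k _)
  · have h1 : Tendsto (fun N ↦ P (k + 1) (A k (P k (x N k))) + b (k + 1)) (hyperfilter ℕ)
        (𝓝 (P (k + 1) (A k (v k)) + b (k + 1))) :=
      (((P (k + 1)).continuous.tendsto _).comp (((A k).continuous.tendsto _).comp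
        (hvlim k))).add_const _
    refine tendsto_nhds_unique (hvlim (k + 1)) (h1.congr' ?_)
    filter_upwards [eventually_hyperfilter_ge (k.natAbs + 1)] with N hN
    rw [hx N k (by constructor <;> omega)]
    simp [hPA, hPX, hPb]

end LinearSystems

/-! ### The Riemannian distance compared with the norm of one tangent space, in a chart. -/

section Metric

open MeasureTheory
open scoped ENNReal

variable {E : Type*} [NormedAddCommGroup E] [NormedSpace ℝ E]
  {M : Type*} [EMetricSpace M] [ChartedSpace E M] [IsManifold 𝓘(ℝ, E) 1 M]

/-- The identification of the model space with the tangent space at `p`. -/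
def toTangent (p : M) : E →L[ℝ] TangentSpace 𝓘(ℝ, E) p :=
  (trivializationAt E (TangentSpace 𝓘(ℝ, E)) p).symmL ℝ p

-- Only the norm changes: the vector is the same, but in the tangent space it is measured by the
-- metric at `p`.
@[simp] theorem toTangent_apply (p : M) (v : E) : toTangent p v = v := by
  unfold toTangent
  rw [TangentBundle.symmL_trivializationAt_eq_core (mem_chart_source E p)]
  exact (tangentBundleCore 𝓘(ℝ, E) M).coordChange_self (achart E p) p (mem_chart_source E p) v

theorem continuousLinearMapAt_symmL {p y : M} (hy : y ∈ (chartAt E p).source) (v : E) :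
    (trivializationAt E (TangentSpace 𝓘(ℝ, E)) p).continuousLinearMapAt ℝ y
      ((trivializationAt E (TangentSpace 𝓘(ℝ, E)) p).symmL ℝ y v) = v :=
  (trivializationAt E (TangentSpace 𝓘(ℝ, E)) p).continuousLinearMapAt_symmL
    (by simpa using hy) v

theorem mfderivWithin_extChartAt_comp {p : M} {γ : ℝ → M} {s : Set ℝ} {t : ℝ}
    (hγ : MDifferentiableWithinAt 𝓘(ℝ, ℝ) 𝓘(ℝ, E) γ s t) (hs : UniqueDiffWithinAt ℝ s t)
    (hp : γ t ∈ (chartAt E p).source) (v : ℝ) :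
    mfderivWithin 𝓘(ℝ, ℝ) 𝓘(ℝ, E) (extChartAt 𝓘(ℝ, E) p ∘ γ) s t v =
      (trivializationAt E (TangentSpace 𝓘(ℝ, E)) p).continuousLinearMapAt ℝ (γ t)
        (mfderivWithin 𝓘(ℝ, ℝ) 𝓘(ℝ, E) γ s t v) := by
  rw [TangentBundle.continuousLinearMapAt_trivializationAt hp]
  have h := mfderiv_comp_mfderivWithin (I := 𝓘(ℝ, ℝ)) (I' := 𝓘(ℝ, E)) (I'' := 𝓘(ℝ, E)) t
    (mdifferentiableAt_extChartAt (I := 𝓘(ℝ, E)) hp) hγ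
    (uniqueMDiffWithinAt_iff_uniqueDiffWithinAt.mpr hs)
  exact congrArg (fun f : ℝ →L[ℝ] E ↦ f v) h

theorem enorm_map_sub_le_lintegral {W V : Type*} [NormedAddCommGroup W] [NormedSpace ℝ W]
    [NormedAddCommGroup V] [NormedSpace ℝ V] (ι : W →L[ℝ] V) {g : ℝ → W}
    (hg : ContDiffOn ℝ 1 g (Icc 0 1)) :
    ‖ι (g 1 - g 0)‖ₑ ≤ ∫⁻ t in Icc (0 : ℝ) 1, ‖ι (derivWithin g (Icc 0 1) t)‖ₑ := by
  rw [map_sub]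
  refine (enorm_sub_le_lintegral_derivWithin_Icc_of_contDiffOn_Icc
    (ι.contDiff.comp_contDiffOn hg) zero_le_one).trans_eq ?_
  refine setLIntegral_congr_fun measurableSet_Icc fun t ht ↦ ?_
  have hu : UniqueDiffWithinAt ℝ (Icc (0 : ℝ) 1) t := uniqueDiffOn_Icc zero_lt_one t ht
  exact congrArg _ ((ι.hasFDerivAt.comp_hasDerivWithinAt t
    ((hg.differentiableOn one_ne_zero t ht).hasDerivWithinAt)).derivWithin hu)

theorem enorm_le_two_mul {V W : Type*} [SeminormedAddCommGroup V] [SeminormedAddCommGroup W]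
    {v : V} {w : W} (h : ‖v‖ ≤ 2 * ‖w‖) : ‖v‖ₑ ≤ 2 * ‖w‖ₑ := by
  rw [← ofReal_norm, ← ofReal_norm, ← ENNReal.ofReal_ofNat 2, ← ENNReal.ofReal_mul zero_le_two]
  exact ENNReal.ofReal_le_ofReal h

variable [RiemannianBundle (fun x : M ↦ TangentSpace 𝓘(ℝ, E) x)]
  [IsContinuousRiemannianBundle E (fun x : M ↦ TangentSpace 𝓘(ℝ, E) x)]

/-- Near `p`, the trivialization at `p` distorts norms at most by the factor two. -/
theorem eventually_norm_toTangent_le (p : M) : ∀ᶠ y in 𝓝 p, ∀ v : TangentSpace 𝓘(ℝ, E) y,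
    ‖toTangent p ((trivializationAt E (TangentSpace 𝓘(ℝ, E)) p).continuousLinearMapAt ℝ y v)‖
      ≤ 2 * ‖v‖ := by
  filter_upwards [eventually_norm_symmL_trivializationAt_self_comp_lt E
    (fun x : M ↦ TangentSpace 𝓘(ℝ, E) x) p one_lt_two] with y hy v
  exact ((((trivializationAt E (TangentSpace 𝓘(ℝ, E)) p).symmL ℝ p) ∘L
    ((trivializationAt E (TangentSpace 𝓘(ℝ, E)) p).continuousLinearMapAt ℝ y)).le_opNorm v).trans
    (by gcongr)

theorem eventually_norm_symmL_le (p : M) : ∀ᶠ y in 𝓝 p, ∀ v : E,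
    ‖(trivializationAt E (TangentSpace 𝓘(ℝ, E)) p).symmL ℝ y v‖ ≤ 2 * ‖toTangent p v‖ := by
  filter_upwards [eventually_norm_symmL_trivializationAt_comp_self_lt E
    (fun x : M ↦ TangentSpace 𝓘(ℝ, E) x) p one_lt_two] with y hy v
  have h := (((trivializationAt E (TangentSpace 𝓘(ℝ, E)) p).symmL ℝ y) ∘L
    ((trivializationAt E (TangentSpace 𝓘(ℝ, E)) p).continuousLinearMapAt ℝ p)).le_opNorm
    (toTangent p v)
  have e : (trivializationAt E (TangentSpace 𝓘(ℝ, E)) p).continuousLinearMapAt ℝ p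
      (toTangent p v) = v := continuousLinearMapAt_symmL (mem_chart_source E p) v
  rw [ContinuousLinearMap.comp_apply, e] at h
  exact h.trans (by gcongr)

variable [IsRiemannianManifold 𝓘(ℝ, E) M]

/-- The chart at `p` is locally `2`-Lipschitz for the norm of the tangent space at `p`. -/
theorem eventually_norm_extChartAt_sub_le (p : M) : ∃ u ∈ 𝓝 p, ∀ x ∈ u, ∀ y ∈ u,
    ‖toTangent p (extChartAt 𝓘(ℝ, E) p x - extChartAt 𝓘(ℝ, E) p y)‖ₑ ≤ 2 * edist x y := by
  have h1 : ∀ᶠ w in 𝓝 p, w ∈ (chartAt E p).source ∧ ∀ v : TangentSpace 𝓘(ℝ, E) w,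
      ‖toTangent p ((trivializationAt E (TangentSpace 𝓘(ℝ, E)) p).continuousLinearMapAt ℝ w v)‖
        ≤ 2 * ‖v‖ :=
    Filter.Eventually.and (chart_source_mem_nhds E p) (eventually_norm_toTangent_le p)
  obtain ⟨ε, hε, hball⟩ := Metric.nhds_basis_eball.eventually_iff.mp h1
  refine ⟨Metric.eball p (ε / 3), Metric.eball_mem_nhds _ (ENNReal.div_pos hε.ne' (by simp)),
    fun x hx y hy ↦ ?_⟩
  rw [Metric.mem_eball] at hx hy
  set φ := extChartAt 𝓘(ℝ, E) p with hφ
  have hxy : edist x y < ε / 3 + ε / 3 :=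
    (edist_triangle_right x y p).trans_lt (ENNReal.add_lt_add hx hy)
  have h3 : ε / 3 + ε / 3 + ε / 3 = ε := ENNReal.add_thirds ε
  rw [mul_comm, ← ENNReal.div_le_iff_le_mul (Or.inl two_ne_zero) (Or.inl ENNReal.ofNat_ne_top)]
  refine le_of_forall_gt_imp_ge_of_dense fun a ha ↦ ?_
  rw [ENNReal.div_le_iff_le_mul (Or.inl two_ne_zero) (Or.inl ENNReal.ofNat_ne_top), mul_comm]
  -- A nearly shortest curve from `x` to `y` is shorter than `2 ε / 3` and starts within `ε / 3` of
  -- `p`, so it stays in the ball where the trivialization distorts norms at most by two.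
  have hr := lt_min ha hxy
  rw [IsRiemannianManifold.out (I := 𝓘(ℝ, E)) x y] at hr
  obtain ⟨γ, hγx, hγy, hγs, hγ⟩ := exists_lt_of_riemannianEDist_lt hr
  have hstay : ∀ t ∈ Icc (0 : ℝ) 1, γ t ∈ Metric.eball p ε := by
    intro t ht
    have h4 : edist x (γ t) ≤ pathELength 𝓘(ℝ, E) γ 0 1 := by
      rw [IsRiemannianManifold.out (I := 𝓘(ℝ, E)) x (γ t)]
      exact (riemannianEDist_le_pathELength (hγs.mono (Icc_subset_Icc_right ht.2)) hγx rfl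
        ht.1).trans (pathELength_mono le_rfl ht.2)
    rw [Metric.mem_eball]
    calc edist (γ t) p ≤ edist x (γ t) + edist x p := edist_triangle_left _ _ _
      _ < (ε / 3 + ε / 3) + ε / 3 :=
        ENNReal.add_lt_add ((h4.trans_lt hγ).trans_le (min_le_right _ _)) hx
      _ = ε := h3
  have hcont : ContDiffOn ℝ 1 (φ ∘ γ) (Icc 0 1) := by
    rw [← contMDiffOn_iff_contDiffOn]
    exact (contMDiffOn_extChartAt (x := p)).comp hγs fun t ht ↦ (hball (hstay t ht)).1
  have hderiv : ∀ t ∈ Icc (0 : ℝ) 1, ‖toTangent p (derivWithin (φ ∘ γ) (Icc 0 1) t)‖ₑ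
      ≤ 2 * ‖mfderivWithin 𝓘(ℝ, ℝ) 𝓘(ℝ, E) γ (Icc 0 1) t 1‖ₑ := by
    intro t ht
    have hu : UniqueDiffWithinAt ℝ (Icc (0 : ℝ) 1) t := uniqueDiffOn_Icc zero_lt_one t ht
    have e2 : derivWithin (φ ∘ γ) (Icc 0 1) t =
        (trivializationAt E (TangentSpace 𝓘(ℝ, E)) p).continuousLinearMapAt ℝ (γ t)
          (mfderivWithin 𝓘(ℝ, ℝ) 𝓘(ℝ, E) γ (Icc 0 1) t (1 : ℝ)) := by
      rw [← mfderivWithin_extChartAt_comp (hγs.mdifferentiableOn one_ne_zero t ht) hu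
        (hball (hstay t ht)).1 1, ← fderivWithin_derivWithin]
      exact congrArg (fun f : ℝ →L[ℝ] E ↦ f 1) mfderivWithin_eq_fderivWithin.symm
    rw [e2]
    exact enorm_le_two_mul ((hball (hstay t ht)).2 _)
  calc ‖toTangent p (φ x - φ y)‖ₑ = ‖toTangent p (φ y - φ x)‖ₑ := by
        rw [map_sub, map_sub, ← enorm_neg, neg_sub]
    _ = ‖toTangent p (φ (γ 1) - φ (γ 0))‖ₑ := by rw [hγx, hγy]
    _ ≤ ∫⁻ t in Icc (0 : ℝ) 1, 2 * ‖mfderivWithin 𝓘(ℝ, ℝ) 𝓘(ℝ, E) γ (Icc 0 1) t 1‖ₑ :=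
        (enorm_map_sub_le_lintegral (W := E) (V := TangentSpace 𝓘(ℝ, E) p) (toTangent p) hcont).trans
          (setLIntegral_mono' measurableSet_Icc hderiv)
    _ = 2 * pathELength 𝓘(ℝ, E) γ 0 1 := by
        rw [lintegral_const_mul' _ _ ENNReal.ofNat_ne_top,
          pathELength_eq_lintegral_mfderivWithin_Icc]
    _ ≤ 2 * a := by
        gcongr
        exact hγ.le.trans (min_le_left _ _)

/-- The inverse chart at `p` is locally `2`-Lipschitz for the norm of the tangent space at `p`. -/
theorem eventually_edist_le (p : M) : ∃ u ∈ 𝓝 p, ∀ x ∈ u, ∀ y ∈ u,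
    edist x y ≤ 2 * ‖toTangent p (extChartAt 𝓘(ℝ, E) p x - extChartAt 𝓘(ℝ, E) p y)‖ₑ := by
  have h1 : ∀ᶠ w in 𝓝 (extChartAt 𝓘(ℝ, E) p p), w ∈ (extChartAt 𝓘(ℝ, E) p).target ∧
      ∀ v : E, ‖(trivializationAt E (TangentSpace 𝓘(ℝ, E)) p).symmL ℝ
        ((extChartAt 𝓘(ℝ, E) p).symm w) v‖ ≤ 2 * ‖toTangent p v‖ := by
    refine Filter.Eventually.and (extChartAt_target_mem_nhds (I := 𝓘(ℝ, E)) p) ?_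
    refine (continuousAt_extChartAt_symm (I := 𝓘(ℝ, E)) p).eventually
      (p := fun y ↦ ∀ v : E, ‖(trivializationAt E (TangentSpace 𝓘(ℝ, E)) p).symmL ℝ y v‖ ≤
        2 * ‖toTangent p v‖) ?_
    rw [extChartAt_to_inv]
    exact eventually_norm_symmL_le p
  obtain ⟨r, hr, hball⟩ := Metric.eventually_nhds_iff_ball.mp h1
  refine ⟨(extChartAt 𝓘(ℝ, E) p).source ∩ extChartAt 𝓘(ℝ, E) p ⁻¹'
    (Metric.ball (extChartAt 𝓘(ℝ, E) p p) r),
    inter_mem (extChartAt_source_mem_nhds p)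
      ((continuousAt_extChartAt p).preimage_mem_nhds (Metric.ball_mem_nhds _ hr)), ?_⟩
  rintro x ⟨hxs, hx⟩ y ⟨hys, hy⟩
  set φ := extChartAt 𝓘(ℝ, E) p with hφ
  -- The distance is bounded by the length of the preimage of the straight segment in the chart.
  let η := ContinuousAffineMap.lineMap (R := ℝ) (φ x) (φ y)
  have hη : ∀ t ∈ Icc (0 : ℝ) 1, η t ∈ Metric.ball (φ p) r := by
    intro t ht
    have h2 : η '' Icc 0 1 ⊆ Metric.ball (φ p) r := by
      simp only [ContinuousAffineMap.coe_lineMap_eq, ← segment_eq_image_lineMap, η]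
      exact (convex_ball _ _).segment_subset hx hy
    exact h2 ⟨t, ht, rfl⟩
  have hηs : ContMDiffOn 𝓘(ℝ, ℝ) 𝓘(ℝ, E) 1 η (Icc 0 1) := by
    rw [contMDiffOn_iff_contDiffOn]
    exact (ContinuousAffineMap.contDiff _).contDiffOn
  have hγs : ContMDiffOn 𝓘(ℝ, ℝ) 𝓘(ℝ, E) 1 (φ.symm ∘ η) (Icc 0 1) :=
    (contMDiffOn_extChartAt_symm p).comp hηs fun t ht ↦ (hball _ (hη t ht)).1
  rw [IsRiemannianManifold.out (I := 𝓘(ℝ, E)) x y]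
  refine (riemannianEDist_le_pathELength hγs (by simp [η, ContinuousAffineMap.coe_lineMap_eq, φ.left_inv hxs])
    (by simp [η, ContinuousAffineMap.coe_lineMap_eq, φ.left_inv hys]) zero_le_one).trans ?_
  rw [pathELength_eq_lintegral_mfderivWithin_Icc]
  have hbound : ∀ t ∈ Icc (0 : ℝ) 1, ‖mfderivWithin 𝓘(ℝ, ℝ) 𝓘(ℝ, E) (φ.symm ∘ η) (Icc 0 1) t 1‖ₑ
      ≤ 2 * ‖toTangent p (φ x - φ y)‖ₑ := by
    intro t ht
    have hw := hball _ (hη t ht)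
    have hsrc : φ.symm (η t) ∈ (chartAt E p).source := by
      have := φ.map_target hw.1
      simpa [hφ] using this
    have hd := mfderivWithin_extChartAt_comp (hγs.mdifferentiableOn one_ne_zero t ht)
      (uniqueDiffOn_Icc zero_lt_one t ht) hsrc (1 : ℝ)
    have e1 : mfderivWithin 𝓘(ℝ, ℝ) 𝓘(ℝ, E) (φ ∘ φ.symm ∘ η) (Icc 0 1) t =
        fderivWithin ℝ η (Icc 0 1) t :=
      (mfderivWithin_congr (fun s hs ↦ φ.right_inv (hball _ (hη s hs)).1)
        (φ.right_inv hw.1)).trans mfderivWithin_eq_fderivWithin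
    have e2 : fderivWithin ℝ η (Icc 0 1) t 1 = φ y - φ x := by
      rw [fderivWithin_eq_fderiv (uniqueDiffOn_Icc zero_lt_one _ ht)
        (ContinuousAffineMap.differentiableAt _)]
      simp [η]
    have e3 : (trivializationAt E (TangentSpace 𝓘(ℝ, E)) p).continuousLinearMapAt ℝ (φ.symm (η t))
        (mfderivWithin 𝓘(ℝ, ℝ) 𝓘(ℝ, E) (φ.symm ∘ η) (Icc 0 1) t (1 : ℝ)) = φ y - φ x :=
      hd.symm.trans ((congrArg (fun f : ℝ →L[ℝ] E ↦ f 1) e1).trans e2)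
    have e4 : mfderivWithin 𝓘(ℝ, ℝ) 𝓘(ℝ, E) (φ.symm ∘ η) (Icc 0 1) t (1 : ℝ) =
        (trivializationAt E (TangentSpace 𝓘(ℝ, E)) p).symmL ℝ (φ.symm (η t)) (φ y - φ x) := by
      rw [← e3]
      exact ((trivializationAt E (TangentSpace 𝓘(ℝ, E)) p).symmL_continuousLinearMapAt
        (by simpa using hsrc) _).symm
    have e5 : ‖mfderivWithin 𝓘(ℝ, ℝ) 𝓘(ℝ, E) (φ.symm ∘ η) (Icc 0 1) t (1 : ℝ)‖ₑ =
        ‖(trivializationAt E (TangentSpace 𝓘(ℝ, E)) p).symmL ℝ (φ.symm (η t)) (φ y - φ x)‖ₑ :=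
      congrArg (fun v : TangentSpace 𝓘(ℝ, E) (φ.symm (η t)) ↦ ‖v‖ₑ) e4
    refine e5.trans_le (enorm_le_two_mul ?_)
    have e6 : ‖toTangent p (φ x - φ y)‖ = ‖toTangent p (φ y - φ x)‖ := by
      rw [map_sub, map_sub, norm_sub_rev]
    rw [e6]
    exact hw.2 (φ y - φ x)
  calc _ ≤ ∫⁻ t in Icc (0 : ℝ) 1, 2 * ‖toTangent p (φ x - φ y)‖ₑ :=
        setLIntegral_mono' measurableSet_Icc hbound
    _ = _ := by simp

end Metric

/-! ### Differentiability of the local flow of a `C¹` field in a normed space. -/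

section LocalFlow

open Metric

variable {E : Type*} [NormedAddCommGroup E] [NormedSpace ℝ E]

/-- Trajectories of `Y` which start in `U` and stay in the ball `closedBall c r` up to time `τ`. -/
structure IsForwardFlowOn (Y : E → E) (c : E) (r τ : ℝ) (U : Set E) (φ : ℝ → E → E) : Prop where
  map_zero : ∀ x ∈ U, φ 0 x = x
  mem_ball : ∀ x ∈ U, ∀ t ∈ Icc 0 τ, φ t x ∈ closedBall c r
  hasDerivAt : ∀ x ∈ U, ∀ t ∈ Icc 0 τ, HasDerivAt (fun s ↦ φ s x) (Y (φ t x)) t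

namespace IsForwardFlowOn

variable {Y : E → E} {Y' : E → E →L[ℝ] E} {c : E} {r τ : ℝ} {U : Set E} {φ : ℝ → E → E} {K : ℝ≥0}

theorem continuousOn (h : IsForwardFlowOn Y c r τ U φ) {x : E} (hx : x ∈ U) :
    ContinuousOn (fun t ↦ φ t x) (Icc 0 τ) :=
  fun t ht ↦ (h.hasDerivAt x hx t ht).continuousAt.continuousWithinAt

theorem lipschitzOnWith_field (hd : ∀ y ∈ closedBall c r, HasFDerivAt Y (Y' y) y)
    (hK : ∀ y ∈ closedBall c r, ‖Y' y‖ ≤ K) : LipschitzOnWith K Y (closedBall c r) :=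
  (convex_closedBall c r).lipschitzOnWith_of_nnnorm_hasFDerivWithin_le
    (fun y hy ↦ (hd y hy).hasFDerivWithinAt) hK

theorem dist_le (h : IsForwardFlowOn Y c r τ U φ) (hd : ∀ y ∈ closedBall c r, HasFDerivAt Y (Y' y) y)
    (hK : ∀ y ∈ closedBall c r, ‖Y' y‖ ≤ K) {x y : E} (hx : x ∈ U) (hy : y ∈ U) {t : ℝ}
    (ht : t ∈ Icc 0 τ) : dist (φ t x) (φ t y) ≤ Real.exp (K * τ) * dist x y := by
  have h1 := dist_le_of_trajectories_ODE_of_mem (v := fun _ ↦ Y) (s := fun _ ↦ closedBall c r)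
    (fun _ _ ↦ lipschitzOnWith_field hd hK) (h.continuousOn hx)
    (fun t ht ↦ (h.hasDerivAt x hx t (Ico_subset_Icc_self ht)).hasDerivWithinAt)
    (fun t ht ↦ h.mem_ball x hx t (Ico_subset_Icc_self ht)) (h.continuousOn hy)
    (fun t ht ↦ (h.hasDerivAt y hy t (Ico_subset_Icc_self ht)).hasDerivWithinAt)
    (fun t ht ↦ h.mem_ball y hy t (Ico_subset_Icc_self ht)) le_rfl t ht
  simp only [h.map_zero x hx, h.map_zero y hy, sub_zero] at h1
  refine h1.trans ?_
  rw [mul_comm]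
  gcongr
  exact ht.2

/-- The variational equation along the trajectory of `x`. Within the unit ball about the identity,
operators have norm at most `2`, so the speed is at most `2 K`; `2 K τ ≤ 1` then lets
Picard-Lindelöf reach time `τ`. -/
theorem exists_linearization [CompleteSpace E] (h : IsForwardFlowOn Y c r τ U φ) (hτ : 0 ≤ τ)
    (hc : ContinuousOn Y' (closedBall c r))
    (hK : ∀ y ∈ closedBall c r, ‖Y' y‖ ≤ K) (hKτ : K * τ ≤ 1 / 2) {x : E} (hx : x ∈ U) :
    ∃ W : ℝ → E →L[ℝ] E, W 0 = ContinuousLinearMap.id ℝ E ∧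
      ∀ t ∈ Icc 0 τ, HasDerivWithinAt W ((Y' (φ t x)).comp (W t)) (Icc 0 τ) t := by
  let t₀ : Icc (0 : ℝ) τ := ⟨0, left_mem_Icc.mpr hτ⟩
  have hPL : IsPicardLindelof (fun t W ↦ (Y' (φ t x)).comp W) t₀ (ContinuousLinearMap.id ℝ E)
      1 0 (K * 2) K := by
    refine ⟨fun t ht ↦ ?_, fun W _ ↦ ?_, fun t ht W hW ↦ ?_, ?_⟩
    · refine LipschitzOnWith.of_dist_le_mul fun W₁ _ W₂ _ ↦ ?_
      rw [dist_eq_norm, dist_eq_norm, ← ContinuousLinearMap.comp_sub]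
      exact (ContinuousLinearMap.opNorm_comp_le _ _).trans
        (by gcongr; exact hK _ (h.mem_ball x hx t ht))
    · exact (hc.comp (h.continuousOn hx) (h.mem_ball x hx)).clm_comp continuousOn_const
    · refine (ContinuousLinearMap.opNorm_comp_le _ _).trans ?_
      have h1 := hK _ (h.mem_ball x hx t ht)
      have h2 : ‖W‖ ≤ 2 := by
        have h3 : ‖W - ContinuousLinearMap.id ℝ E‖ ≤ 1 := by simpa [dist_eq_norm] using hW
        have h4 := norm_le_norm_add_norm_sub' W (ContinuousLinearMap.id ℝ E)
        have h5 : ‖ContinuousLinearMap.id ℝ E‖ ≤ 1 := ContinuousLinearMap.norm_id_le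
        linarith
      push_cast
      gcongr
    · have : max (τ - ((t₀ : Icc (0 : ℝ) τ) : ℝ)) (((t₀ : Icc (0 : ℝ) τ) : ℝ) - 0) = τ := by
        simp [t₀, hτ]
      rw [this]
      push_cast
      linarith
  exact hPL.exists_eq_forall_mem_Icc_hasDerivWithinAt₀

/-- Grönwall is applied to `φ s y - φ s z - W s (y - z)` for two points `y`, `z` near `x`. Working
with two points makes the derivative strict, so that its continuity in `x` needs no separate proof.
In `ε / B ^ 2` one factor `B` pays for the Lipschitz bound of the flow and one for Grönwall; `1 ≤ K`
discards a division by `K`. -/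
theorem exists_hasStrictFDerivAt [ProperSpace E] [CompleteSpace E]
    (h : IsForwardFlowOn Y c r τ U φ) (hU : IsOpen U)
    (hd : ∀ y ∈ closedBall c r, HasFDerivAt Y (Y' y) y) (hc : ContinuousOn Y' (closedBall c r))
    (hK : ∀ y ∈ closedBall c r, ‖Y' y‖ ≤ K) (hK1 : 1 ≤ K) (hKτ : K * τ ≤ 1 / 2)
    {x : E} (hx : x ∈ U) {t : ℝ} (ht : t ∈ Icc 0 τ) :
    ∃ W : E →L[ℝ] E, HasStrictFDerivAt (φ t) W x := by
  have hτ : 0 ≤ τ := ht.1.trans ht.2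
  obtain ⟨W, hW0, hW⟩ := h.exists_linearization hτ hc hK hKτ hx
  refine ⟨W t, ?_⟩
  rw [hasStrictFDerivAt_iff_isLittleO, Asymptotics.isLittleO_iff]
  intro ε hε
  set B := Real.exp (K * τ) with hB
  have hB1 : 1 ≤ B := Real.one_le_exp (by positivity)
  have hB0 : 0 < B := by positivity
  have huc := (isCompact_closedBall c r).uniformContinuousOn_of_continuous hc
  rw [Metric.uniformContinuousOn_iff_le] at huc
  obtain ⟨ρ, hρ, hρY⟩ := huc (ε / B ^ 2) (by positivity)
  have hnear : ∀ᶠ y in 𝓝 x, y ∈ U ∧ dist y x ≤ ρ / B :=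
    Filter.Eventually.and (hU.mem_nhds hx) (closedBall_mem_nhds x (by positivity))
  rw [nhds_prod_eq]
  filter_upwards [hnear.prod_mk hnear] with p hp
  obtain ⟨⟨hy, hyx⟩, hz, hzx⟩ := hp
  set y := p.1
  set z := p.2
  have hclose : ∀ w ∈ U, dist w x ≤ ρ / B → ∀ s ∈ Icc 0 τ, φ s w ∈
      closedBall c r ∩ closedBall (φ s x) ρ := by
    intro w hw hwx s hs
    refine ⟨h.mem_ball w hw s hs, (h.dist_le hd hK hw hx hs).trans ?_⟩
    calc B * dist w x ≤ B * (ρ / B) := by gcongr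
      _ = ρ := by field_simp
  have hrem : ∀ s ∈ Icc 0 τ, ‖Y (φ s y) - Y (φ s z) - Y' (φ s x) (φ s y - φ s z)‖ ≤
      ε / B * ‖y - z‖ := by
    intro s hs
    have h1 := ((convex_closedBall c r).inter
      (convex_closedBall (φ s x) ρ)).norm_image_sub_le_of_norm_hasFDerivWithin_le'
      (f := Y) (f' := Y') (φ := Y' (φ s x)) (C := ε / B ^ 2)
      (fun w hw ↦ (hd w hw.1).hasFDerivWithinAt)
      (fun w hw ↦ by
        rw [← dist_eq_norm]
        exact hρY w hw.1 _ (h.mem_ball x hx s hs) hw.2)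
      (hclose z hz hzx s hs) (hclose y hy hyx s hs)
    refine h1.trans ?_
    have h2 := h.dist_le hd hK hy hz hs
    rw [dist_eq_norm, dist_eq_norm] at h2
    calc ε / B ^ 2 * ‖φ s y - φ s z‖ ≤ ε / B ^ 2 * (B * ‖y - z‖) := by gcongr
      _ = _ := by field_simp
  have hDd : ∀ s ∈ Icc 0 τ, HasDerivWithinAt (fun s ↦ φ s y - φ s z - W s (y - z))
      (Y (φ s y) - Y (φ s z) - Y' (φ s x) (W s (y - z))) (Icc 0 τ) s := by
    intro s hs
    refine ((h.hasDerivAt y hy s hs).hasDerivWithinAt.sub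
      (h.hasDerivAt z hz s hs).hasDerivWithinAt).sub ?_
    exact (hW s hs).clm_apply (hasDerivWithinAt_const s _ (y - z)) |>.congr_deriv (by simp)
  have hgron := norm_le_gronwallBound_of_norm_deriv_right_le (K := K) (δ := 0)
    (ε := ε / B * ‖y - z‖) (fun s hs ↦ (hDd s hs).continuousWithinAt)
    (fun s hs ↦ (hDd s (Ico_subset_Icc_self hs)).mono_of_mem_nhdsWithin
      (Icc_mem_nhdsGE_of_mem hs))
    (by simp [hW0, h.map_zero y hy, h.map_zero z hz])
    (fun s hs ↦ by
      have h1 := hrem s (Ico_subset_Icc_self hs)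
      have e : Y (φ s y) - Y (φ s z) - Y' (φ s x) (W s (y - z)) =
        Y' (φ s x) (φ s y - φ s z - W s (y - z)) +
          (Y (φ s y) - Y (φ s z) - Y' (φ s x) (φ s y - φ s z)) := by
        simp only [map_sub]; abel
      rw [e]
      refine (norm_add_le _ _).trans (add_le_add ?_ h1)
      exact ((Y' (φ s x)).le_opNorm _).trans (by
        gcongr
        exact hK _ (h.mem_ball x hx s (Ico_subset_Icc_self hs))))
    t ht
  refine hgron.trans ?_
  have hK0 : (K : ℝ) ≠ 0 := by
    have : (1 : ℝ) ≤ K := by exact_mod_cast hK1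
    positivity
  have hK1' : (1 : ℝ) ≤ K := by exact_mod_cast hK1
  rw [gronwallBound_of_K_ne_0 hK0]
  simp only [sub_zero, zero_mul, zero_add]
  have h3 : Real.exp (K * t) - 1 ≤ B := by
    have : Real.exp (K * t) ≤ B := by
      rw [hB]; gcongr; exact ht.2
    linarith
  calc ε / B * ‖y - z‖ / K * (Real.exp (K * t) - 1) ≤ ε / B * ‖y - z‖ / 1 * B := by
        gcongr
        exact sub_nonneg.mpr (Real.one_le_exp (mul_nonneg (by positivity) ht.1))
    _ = ε * ‖y - z‖ := by field_simp

end IsForwardFlowOn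
end LocalFlow

section StrictDerivative

variable {E F : Type*} [NormedAddCommGroup E] [NormedSpace ℝ E] [NormedAddCommGroup F]
  [NormedSpace ℝ F]

/-- A map with strict derivatives at all points of an open set is continuously differentiable. -/
theorem contDiffOn_one_of_hasStrictFDerivAt {f : E → F} {f' : E → E →L[ℝ] F} {U : Set E}
    (hU : IsOpen U) (h : ∀ x ∈ U, HasStrictFDerivAt f (f' x) x) : ContDiffOn ℝ 1 f U := by
  rw [show (1 : WithTop ℕ∞) = 0 + 1 from (zero_add 1).symm, contDiffOn_succ_iff_fderiv_of_isOpen hU,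
    contDiffOn_zero]
  refine ⟨fun x hx ↦ (h x hx).hasFDerivAt.differentiableAt.differentiableWithinAt,
    fun h0 ↦ by simp at h0, fun x hx ↦ ?_⟩
  refine ContinuousAt.continuousWithinAt ?_
  rw [Metric.continuousAt_iff']
  intro ε hε
  obtain ⟨s, hs, hlip⟩ := (h x hx).approximates_deriv_on_nhds (c := (ε / 2).toNNReal)
    (Or.inr (by simpa using hε))
  have hs' : ∀ᶠ y in 𝓝 x, s ∈ 𝓝 y := eventually_mem_nhds_iff.mpr hs
  filter_upwards [hs', hU.mem_nhds hx] with y hy hyU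
  rw [(h x hx).hasFDerivAt.fderiv, (h y hyU).hasFDerivAt.fderiv, dist_eq_norm]
  -- Near `x` the map `f - f' x` is `ε / 2`-Lipschitz, which bounds its derivative at every nearby
  -- point.
  have h1 : HasFDerivAt (fun z ↦ f z - f' x z) (f' y - f' x) y :=
    (h y hyU).hasFDerivAt.sub (f' x).hasFDerivAt
  have h2 : LipschitzOnWith (ε / 2).toNNReal (fun z ↦ f z - f' x z) s := hlip.lipschitzOnWith
  refine (h1.le_of_lipschitzOn hy h2).trans_lt ?_
  rw [Real.coe_toNNReal _ (by positivity)]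
  linarith

end StrictDerivative

/-! ### Local regularity of a flow on a manifold. -/

section FlowBox

open scoped ENNReal

variable {E : Type*} [NormedAddCommGroup E] [NormedSpace ℝ E]
  {M : Type*} [EMetricSpace M] [ChartedSpace E M] [IsManifold 𝓘(ℝ, E) ∞ M]

/-- The vector field `X` read in the chart at `c`. -/
def chartField (X : (x : M) → TangentSpace 𝓘(ℝ, E) x) (c : M) (w : E) : E :=
  (trivializationAt E (TangentSpace 𝓘(ℝ, E)) c).continuousLinearMapAt ℝ
    ((extChartAt 𝓘(ℝ, E) c).symm w) (X ((extChartAt 𝓘(ℝ, E) c).symm w))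

theorem hasDerivAt_extChartAt_comp {X : (x : M) → TangentSpace 𝓘(ℝ, E) x} {γ : ℝ → M} {t : ℝ}
    (hγ : HasMFDerivAt 𝓘(ℝ, ℝ) 𝓘(ℝ, E) γ t ((1 : ℝ →L[ℝ] ℝ).smulRight (X (γ t)))) {c : M}
    (hc : γ t ∈ (chartAt E c).source) :
    HasDerivAt (extChartAt 𝓘(ℝ, E) c ∘ γ) (chartField X c (extChartAt 𝓘(ℝ, E) c (γ t))) t := by
  have h1 : HasMFDerivAt 𝓘(ℝ, ℝ) 𝓘(ℝ, E) (extChartAt 𝓘(ℝ, E) c ∘ γ) t _ :=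
    HasMFDerivAt.comp t (mdifferentiableAt_extChartAt (I := 𝓘(ℝ, E)) hc).hasMFDerivAt hγ
  have h2 : HasFDerivAt (extChartAt 𝓘(ℝ, E) c ∘ γ) _ t := hasMFDerivAt_iff_hasFDerivAt.mp h1
  rw [hasDerivAt_iff_hasFDerivAt]
  refine h2.congr_fderiv ?_
  ext
  have e : (extChartAt 𝓘(ℝ, E) c).symm (extChartAt 𝓘(ℝ, E) c (γ t)) = γ t :=
    (extChartAt 𝓘(ℝ, E) c).left_inv (by simpa using hc)
  rw [chartField, e, TangentBundle.continuousLinearMapAt_trivializationAt hc]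
  exact (mfderiv 𝓘(ℝ, E) 𝓘(ℝ, E) (extChartAt 𝓘(ℝ, E) c) (γ t)).map_smul (1 : ℝ) (X (γ t))

theorem contDiffAt_chartField {X : (x : M) → TangentSpace 𝓘(ℝ, E) x}
    (hX : ContMDiff 𝓘(ℝ, E) 𝓘(ℝ, E).tangent 1 (fun x ↦ (⟨x, X x⟩ : TangentBundle 𝓘(ℝ, E) M)))
    (c : M) : ContDiffAt ℝ 1 (chartField X c) (extChartAt 𝓘(ℝ, E) c c) := by
  have h1 := (contMDiffAt_section (IB := 𝓘(ℝ, E)) (F := E) (n := 1) (s := X) c).mp (hX c)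
  have h2 := h1.comp_of_eq (contMDiffOn_extChartAt_symm (I := 𝓘(ℝ, E)) (n := 1) c |>.contMDiffAt
    (extChartAt_target_mem_nhds (I := 𝓘(ℝ, E)) c)) (extChartAt_to_inv c)
  rw [contMDiffAt_iff_contDiffAt] at h2
  refine h2.congr_of_eventuallyEq ?_
  filter_upwards [extChartAt_target_mem_nhds (I := 𝓘(ℝ, E)) c] with w hw
  have : (extChartAt 𝓘(ℝ, E) c).symm w ∈ (chartAt E c).source := by
    simpa using (extChartAt 𝓘(ℝ, E) c).map_target hw
  exact (trivializationAt E (TangentSpace 𝓘(ℝ, E)) c).continuousLinearMapAt_apply_of_mem (R := ℝ)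
    (b := (extChartAt 𝓘(ℝ, E) c).symm w) (by simpa using this) _

end FlowBox

section FlowBox

open Metric
open scoped ENNReal

variable {E : Type*} [NormedAddCommGroup E] [NormedSpace ℝ E]
  {M : Type*} [EMetricSpace M] [ChartedSpace E M] [IsManifold 𝓘(ℝ, E) ∞ M]

theorem exists_chartField_bounds [FiniteDimensional ℝ E] {X : (x : M) → TangentSpace 𝓘(ℝ, E) x}
    (hX : ContMDiff 𝓘(ℝ, E) 𝓘(ℝ, E).tangent 1 (fun x ↦ (⟨x, X x⟩ : TangentBundle 𝓘(ℝ, E) M)))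
    (c : M) {s : Set E} (hs : s ∈ 𝓝 (extChartAt 𝓘(ℝ, E) c c)) :
    ∃ r > 0, ∃ Y' : E → E →L[ℝ] E, ∃ K : ℝ≥0, 1 ≤ K ∧
      closedBall (extChartAt 𝓘(ℝ, E) c c) r ⊆ s ∧
      (∀ y ∈ closedBall (extChartAt 𝓘(ℝ, E) c c) r, HasFDerivAt (chartField X c) (Y' y) y) ∧
      ContinuousOn Y' (closedBall (extChartAt 𝓘(ℝ, E) c c) r) ∧
      (∀ y ∈ closedBall (extChartAt 𝓘(ℝ, E) c c) r, ‖Y' y‖ ≤ K) ∧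
      ∀ y ∈ closedBall (extChartAt 𝓘(ℝ, E) c c) r, ‖chartField X c y‖ ≤ K := by
  have := FiniteDimensional.proper ℝ E
  obtain ⟨Y', u, hu, hcont, hder⟩ := contDiffAt_one_iff.mp (contDiffAt_chartField hX c)
  obtain ⟨r, hr, hsub⟩ := nhds_basis_closedBall.mem_iff.mp (inter_mem hu hs)
  have hsub1 := hsub.trans inter_subset_left
  have hc' := hcont.mono hsub1
  have hd' : ∀ y ∈ closedBall (extChartAt 𝓘(ℝ, E) c c) r,
      HasFDerivAt (chartField X c) (Y' y) y := fun y hy ↦ hder y (hsub1 hy)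
  have hY : ContinuousOn (chartField X c) (closedBall (extChartAt 𝓘(ℝ, E) c c) r) :=
    fun y hy ↦ (hd' y hy).continuousAt.continuousWithinAt
  obtain ⟨K₁, hK₁⟩ := (isCompact_closedBall _ _).exists_bound_of_continuousOn hc'
  obtain ⟨K₂, hK₂⟩ := (isCompact_closedBall _ _).exists_bound_of_continuousOn hY
  have hK : max 1 (max K₁ K₂) ≤ ((max 1 (max K₁ K₂)).toNNReal : ℝ) := Real.le_coe_toNNReal _
  refine ⟨r, hr, Y', (max 1 (max K₁ K₂)).toNNReal, ?_, hsub.trans inter_subset_right, hd', hc',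
    fun y hy ↦ (hK₁ y hy).trans ?_, fun y hy ↦ (hK₂ y hy).trans ?_⟩
  · exact_mod_cast (le_max_left _ _).trans hK
  · exact ((le_max_left _ _).trans (le_max_right _ _)).trans hK
  · exact ((le_max_right _ _).trans (le_max_right _ _)).trans hK

variable {Φ : Flow ℝ M} {X : (x : M) → TangentSpace 𝓘(ℝ, E) x}

/-- Used with `e = 1` and `e = -1`: reversed time is the flow of the opposite field, so forward
estimates also cover negative times. -/
theorem isForwardFlowOn_extChartAt (hΦ : ∀ x, IsMIntegralCurve (fun t ↦ Φ t x) X) (c : M)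
    {e r τ : ℝ} {V : Set M}
    (hV : ∀ x ∈ V, ∀ t ∈ Icc 0 τ, Φ (e * t) x ∈ (chartAt E c).source ∧
      extChartAt 𝓘(ℝ, E) c (Φ (e * t) x) ∈ closedBall (extChartAt 𝓘(ℝ, E) c c) r) :
    IsForwardFlowOn (fun y ↦ e • chartField X c y) (extChartAt 𝓘(ℝ, E) c c) r τ
      ((extChartAt 𝓘(ℝ, E) c).target ∩ (extChartAt 𝓘(ℝ, E) c).symm ⁻¹' V)
      (fun t w ↦ extChartAt 𝓘(ℝ, E) c (Φ (e * t) ((extChartAt 𝓘(ℝ, E) c).symm w))) where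
  map_zero w hw := by
    simp only [mul_zero, Flow.map_zero_apply]
    exact (extChartAt 𝓘(ℝ, E) c).right_inv hw.1
  mem_ball w hw t ht := (hV _ hw.2 t ht).2
  hasDerivAt w hw t ht := by
    have h1 := hasDerivAt_extChartAt_comp (hΦ ((extChartAt 𝓘(ℝ, E) c).symm w) (e * t))
      (hV _ hw.2 t ht).1
    have h2 : HasDerivAt (fun s : ℝ ↦ e * s) e t := by
      simpa using (hasDerivAt_id t).const_mul e
    exact h1.scomp t h2

theorem exists_edist_extChartAt_bounds
    [RiemannianBundle (fun x : M ↦ TangentSpace 𝓘(ℝ, E) x)]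
    [IsContinuousRiemannianBundle E (fun x : M ↦ TangentSpace 𝓘(ℝ, E) x)]
    [IsRiemannianManifold 𝓘(ℝ, E) M] (c : M) :
    ∃ u ∈ 𝓝 c, ∃ C : ℝ≥0, ∀ x ∈ u, ∀ y ∈ u,
      edist x y ≤ C * ‖extChartAt 𝓘(ℝ, E) c x - extChartAt 𝓘(ℝ, E) c y‖ₑ ∧
      ‖extChartAt 𝓘(ℝ, E) c x - extChartAt 𝓘(ℝ, E) c y‖ₑ ≤ C * edist x y := by
  obtain ⟨u₁, hu₁, hu₁'⟩ := eventually_norm_extChartAt_sub_le (E := E) c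
  obtain ⟨u₂, hu₂, hu₂'⟩ := eventually_edist_le (E := E) c
  set ι := (trivializationAt E (TangentSpace 𝓘(ℝ, E)) c).continuousLinearMapAt ℝ c with hι
  have hιc : ∀ v : E, ι (toTangent c v) = v := fun v ↦ by
    rw [hι, toTangent]
    exact continuousLinearMapAt_symmL (mem_chart_source E c) v
  have hfrom : ∀ v : E, ‖v‖ₑ ≤ ‖ι‖ₑ * ‖toTangent c v‖ₑ := fun v ↦ by
    conv_lhs => rw [← hιc v]
    exact ι.le_opENorm _
  refine ⟨u₁ ∩ u₂, inter_mem hu₁ hu₂, 2 * max ‖toTangent (E := E) c‖₊ ‖ι‖₊,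
    fun x hx y hy ↦ ⟨?_, ?_⟩⟩
  · refine (hu₂' x hx.2 y hy.2).trans ?_
    push_cast
    rw [mul_assoc]
    gcongr
    refine ((toTangent (E := E) (M := M) c).le_opENorm _).trans ?_
    gcongr
    exact le_max_left _ _
  · refine (hfrom _).trans ?_
    push_cast
    rw [mul_comm 2, mul_assoc]
    gcongr
    · exact le_max_right _ _
    · exact hu₁' x hx.1 y hy.1

/-- The global flow is jointly continuous at `(0, c)`, which keeps short trajectories in the chart
ball. The time is shortened further to `1 / (2 K)`, as the linearization requires. -/
theorem exists_local_flow [FiniteDimensional ℝ E]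
    (hX : ContMDiff 𝓘(ℝ, E) 𝓘(ℝ, E).tangent 1 (fun x ↦ (⟨x, X x⟩ : TangentBundle 𝓘(ℝ, E) M)))
    (c : M) {s : Set M} (hs : s ∈ 𝓝 c) :
    ∃ V : Set M, IsOpen V ∧ c ∈ V ∧ V ⊆ (chartAt E c).source ∩ s ∧ ∃ T : ℝ, 0 < T ∧ ∃ r : ℝ,
      ∃ Y' : E → E →L[ℝ] E, ∃ K : ℝ≥0, 1 ≤ K ∧ (K : ℝ) * T ≤ 1 / 2 ∧
      (∀ y ∈ closedBall (extChartAt 𝓘(ℝ, E) c c) r, HasFDerivAt (chartField X c) (Y' y) y) ∧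
      ContinuousOn Y' (closedBall (extChartAt 𝓘(ℝ, E) c c) r) ∧
      (∀ y ∈ closedBall (extChartAt 𝓘(ℝ, E) c c) r, ‖Y' y‖ ≤ K) ∧
      (∀ y ∈ closedBall (extChartAt 𝓘(ℝ, E) c c) r, ‖chartField X c y‖ ≤ K) ∧
      ∀ t, |t| ≤ T → ∀ x ∈ V, Φ t x ∈ (chartAt E c).source ∧
        extChartAt 𝓘(ℝ, E) c (Φ t x) ∈ closedBall (extChartAt 𝓘(ℝ, E) c c) r ∧ Φ t x ∈ s := by
  set φ := extChartAt 𝓘(ℝ, E) c with hφ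
  obtain ⟨r, hr, Y', K, hK1, -, hd, hc, hK, hKY⟩ := exists_chartField_bounds hX c (univ_mem)
  set τ : ℝ := 1 / (2 * K) with hτ
  have hKpos : (0 : ℝ) < K := lt_of_lt_of_le one_pos (by exact_mod_cast hK1)
  have hopen : ∀ᶠ x in 𝓝 c, x ∈ (chartAt E c).source ∧ φ x ∈ closedBall (φ c) r ∧ x ∈ s := by
    refine Filter.Eventually.and (chart_source_mem_nhds E c) (Filter.Eventually.and ?_ hs)
    exact (continuousAt_extChartAt (I := 𝓘(ℝ, E)) c) (closedBall_mem_nhds _ hr)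
  have hjoint : ∀ᶠ q : ℝ × M in 𝓝 (0, c), Φ q.1 q.2 ∈ (chartAt E c).source ∧
      φ (Φ q.1 q.2) ∈ closedBall (φ c) r ∧ Φ q.1 q.2 ∈ s := by
    have h : Tendsto (Function.uncurry Φ.toFun) (𝓝 (0, c)) (𝓝 c) := by
      have := (Φ.cont'.tendsto (0, c))
      rwa [Function.uncurry_apply_pair, Φ.map_zero'] at this
    exact h.eventually hopen
  rw [nhds_prod_eq] at hjoint
  obtain ⟨pa, hpa, V₀, hV₀, hprod⟩ := (Filter.eventually_prod_iff.mp hjoint)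
  obtain ⟨σ, hσ, hσ'⟩ := nhds_basis_closedBall.eventually_iff.mp hpa
  obtain ⟨V, hVV₀, hVo, hcV⟩ := eventually_nhds_iff.mp (Filter.Eventually.and hV₀ hopen)
  refine ⟨V, hVo, hcV, fun x hx ↦ ⟨(hVV₀ x hx).2.1, (hVV₀ x hx).2.2.2⟩, min τ σ,
    lt_min (by positivity) hσ, r, Y', K, hK1, ?_, hd, hc, hK, hKY, fun t ht x hx ↦
    hprod (hσ' (by simpa using ht.trans (min_le_right _ _))) (hVV₀ x hx).1⟩
  calc (K : ℝ) * min τ σ ≤ K * τ := by gcongr; exact min_le_left _ _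
    _ = 1 / 2 := by rw [hτ]; field_simp

theorem exists_sign_mul {t T : ℝ} (ht : |t| ≤ T) : ∃ e : ℝ, |e| = 1 ∧ ∃ t' ∈ Icc 0 T, t = e * t' := by
  rcases le_total 0 t with h | h
  · exact ⟨1, by simp, t, ⟨h, (le_abs_self t).trans ht⟩, by simp⟩
  · exact ⟨-1, by simp, -t, ⟨by linarith, (neg_le_abs t).trans ht⟩, by simp⟩

theorem enorm_le_coe_mul {V W : Type*} [SeminormedAddCommGroup V] [SeminormedAddCommGroup W]
    {v : V} {w : W} {K : ℝ≥0} (h : ‖v‖ ≤ K * ‖w‖) : ‖v‖ₑ ≤ K * ‖w‖ₑ := by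
  rw [enorm_eq_nnnorm, enorm_eq_nnnorm]
  exact_mod_cast h

theorem exists_flow_box [FiniteDimensional ℝ E]
    [RiemannianBundle (fun x : M ↦ TangentSpace 𝓘(ℝ, E) x)]
    [IsContinuousRiemannianBundle E (fun x : M ↦ TangentSpace 𝓘(ℝ, E) x)]
    [IsRiemannianManifold 𝓘(ℝ, E) M]
    (hX : ContMDiff 𝓘(ℝ, E) 𝓘(ℝ, E).tangent 1 (fun x ↦ (⟨x, X x⟩ : TangentBundle 𝓘(ℝ, E) M)))
    (hΦ : ∀ x, IsMIntegralCurve (fun t ↦ Φ t x) X) (c : M) :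
    ∃ u, IsOpen u ∧ c ∈ u ∧ ∃ τ > 0, ∃ C : ℝ≥0,
      (∀ t, |t| ≤ τ → ∀ x ∈ u, ∀ y ∈ u, edist (Φ t x) (Φ t y) ≤ C * edist x y) ∧
      (∀ s t, |s| ≤ τ → |t| ≤ τ → ∀ x ∈ u, edist (Φ s x) (Φ t x) ≤ C * ‖s - t‖ₑ) ∧
      ∀ t, |t| ≤ τ → ∀ x ∈ u, ContMDiffAt 𝓘(ℝ, E) 𝓘(ℝ, E) 1 (Φ t) x := by
  have := FiniteDimensional.proper ℝ E
  obtain ⟨s, hs, A, hA⟩ := exists_edist_extChartAt_bounds (E := E) c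
  obtain ⟨V, hVo, hcV, hVs, T, hTpos, r, Y', K, hK1, hKT, hd, hc, hK, hKY, key⟩ :=
    exists_local_flow (Φ := Φ) hX c hs
  set φ := extChartAt 𝓘(ℝ, E) c with hφ
  set U := φ.target ∩ φ.symm ⁻¹' V with hU
  have hUo : IsOpen U := (continuousOn_extChartAt_symm (I := 𝓘(ℝ, E)) c).isOpen_inter_preimage
    (isOpen_extChartAt_target (I := 𝓘(ℝ, E)) c) hVo
  have hmemU : ∀ x ∈ V, φ x ∈ U ∧ φ.symm (φ x) = x := fun x hx ↦ by
    have hxs : x ∈ φ.source := by simpa [hφ] using (hVs hx).1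
    refine ⟨⟨φ.map_source hxs, ?_⟩, φ.left_inv hxs⟩
    rw [mem_preimage, φ.left_inv hxs]
    exact hx
  have hflow : ∀ e : ℝ, |e| = 1 → IsForwardFlowOn (fun y ↦ e • chartField X c y) (φ c) r T U
      (fun t w ↦ φ (Φ (e * t) (φ.symm w))) := fun e he ↦
    isForwardFlowOn_extChartAt hΦ c fun x hx t ht ↦ by
      have := key (e * t) (by rw [abs_mul, he, one_mul, abs_of_nonneg ht.1]; exact ht.2) x hx
      exact ⟨this.1, this.2.1⟩
  have hd' : ∀ e : ℝ, ∀ y ∈ closedBall (φ c) r,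
      HasFDerivAt (fun y ↦ e • chartField X c y) (e • Y' y) y := fun e y hy ↦ (hd y hy).const_smul e
  have hK' : ∀ e : ℝ, |e| = 1 → ∀ y ∈ closedBall (φ c) r, ‖e • Y' y‖ ≤ K := fun e he y hy ↦ by
    rw [norm_smul, Real.norm_eq_abs, he, one_mul]
    exact hK y hy
  refine ⟨V, hVo, hcV, T, hTpos, A * (max K (Real.exp (K * T)).toNNReal * max 1 A), ?_, ?_, ?_⟩
  · intro t ht x hx y hy
    obtain ⟨e, he, t', ht', rfl⟩ := exists_sign_mul ht
    have h1 := (hflow e he).dist_le (hd' e) (hK' e he) (hmemU x hx).1 (hmemU y hy).1 ht'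
    rw [(hmemU x hx).2, (hmemU y hy).2, dist_eq_norm, dist_eq_norm] at h1
    refine (hA _ (key _ ht x hx).2.2 _ (key _ ht y hy).2.2).1.trans ?_
    push_cast
    rw [mul_assoc, mul_assoc]
    gcongr
    refine (enorm_le_coe_mul (K := (Real.exp (K * T)).toNNReal) ?_).trans
      (mul_le_mul' (le_max_right _ _) (((hA x (hVs hx).2 y (hVs hy).2).2.trans
      (mul_le_mul_left (le_max_right _ _) _))))
    rwa [Real.coe_toNNReal _ (Real.exp_nonneg _)]
  · intro s t hs ht x hx
    have h2 : ‖φ (Φ s x) - φ (Φ t x)‖ ≤ K * ‖s - t‖ :=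
      (convex_Icc (-T) T).norm_image_sub_le_of_norm_hasDerivWithin_le
        (f := fun s ↦ φ (Φ s x)) (f' := fun w ↦ chartField X c (φ (Φ w x)))
        (fun w hw ↦ (hasDerivAt_extChartAt_comp (hΦ x w)
          (key w (abs_le.mpr hw) x hx).1).hasDerivWithinAt)
        (fun w hw ↦ hKY _ (key w (abs_le.mpr hw) x hx).2.1) (abs_le.mp ht) (abs_le.mp hs)
    refine (hA _ (key _ hs x hx).2.2 _ (key _ ht x hx).2.2).1.trans ?_
    push_cast
    rw [mul_assoc, mul_assoc]
    gcongr
    refine (enorm_le_coe_mul h2).trans (mul_le_mul' (le_max_left _ _) ?_)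
    conv_lhs => rw [← one_mul ‖s - t‖ₑ]
    gcongr
    exact le_max_left _ _
  · intro t ht x hx
    obtain ⟨e, he, t', ht', rfl⟩ := exists_sign_mul ht
    choose! W hW using fun w (hw : w ∈ U) ↦ (hflow e he).exists_hasStrictFDerivAt hUo (hd' e)
      (hc.const_smul e) (hK' e he) (by exact_mod_cast hK1) hKT hw ht'
    have h1 : ContDiffAt ℝ 1 (fun w ↦ φ (Φ (e * t') (φ.symm w))) (φ x) :=
      (contDiffOn_one_of_hasStrictFDerivAt hUo hW).contDiffAt (hUo.mem_nhds (hmemU x hx).1)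
    have h2 : ContMDiffAt 𝓘(ℝ, E) 𝓘(ℝ, E) 1
        (fun y ↦ φ (Φ (e * t') (φ.symm (φ y)))) x :=
      h1.contMDiffAt.comp x (contMDiffAt_extChartAt' (I := 𝓘(ℝ, E)) (hVs hx).1)
    have hmem : φ (Φ (e * t') (φ.symm (φ x))) ∈ φ.target := by
      rw [(hmemU x hx).2]
      exact φ.map_source (by simpa [hφ] using (key _ ht x hx).1)
    have h3 := (contMDiffOn_extChartAt_symm (I := 𝓘(ℝ, E)) (n := 1) c).contMDiffAt
      ((isOpen_extChartAt_target (I := 𝓘(ℝ, E)) c).mem_nhds hmem)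
    refine (h3.comp x h2).congr_of_eventuallyEq ?_
    filter_upwards [hVo.mem_nhds hx] with y hy
    simp only [Function.comp_apply]
    rw [(hmemU y hy).2]
    exact (φ.left_inv (by simpa [hφ] using (key _ ht y hy).1)).symm

end FlowBox

/-! ### Uniform estimates for the flow on a compact manifold. -/

section CompactFlow

open scoped ENNReal

theorem flow_natCast_mul {M : Type*} [TopologicalSpace M] (Φ : Flow ℝ M) (t : ℝ) (n : ℕ) (x : M) :
    Φ (n * t) x = (Φ t)^[n] x := by
  induction n with
  | zero => simp
  | succ n ih => rw [Function.iterate_succ_apply', ← ih, ← Φ.map_add]; push_cast; ring_nf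

theorem flow_eq_iterate {M : Type*} [TopologicalSpace M] (Φ : Flow ℝ M) (t : ℝ) {n : ℕ}
    (hn : n ≠ 0) : Φ t = (Φ (t / n))^[n] := by
  ext x
  rw [← flow_natCast_mul]
  field_simp

theorem exists_natCast_div_le (T : ℝ) {τ : ℝ} (hτ : 0 < τ) :
    ∃ n : ℕ, n ≠ 0 ∧ ∀ t, |t| ≤ T → |t / n| ≤ τ := by
  obtain ⟨n, hn⟩ := exists_nat_ge (T / τ)
  refine ⟨n + 1, by simp, fun t ht ↦ ?_⟩
  have hpos : (0 : ℝ) < (n + 1 : ℕ) := by positivity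
  rw [abs_div, abs_of_pos hpos, div_le_iff₀ hpos]
  rw [div_le_iff₀ hτ] at hn
  push_cast
  nlinarith

variable {E : Type*} [NormedAddCommGroup E] [NormedSpace ℝ E] [FiniteDimensional ℝ E]
  {M : Type*} [EMetricSpace M] [ChartedSpace E M] [IsManifold 𝓘(ℝ, E) ∞ M] [CompactSpace M]
  [RiemannianBundle (fun x : M ↦ TangentSpace 𝓘(ℝ, E) x)]
  [IsContinuousRiemannianBundle E (fun x : M ↦ TangentSpace 𝓘(ℝ, E) x)]
  [IsRiemannianManifold 𝓘(ℝ, E) M]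
  {Φ : Flow ℝ M} {X : (x : M) → TangentSpace 𝓘(ℝ, E) x}

/-- Finitely many flow boxes suffice. Two points share a box only when closer than a Lebesgue
number, hence the restriction to `edist x y < δ`. -/
theorem exists_uniform_flow_box
    (hX : ContMDiff 𝓘(ℝ, E) 𝓘(ℝ, E).tangent 1 (fun x ↦ (⟨x, X x⟩ : TangentBundle 𝓘(ℝ, E) M)))
    (hΦ : ∀ x, IsMIntegralCurve (fun t ↦ Φ t x) X) :
    ∃ τ : ℝ, 0 < τ ∧ ∃ C : ℝ≥0, ∃ δ : ℝ≥0, 0 < δ ∧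
      (∀ t, |t| ≤ τ → ∀ x y, edist x y < δ → edist (Φ t x) (Φ t y) ≤ C * edist x y) ∧
      (∀ s t, |s| ≤ τ → |t| ≤ τ → ∀ x, edist (Φ s x) (Φ t x) ≤ C * ‖s - t‖ₑ) ∧
      ∀ t, |t| ≤ τ → ContMDiff 𝓘(ℝ, E) 𝓘(ℝ, E) 1 (Φ t) := by
  choose u huo hu τ hτ C h1 h2 h3 using fun c ↦ exists_flow_box (Φ := Φ) hX hΦ c
  obtain ⟨F, hF⟩ := isCompact_univ.elim_finite_subcover u huo
    (fun x _ ↦ mem_iUnion.mpr ⟨x, hu x⟩)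
  obtain ⟨δ, hδ, hleb⟩ := lebesgue_number_lemma_of_emetric (c := fun i : F ↦ u i) isCompact_univ
    (fun i ↦ huo i) (hF.trans (by simp [iUnion_subtype]))
  obtain ⟨δ', hδ', hδδ'⟩ := ENNReal.lt_iff_exists_nnreal_btwn.mp hδ
  obtain ⟨T, hT, hTpos⟩ := (((Filter.eventually_all_finset F).mpr fun c _ ↦
    Ioo_mem_nhdsGT (hτ c)).and (self_mem_nhdsWithin (s := Ioi (0 : ℝ)))).exists
  have hle : ∀ c ∈ F, (C c : ℝ≥0∞) ≤ (F.sup C : ℝ≥0) := fun c hc ↦ by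
    exact_mod_cast Finset.le_sup (f := C) hc
  have hcov : ∀ x, ∃ c ∈ F, x ∈ u c := fun x ↦ by simpa using hF (mem_univ x)
  refine ⟨T, hTpos, F.sup C, δ', by exact_mod_cast hδ', fun t ht x y hxy ↦ ?_,
    fun s t hs ht x ↦ ?_, fun t ht x ↦ ?_⟩
  · obtain ⟨c, hc⟩ := hleb x (mem_univ x)
    refine (h1 c t (ht.trans (hT c c.2).2.le) x (hc (Metric.mem_eball_self hδ)) y (hc ?_)).trans
      (mul_le_mul_left (hle c c.2) _)
    rw [Metric.mem_eball, edist_comm]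
    exact hxy.trans hδδ'
  · obtain ⟨c, hc, hxc⟩ := hcov x
    exact (h2 c s t (hs.trans (hT c hc).2.le) (ht.trans (hT c hc).2.le) x hxc).trans
      (mul_le_mul_left (hle c hc) _)
  · obtain ⟨c, hc, hxc⟩ := hcov x
    exact h3 c t (ht.trans (hT c hc).2.le) x hxc

/-- A long time is cut into `n` short steps; each moves every point by at most `C |h / n|`, so the
constant does not grow with time. -/
theorem exists_edist_flow_flow_le
    (hX : ContMDiff 𝓘(ℝ, E) 𝓘(ℝ, E).tangent 1 (fun x ↦ (⟨x, X x⟩ : TangentBundle 𝓘(ℝ, E) M)))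
    (hΦ : ∀ x, IsMIntegralCurve (fun t ↦ Φ t x) X) :
    ∃ C : ℝ≥0, ∀ s t x, edist (Φ s x) (Φ t x) ≤ C * ‖s - t‖ₑ := by
  obtain ⟨τ, hτ, C, δ, hδ, -, h2, -⟩ := exists_uniform_flow_box hX hΦ
  have h0 : ∀ h x, edist (Φ h x) x ≤ C * ‖h‖ₑ := fun h x ↦ by
    obtain ⟨n, hn, hle⟩ := exists_natCast_div_le |h| hτ
    have key : ∀ k : ℕ, edist ((Φ (h / n))^[k] x) x ≤ k * (C * ‖h / n‖ₑ) := fun k ↦ by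
      induction k with
      | zero => simp
      | succ k ih =>
        rw [Function.iterate_succ_apply']
        have h3 := h2 (h / n) 0 (hle h le_rfl) (by simpa using hτ.le) ((Φ (h / n))^[k] x)
        rw [Φ.map_zero_apply, sub_zero] at h3
        push_cast
        rw [add_mul, one_mul, add_comm]
        exact (edist_triangle _ _ _).trans (add_le_add h3 ih)
    rw [flow_eq_iterate Φ h hn]
    refine (key n).trans_eq ?_
    rw [mul_left_comm]
    congr 1
    have : ((n : ℝ≥0∞)) = ‖(n : ℝ)‖ₑ := by simp
    rw [this, ← enorm_mul]
    congr 1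
    field_simp
  refine ⟨C, fun s t x ↦ ?_⟩
  have := h0 (s - t) (Φ t x)
  rwa [← Φ.map_add, sub_add_cancel] at this

/-- For points at distance at least `δ`, including infinite distance, each point moves by at most `C
τ`, which is at most `C τ / δ` times their distance. Iteration then extends short times to `|t| ≤
T`. -/
theorem exists_lipschitzWith_flow
    (hX : ContMDiff 𝓘(ℝ, E) 𝓘(ℝ, E).tangent 1 (fun x ↦ (⟨x, X x⟩ : TangentBundle 𝓘(ℝ, E) M)))
    (hΦ : ∀ x, IsMIntegralCurve (fun t ↦ Φ t x) X) (T : ℝ) :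
    ∃ Λ : ℝ≥0, ∀ t, |t| ≤ T → LipschitzWith Λ (Φ t) := by
  obtain ⟨τ, hτ, C, δ, hδ, h1, h2, -⟩ := exists_uniform_flow_box hX hΦ
  have h0 : ∀ t, |t| ≤ τ → LipschitzWith (max C (2 * C * τ.toNNReal / δ + 1)) (Φ t) := by
    intro t ht x y
    rcases lt_or_ge (edist x y) δ with h | h
    · exact (h1 t ht x y h).trans (mul_le_mul_left (by exact_mod_cast le_max_left _ _) _)
    · have h3 : ∀ z, edist (Φ t z) z ≤ C * τ.toNNReal := fun z ↦ by
        have h3 := h2 t 0 ht (by simpa using hτ.le) z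
        rw [Φ.map_zero_apply, sub_zero] at h3
        refine h3.trans ?_
        gcongr
        rw [← ofReal_norm]
        exact ENNReal.ofReal_le_ofReal ht
      refine (edist_triangle4 (Φ t x) x y (Φ t y)).trans ?_
      rw [edist_comm y]
      calc edist (Φ t x) x + edist x y + edist (Φ t y) y
          ≤ C * τ.toNNReal + edist x y + C * τ.toNNReal := by
            gcongr
            exacts [h3 x, h3 y]
        _ = ((2 * C * τ.toNNReal / δ : ℝ≥0) : ℝ≥0∞) * δ + edist x y := by
            have h4 : ((2 * C * τ.toNNReal / δ : ℝ≥0) : ℝ≥0∞) * δ = (2 * C * τ.toNNReal : ℝ≥0) := by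
              rw [← ENNReal.coe_mul, div_mul_cancel₀ _ hδ.ne']
            rw [h4]
            push_cast
            ring
        _ ≤ ((2 * C * τ.toNNReal / δ : ℝ≥0) : ℝ≥0∞) * edist x y + edist x y := by gcongr
        _ = ((2 * C * τ.toNNReal / δ + 1 : ℝ≥0) : ℝ≥0∞) * edist x y := by
            rw [ENNReal.coe_add, add_mul, ENNReal.coe_one, one_mul]
        _ ≤ _ := by
            gcongr
            exact le_max_right _ _
  obtain ⟨n, hn, hle⟩ := exists_natCast_div_le T hτ
  refine ⟨(max C (2 * C * τ.toNNReal / δ + 1)) ^ n, fun t ht ↦ ?_⟩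
  rw [flow_eq_iterate Φ t hn]
  exact (h0 _ (hle t ht)).iterate n

theorem contMDiff_flow
    (hX : ContMDiff 𝓘(ℝ, E) 𝓘(ℝ, E).tangent 1 (fun x ↦ (⟨x, X x⟩ : TangentBundle 𝓘(ℝ, E) M)))
    (hΦ : ∀ x, IsMIntegralCurve (fun t ↦ Φ t x) X) (t : ℝ) :
    ContMDiff 𝓘(ℝ, E) 𝓘(ℝ, E) 1 (Φ t) := by
  obtain ⟨τ, hτ, C, δ, hδ, -, -, h3⟩ := exists_uniform_flow_box hX hΦ
  obtain ⟨n, hn, hle⟩ := exists_natCast_div_le |t| hτ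
  rw [flow_eq_iterate Φ t hn]
  exact (h3 _ (hle t le_rfl)).iterate n

end CompactFlow

/-! ### Smooth approximation of continuous maps into a compact manifold. -/

section SmoothApproximation

open Metric

variable {E : Type*} [NormedAddCommGroup E] [NormedSpace ℝ E] [FiniteDimensional ℝ E]
  {M : Type*} [EMetricSpace M] [ChartedSpace E M] [IsManifold 𝓘(ℝ, E) ∞ M]
  {E' : Type*} [NormedAddCommGroup E'] [NormedSpace ℝ E'] [FiniteDimensional ℝ E']
  {H' : Type*} [TopologicalSpace H'] {J : ModelWithCorners ℝ E' H'}
  {N : Type*} [TopologicalSpace N] [ChartedSpace H' N] [IsManifold J ∞ N] [SigmaCompactSpace N]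
  [T2Space N] [NormalSpace N]

/-- A smooth map to the model space which agrees with the chart at `c` on a given closed subset of
its domain. -/
theorem exists_contMDiff_eqOn_extChartAt [SigmaCompactSpace M] {c : M} {D : Set M} (hD : IsClosed D)
    (hDc : D ⊆ (chartAt E c).source) :
    ∃ h : M → E, ContMDiff 𝓘(ℝ, E) 𝓘(ℝ, E) ∞ h ∧ EqOn h (extChartAt 𝓘(ℝ, E) c) D := by
  obtain ⟨θ, h0, h1, -⟩ := exists_contMDiffMap_zero_one_nhds_of_isClosed 𝓘(ℝ, E) (n := ⊤)
    (chartAt E c).open_source.isClosed_compl hD (disjoint_compl_left_iff_subset.mpr hDc)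
  refine ⟨fun x ↦ θ x • extChartAt 𝓘(ℝ, E) c x, fun x ↦ ?_, fun x hx ↦ ?_⟩
  · by_cases hx : x ∈ (chartAt E c).source
    · exact θ.contMDiff.contMDiffAt.smul (contMDiffAt_extChartAt' hx)
    · refine (contMDiffAt_const (c := (0 : E))).congr_of_eventuallyEq ?_
      filter_upwards [mem_nhdsSet_iff_forall.mp h0 x hx] with y hy
      simp [show θ y = 0 from hy]
  · have := h1.self_of_nhdsSet x hx
    simp [this]

/-- One chart at a time: where `F` enters the chart, its coordinates are moved towards a smooth
approximation `g` by a cut-off `χ` equal to `1` near `K`. This gains smoothness near `K`, keeps it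
where `F` was smooth, and leaves the values on `S` unchanged since `g` agrees there. -/
theorem exists_smooth_approx_step [SigmaCompactSpace M] {F : N → M} (hF : Continuous F)
    {S U K : Set N} (hS : IsClosed S) (hU : IsOpen U) (hSU : S ⊆ U)
    (hFU : ∀ q ∈ U, ContMDiffAt J 𝓘(ℝ, E) ∞ F q) (hK : IsClosed K) {c : M} {D D' : Set M}
    (hD' : IsCompact D') (hDD' : D ⊆ interior D') (hD'c : D' ⊆ (chartAt E c).source)
    (hKD : MapsTo F K D) {ε : ENNReal} (hε : 0 < ε) :
    ∃ G : N → M, Continuous G ∧ (∀ q, edist (G q) (F q) < ε) ∧ EqOn G F S ∧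
      ∃ V, IsOpen V ∧ U ∪ K ⊆ V ∧ ∀ q ∈ V, ContMDiffAt J 𝓘(ℝ, E) ∞ G q := by
  classical
  set φ := extChartAt 𝓘(ℝ, E) c with hφ
  obtain ⟨h, hh, hhD⟩ := exists_contMDiff_eqOn_extChartAt hD'.isClosed hD'c
  have hφD : ContinuousOn φ D' := (continuousOn_extChartAt c).mono (by simpa using hD'c)
  have hC : IsCompact (φ '' D') := hD'.image_of_continuousOn hφD
  have hCt : φ '' D' ⊆ φ.target := by
    rintro _ ⟨x, hx, rfl⟩
    exact φ.map_source (by simpa [hφ] using hD'c hx)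
  obtain ⟨δ₁, hδ₁, hthick⟩ := hC.exists_thickening_subset_open
    (isOpen_extChartAt_target (I := 𝓘(ℝ, E)) c) hCt
  -- `δ₁` keeps the modified coordinates in the chart's target; `δ₂` makes the displacement in `M`
  -- less than `ε`.
  have huc := hC.uniformContinuousAt_of_continuousAt φ.symm
    (fun w hw ↦ continuousAt_extChartAt_symm'' (I := 𝓘(ℝ, E)) (hCt hw))
    (edist_mem_uniformity hε)
  obtain ⟨δ₂, hδ₂, huc⟩ := Metric.mem_uniformity_dist.mp huc
  obtain ⟨g, hgf, hgS, -⟩ := (hh.continuous.comp hF).exists_contMDiff_approx_and_eqOn J ⊤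
    (continuous_const (y := min δ₁ δ₂)) (fun _ ↦ lt_min hδ₁ hδ₂) hS (hU.mem_nhdsSet.mpr hSU)
    (fun q hq ↦ (hh.contMDiffAt.comp q (hFU q hq)).contMDiffWithinAt)
  set W : Set N := F ⁻¹' interior D' with hW
  have hWo : IsOpen W := isOpen_interior.preimage hF
  obtain ⟨χ, hχ0, hχ1, hχ⟩ := exists_contMDiffMap_zero_one_nhds_of_isClosed J (n := ⊤)
    hWo.isClosed_compl hK (disjoint_compl_left_iff_subset.mpr fun q hq ↦ hDD' (hKD hq))
  set w : N → E := fun q ↦ h (F q) + χ q • (g q - h (F q)) with hw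
  set G : N → M := fun q ↦ if q ∈ W then φ.symm (w q) else F q with hG
  have hhF : ∀ q ∈ W, h (F q) = φ (F q) := fun q hq ↦ hhD (interior_subset hq)
  have hFs : ∀ q ∈ W, F q ∈ φ.source := fun q hq ↦ by
    simpa [hφ] using hD'c (interior_subset hq)
  have hwd : ∀ q ∈ W, dist (φ (F q)) (w q) < min δ₁ δ₂ := fun q hq ↦ by
    rw [← hhF q hq, dist_eq_norm, hw]
    simp only [sub_add_cancel_left, norm_neg, norm_smul, Real.norm_eq_abs, abs_of_nonneg (hχ q).1]
    refine (mul_le_of_le_one_left (norm_nonneg _) (hχ q).2).trans_lt ?_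
    rw [← dist_eq_norm]
    exact hgf q
  have hwt : ∀ q ∈ W, w q ∈ φ.target := fun q hq ↦ hthick (mem_thickening_iff.mpr
    ⟨φ (F q), mem_image_of_mem _ (interior_subset hq),
      by rw [dist_comm]; exact (hwd q hq).trans_le (min_le_left _ _)⟩)
  have hGF : ∀ q, χ q = 0 → G q = F q := fun q hq ↦ by
    by_cases hqW : q ∈ W
    · simp only [hG, hqW, if_true, hw, hq, zero_smul, add_zero, hhF q hqW]
      exact φ.left_inv (hFs q hqW)
    · simp [hG, hqW]
  have hGW : ∀ q ∈ W, G =ᶠ[𝓝 q] fun q ↦ φ.symm (w q) := fun q hq ↦ by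
    filter_upwards [hWo.mem_nhds hq] with p hp
    simp [hG, hp]
  have hGW' : ∀ q ∉ W, G =ᶠ[𝓝 q] F := fun q hq ↦ by
    filter_upwards [mem_nhdsSet_iff_forall.mp hχ0 q hq] with p hp
    exact hGF p hp
  have hwc : Continuous w := (hh.continuous.comp hF).add
    (χ.contMDiff.continuous.smul (g.contMDiff.continuous.sub (hh.continuous.comp hF)))
  have hwsm : ∀ q ∈ W, ContMDiffAt J 𝓘(ℝ, E) ∞ w q → ContMDiffAt J 𝓘(ℝ, E) ∞ G q :=
    fun q hq hwq ↦ by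
      have h3 := (contMDiffOn_extChartAt_symm (I := 𝓘(ℝ, E)) (n := ∞) c).contMDiffAt
        ((isOpen_extChartAt_target (I := 𝓘(ℝ, E)) c).mem_nhds (hwt q hq))
      exact (h3.comp q hwq).congr_of_eventuallyEq (hGW q hq)
  obtain ⟨V₁, hV₁o, hKV₁, hV₁⟩ := mem_nhdsSet_iff_exists.mp hχ1
  refine ⟨G, ?_, fun q ↦ ?_, fun q hq ↦ ?_, U ∪ (V₁ ∩ W), hU.union (hV₁o.inter hWo),
    union_subset_union_right _ (subset_inter hKV₁ fun q hq ↦ hDD' (hKD hq)), ?_⟩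
  · rw [continuous_iff_continuousAt]
    intro q
    by_cases hq : q ∈ W
    · exact ((continuousAt_extChartAt_symm'' (I := 𝓘(ℝ, E)) (hwt q hq)).comp
        hwc.continuousAt).congr (hGW q hq).symm
    · exact hF.continuousAt.congr (hGW' q hq).symm
  · by_cases hq : q ∈ W
    · have h1 := huc ((hwd q hq).trans_le (min_le_right _ _))
        (mem_image_of_mem _ (interior_subset hq))
      simp only [hG, hq, if_true]
      rw [edist_comm]
      have h2 : edist (φ.symm (φ (F q))) (φ.symm (w q)) < ε := h1
      rwa [φ.left_inv (hFs q hq)] at h2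
    · simpa [hG, hq] using hε
  · by_cases hqW : q ∈ W
    · have : g q = h (F q) := hgS hq
      simp only [hG, hqW, if_true, hw, this, sub_self, smul_zero, add_zero, hhF q hqW]
      exact φ.left_inv (hFs q hqW)
    · simp [hG, hqW]
  · rintro q (hq | ⟨hq, hqW⟩)
    · by_cases hqW : q ∈ W
      · refine hwsm q hqW ?_
        have h1 := hh.contMDiffAt.comp q (hFU q hq)
        exact h1.add (χ.contMDiff.contMDiffAt.smul (g.contMDiff.contMDiffAt.sub h1))
      · exact (hFU q hq).congr_of_eventuallyEq (hGW' q hqW)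
    · refine hwsm q hqW (g.contMDiff.contMDiffAt.congr_of_eventuallyEq ?_)
      filter_upwards [hV₁o.mem_nhds hq] with p hp
      have : χ p = 1 := hV₁ hp
      simp [hw, this]

/-- A continuous map to a compact manifold which is smooth near a closed set is uniformly
approximated by smooth maps with the same values on that set. -/
theorem exists_contMDiff_edist_lt [CompactSpace M] {F : N → M} (hF : Continuous F)
    {S U : Set N} (hS : IsClosed S) (hU : IsOpen U) (hSU : S ⊆ U)
    (hFU : ∀ q ∈ U, ContMDiffAt J 𝓘(ℝ, E) ∞ F q) {ε : ENNReal} (hε : 0 < ε) :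
    ∃ G : N → M, ContMDiff J 𝓘(ℝ, E) ∞ G ∧ (∀ q, edist (G q) (F q) < ε) ∧ EqOn G F S := by
  classical
  have hball : ∀ c : M, ∃ r : ENNReal, 0 < r ∧ r ≠ ⊤ ∧ closedEBall c r ⊆ (chartAt E c).source :=
    fun c ↦ by
      obtain ⟨r, hr, hrs⟩ := nhds_basis_closedEBall.mem_iff.mp (chart_source_mem_nhds E c)
      exact ⟨min r 1, lt_min hr one_pos, ne_top_of_le_ne_top ENNReal.one_ne_top (min_le_right _ _),
        (closedEBall_subset_closedEBall (min_le_left _ _)).trans hrs⟩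
  choose r hr hrt hrs using hball
  -- The sets to be smoothed are preimages under the original `F` of balls of radius `r c / 4`. An
  -- earlier approximation within `r c / 4` still maps them into the ball of radius `r c / 2`,
  -- inside the next chart.
  have hind : ∀ T : Finset M, ∀ ε : ENNReal, 0 < ε → ∃ G : N → M, Continuous G ∧
      (∀ q, edist (G q) (F q) < ε) ∧ EqOn G F S ∧ ∃ V, IsOpen V ∧ U ⊆ V ∧
      (⋃ c ∈ T, F ⁻¹' closedEBall c (r c / 2 / 2)) ⊆ V ∧ ∀ q ∈ V, ContMDiffAt J 𝓘(ℝ, E) ∞ G q := by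
    intro T
    induction T using Finset.induction_on with
    | empty => exact fun ε hε ↦ ⟨F, hF, fun _ ↦ by simpa using hε, fun _ _ ↦ rfl, U, hU, le_rfl, by simp, hFU⟩
    | insert c T hc ih =>
      intro ε hε
      obtain ⟨G₁, hG₁c, hG₁, hG₁S, V, hVo, hUV, hTV, hG₁V⟩ := ih (min (ε / 2) (r c / 2 / 2))
        (lt_min (ENNReal.half_pos hε.ne') (ENNReal.half_pos (ENNReal.half_pos (hr c).ne').ne'))
      have hint : closedEBall c (r c / 2) ⊆ interior (closedEBall c (r c)) := by
        refine subset_trans ?_ (interior_maximal eball_subset_closedEBall isOpen_eball)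
        intro x hx
        exact lt_of_le_of_lt hx (ENNReal.half_lt_self (hr c).ne' (hrt c))
      have hmaps : MapsTo G₁ (F ⁻¹' closedEBall c (r c / 2 / 2)) (closedEBall c (r c / 2)) := by
        intro q hq
        have h1 : edist (F q) c ≤ r c / 2 / 2 := hq
        have h2 : r c / 2 / 2 + r c / 2 / 2 = r c / 2 := ENNReal.add_halves _
        show edist (G₁ q) c ≤ r c / 2
        rw [← h2]
        exact (edist_triangle _ (F q) _).trans
          (add_le_add ((hG₁ q).le.trans (min_le_right _ _)) h1)
      obtain ⟨G, hGc, hG, hGS, V', hV'o, hVV', hGV'⟩ := exists_smooth_approx_step (c := c)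
        (K := F ⁻¹' closedEBall c (r c / 2 / 2)) (D := closedEBall c (r c / 2))
        (D' := closedEBall c (r c)) hG₁c hS hVo
        (hSU.trans hUV) hG₁V (isClosed_closedEBall.preimage hF) isClosed_closedEBall.isCompact
        hint (hrs c) hmaps (ENNReal.half_pos hε.ne')
      · refine ⟨G, hGc, fun q ↦ ?_, fun q hq ↦ (hGS hq).trans (hG₁S hq), V', hV'o,
          hUV.trans (subset_union_left.trans hVV'), ?_, hGV'⟩
        · calc edist (G q) (F q) ≤ edist (G q) (G₁ q) + edist (G₁ q) (F q) := edist_triangle _ _ _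
            _ < ε / 2 + ε / 2 := ENNReal.add_lt_add (hG q) ((hG₁ q).trans_le (min_le_left _ _))
            _ = ε := ENNReal.add_halves ε
        · rw [Finset.set_biUnion_insert]
          exact union_subset (subset_union_right.trans hVV')
            (hTV.trans (subset_union_left.trans hVV'))
  obtain ⟨T, -, hT⟩ := isCompact_univ.elim_nhds_subcover (fun c : M ↦ closedEBall c (r c / 2 / 2))
    (fun c _ ↦ closedEBall_mem_nhds _ (ENNReal.half_pos (ENNReal.half_pos (hr c).ne').ne'))
  obtain ⟨G, -, hG, hGS, V, -, -, hTV, hGV⟩ := hind T ε hε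
  refine ⟨G, fun q ↦ hGV q (hTV ?_), hG, hGS⟩
  have := hT (mem_univ (F q))
  simpa using this

end SmoothApproximation

/-! ### Charts as maps to and from tangent spaces, and the linearization of maps. -/

section TangentCoordinates

variable {E : Type*} [NormedAddCommGroup E] [NormedSpace ℝ E]
  {M : Type*} [EMetricSpace M] [ChartedSpace E M] [IsManifold 𝓘(ℝ, E) 1 M]

/-- The identification of the tangent space at `p` with the model space. -/
def ofTangent (p : M) : TangentSpace 𝓘(ℝ, E) p →L[ℝ] E :=
  (trivializationAt E (TangentSpace 𝓘(ℝ, E)) p).continuousLinearMapAt ℝ p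

theorem ofTangent_toTangent (p : M) (v : E) :
    ofTangent (E := E) p (toTangent (E := E) p v) = v :=
  continuousLinearMapAt_symmL (mem_chart_source E p) v

theorem ofTangent_apply (p : M) (v : TangentSpace 𝓘(ℝ, E) p) : ofTangent (E := E) p v = v :=
  (congrArg (ofTangent (E := E) p) (toTangent_apply (E := E) p v)).symm.trans
    (ofTangent_toTangent (E := E) p v)

theorem toTangent_ofTangent (p : M) (v : TangentSpace 𝓘(ℝ, E) p) :
    toTangent (E := E) p (ofTangent (E := E) p v) = v :=
  (toTangent_apply (E := E) p _).trans (ofTangent_apply p v)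

/-- The chart at `p`, as a map to the tangent space at `p` which vanishes at `p`. -/
def chartLog (p : M) (x : M) : TangentSpace 𝓘(ℝ, E) p :=
  toTangent p (extChartAt 𝓘(ℝ, E) p x - extChartAt 𝓘(ℝ, E) p p)

/-- The inverse of the chart at `p`, as a map from the tangent space at `p`. -/
def chartExp (p : M) (v : TangentSpace 𝓘(ℝ, E) p) : M :=
  (extChartAt 𝓘(ℝ, E) p).symm (extChartAt 𝓘(ℝ, E) p p + ofTangent p v)

@[simp] theorem chartLog_self (p : M) : chartLog (E := E) p p = 0 := by
  simp only [chartLog, sub_self]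
  exact map_zero (toTangent (E := E) p)

@[simp] theorem chartExp_zero (p : M) : chartExp p (0 : TangentSpace 𝓘(ℝ, E) p) = p := by
  rw [chartExp, map_zero, add_zero]
  exact extChartAt_to_inv p

theorem chartExp_chartLog {p x : M} (hx : x ∈ (chartAt E p).source) :
    chartExp p (chartLog (E := E) p x) = x := by
  rw [chartExp, chartLog, ofTangent_toTangent, add_sub_cancel]
  exact (extChartAt 𝓘(ℝ, E) p).left_inv (by simpa using hx)

theorem eventually_chartLog_chartExp (p : M) : ∀ᶠ v : TangentSpace 𝓘(ℝ, E) p in 𝓝 0,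
    chartLog p (chartExp p v) = v ∧ ContinuousAt (chartExp p) v ∧
      chartExp p v ∈ (chartAt E p).source := by
  have h1 : Tendsto (fun v : TangentSpace 𝓘(ℝ, E) p ↦ extChartAt 𝓘(ℝ, E) p p + ofTangent p v)
      (𝓝 0) (𝓝 (extChartAt 𝓘(ℝ, E) p p)) := by
    have : Continuous fun v : TangentSpace 𝓘(ℝ, E) p ↦ extChartAt 𝓘(ℝ, E) p p + ofTangent p v :=
      continuous_const.add (ofTangent p).continuous
    simpa using this.tendsto 0
  filter_upwards [h1 (extChartAt_target_mem_nhds (I := 𝓘(ℝ, E)) p)] with v hv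
  refine ⟨?_, ?_, ?_⟩
  · rw [chartLog, chartExp, (extChartAt 𝓘(ℝ, E) p).right_inv hv, add_sub_cancel_left,
      toTangent_ofTangent]
  · exact (continuousAt_extChartAt_symm'' (I := 𝓘(ℝ, E)) hv).comp
      (f := fun v : TangentSpace 𝓘(ℝ, E) p ↦ extChartAt 𝓘(ℝ, E) p p + ofTangent p v)
      (continuous_const.add (ofTangent p).continuous).continuousAt
  · simpa [chartExp] using (extChartAt 𝓘(ℝ, E) p).map_target hv

theorem continuousAt_chartLog {p x : M} (hx : x ∈ (chartAt E p).source) :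
    ContinuousAt (chartLog (E := E) p) x :=
  (toTangent p).continuous.continuousAt.comp
    ((continuousAt_extChartAt' (I := 𝓘(ℝ, E)) (by simpa using hx)).sub continuousAt_const)

variable [RiemannianBundle (fun x : M ↦ TangentSpace 𝓘(ℝ, E) x)]

theorem hasFDerivAt_chartLog_comp_chartExp {f : M → M} {p : M}
    (hf : MDifferentiableAt 𝓘(ℝ, E) 𝓘(ℝ, E) f p) :
    HasFDerivAt (fun v : TangentSpace 𝓘(ℝ, E) p ↦ chartLog (f p) (f (chartExp p v)))
      (mfderiv 𝓘(ℝ, E) 𝓘(ℝ, E) f p) 0 := by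
  let D : E →L[ℝ] E := mfderiv 𝓘(ℝ, E) 𝓘(ℝ, E) f p
  have h1 : HasFDerivWithinAt (writtenInExtChartAt 𝓘(ℝ, E) 𝓘(ℝ, E) p f) D (range 𝓘(ℝ, E))
    (extChartAt 𝓘(ℝ, E) p p) := hf.hasMFDerivAt.2
  rw [ModelWithCorners.range_eq_univ, hasFDerivWithinAt_univ] at h1
  have h2 : HasFDerivAt (fun v : TangentSpace 𝓘(ℝ, E) p ↦ extChartAt 𝓘(ℝ, E) p p + ofTangent p v)
      (ofTangent p) 0 := HasFDerivAt.const_add (E := TangentSpace 𝓘(ℝ, E) p) (F := E)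
        (extChartAt 𝓘(ℝ, E) p p)
        (ContinuousLinearMap.hasFDerivAt (E := TangentSpace 𝓘(ℝ, E) p) (F := E) (ofTangent p))
  have h3 : HasFDerivAt (writtenInExtChartAt 𝓘(ℝ, E) 𝓘(ℝ, E) p f) D
    (extChartAt 𝓘(ℝ, E) p p + ofTangent p 0) := by rwa [map_zero, add_zero]
  have h4 := ((toTangent (E := E) (f p)).hasFDerivAt.comp (0 : TangentSpace 𝓘(ℝ, E) p)
    ((h3.comp (0 : TangentSpace 𝓘(ℝ, E) p) h2).sub_const (extChartAt 𝓘(ℝ, E) (f p) (f p))))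
  refine (h4.congr_fderiv ?_)
  ext v
  exact (toTangent_apply (E := E) (f p) _).trans (congrArg D (ofTangent_apply p v))

theorem hasDerivAt_chartLog_comp {γ : ℝ → M} {t : ℝ} {v : TangentSpace 𝓘(ℝ, E) (γ t)}
    (hγ : HasMFDerivAt 𝓘(ℝ, ℝ) 𝓘(ℝ, E) γ t ((1 : ℝ →L[ℝ] ℝ).smulRight v)) :
    HasDerivAt (fun s ↦ chartLog (E := E) (γ t) (γ s)) v t := by
  let D : ℝ →L[ℝ] E := (1 : ℝ →L[ℝ] ℝ).smulRight (v : E)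
  have h1 : HasFDerivWithinAt (writtenInExtChartAt 𝓘(ℝ, ℝ) 𝓘(ℝ, E) t γ) D (range 𝓘(ℝ, ℝ)) t := hγ.2
  rw [ModelWithCorners.range_eq_univ, hasFDerivWithinAt_univ] at h1
  have h2 : HasDerivAt (fun s ↦ extChartAt 𝓘(ℝ, E) (γ t) (γ s)) (D 1) t := h1.hasDerivAt
  have h3 := (toTangent (E := E) (γ t)).hasFDerivAt.comp_hasDerivAt t
    (h2.sub_const (extChartAt 𝓘(ℝ, E) (γ t) (γ t)))
  have h4 : toTangent (E := E) (γ t) (D 1) = v :=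
    (toTangent_apply (E := E) (γ t) _).trans (one_smul ℝ v)
  rw [h4] at h3
  exact h3

variable [IsContinuousRiemannianBundle E (fun x : M ↦ TangentSpace 𝓘(ℝ, E) x)]
  [IsRiemannianManifold 𝓘(ℝ, E) M]

theorem eventually_edist_chartLog (p : M) : ∃ u ∈ 𝓝 p, ∀ x ∈ u, ∀ y ∈ u,
    edist x y ≤ 2 * ‖chartLog (E := E) p x - chartLog p y‖ₑ ∧
      ‖chartLog (E := E) p x - chartLog p y‖ₑ ≤ 2 * edist x y := by
  obtain ⟨u₁, hu₁, h₁⟩ := eventually_norm_extChartAt_sub_le (E := E) p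
  obtain ⟨u₂, hu₂, h₂⟩ := eventually_edist_le (E := E) p
  have h : ∀ x y, chartLog (E := E) p x - chartLog p y =
      toTangent p (extChartAt 𝓘(ℝ, E) p x - extChartAt 𝓘(ℝ, E) p y) := fun x y ↦ by
    rw [chartLog, chartLog, ← map_sub, sub_sub_sub_cancel_right]
  refine ⟨u₁ ∩ u₂, inter_mem hu₁ hu₂, fun x hx y hy ↦ ?_⟩
  rw [h]
  exact ⟨h₂ x hx.2 y hy.2, h₁ x hx.1 y hy.1⟩

/-- Only differentiability at `p` is used, so the error is controlled by `‖u‖ + ‖v‖` and not by `‖u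
- v‖`. This suffices since all vectors concerned will be of the same order `d`. -/
theorem eventually_edist_map_chartExp {f : M → M} {p : M}
    (hf : MDifferentiableAt 𝓘(ℝ, E) 𝓘(ℝ, E) f p) {ε : ℝ} (hε : 0 < ε) :
    ∀ᶠ r in 𝓝[>] (0 : ℝ), ∀ u v : TangentSpace 𝓘(ℝ, E) p, ‖u‖ ≤ r → ‖v‖ ≤ r →
      edist (f (chartExp p u)) (f (chartExp p v)) ≤
        2 * ENNReal.ofReal (‖mfderiv 𝓘(ℝ, E) 𝓘(ℝ, E) f p (u - v)‖ + ε * (‖u‖ + ‖v‖)) ∧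
      ENNReal.ofReal ‖mfderiv 𝓘(ℝ, E) 𝓘(ℝ, E) f p (u - v)‖ ≤
        2 * edist (f (chartExp p u)) (f (chartExp p v)) + ENNReal.ofReal (ε * (‖u‖ + ‖v‖)) := by
  set D := mfderiv 𝓘(ℝ, E) 𝓘(ℝ, E) f p with hD
  obtain ⟨w, hw, hw'⟩ := eventually_edist_chartLog (E := E) (f p)
  have h1 := (hasFDerivAt_chartLog_comp_chartExp hf).isLittleO
  rw [Asymptotics.isLittleO_iff] at h1
  have h2 := h1 hε
  have h3 : ∀ᶠ v : TangentSpace 𝓘(ℝ, E) p in 𝓝 0, f (chartExp p v) ∈ w := by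
    have hc : ContinuousAt (chartExp p) (0 : TangentSpace 𝓘(ℝ, E) p) :=
      (eventually_chartLog_chartExp p).self_of_nhds.2.1
    have hfc : ContinuousAt f (chartExp p (0 : TangentSpace 𝓘(ℝ, E) p)) := by
      rw [chartExp_zero]
      exact hf.continuousAt
    refine (hfc.comp hc) ?_
    simpa using hw
  obtain ⟨r₀, hr₀, hr⟩ := Metric.nhds_basis_closedBall.eventually_iff.mp (h2.and h3)
  filter_upwards [Ioo_mem_nhdsGT hr₀] with r hrr u v hu hv
  obtain ⟨hu1, hu2⟩ := hr (mem_closedBall_zero_iff.mpr (hu.trans hrr.2.le))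
  obtain ⟨hv1, hv2⟩ := hr (mem_closedBall_zero_iff.mpr (hv.trans hrr.2.le))
  simp only [chartExp_zero, chartLog_self, sub_zero] at hu1 hv1
  obtain ⟨h4, h5⟩ := hw' _ hu2 _ hv2
  set a := chartLog (E := E) (f p) (f (chartExp p u)) with ha
  set b := chartLog (E := E) (f p) (f (chartExp p v)) with hb
  have h6 : ‖(a - b) - D (u - v)‖ ≤ ε * (‖u‖ + ‖v‖) := by
    have : (a - b) - D (u - v) = (a - D u) - (b - D v) := by rw [map_sub]; abel
    rw [this, mul_add]
    exact (norm_sub_le _ _).trans (add_le_add hu1 hv1)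
  have h7 : ‖a - b‖ ≤ ‖D (u - v)‖ + ε * (‖u‖ + ‖v‖) := by
    have := norm_le_norm_add_norm_sub' (a - b) (D (u - v))
    linarith
  have h8 : ‖D (u - v)‖ ≤ ‖a - b‖ + ε * (‖u‖ + ‖v‖) := by
    have := norm_le_norm_add_norm_sub (a - b) (D (u - v))
    linarith
  constructor
  · refine h4.trans ?_
    gcongr
    rw [← ofReal_norm]
    exact ENNReal.ofReal_le_ofReal h7
  · refine (ENNReal.ofReal_le_ofReal h8).trans ?_
    rw [ENNReal.ofReal_add (norm_nonneg _) (by positivity), ofReal_norm]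
    gcongr

end TangentCoordinates

/-! ### Local translations, and derivative bounds from Lipschitz bounds. -/

section LocalShift

open Metric

variable {E : Type*} [NormedAddCommGroup E] [NormedSpace ℝ E]
  {M : Type*} [EMetricSpace M] [ChartedSpace E M]

theorem finiteDimensional_tangentSpace [FiniteDimensional ℝ E] (p : M) :
    FiniteDimensional ℝ (TangentSpace 𝓘(ℝ, E) p) :=
  inferInstanceAs (FiniteDimensional ℝ E)

variable [IsManifold 𝓘(ℝ, E) 1 M] [RiemannianBundle (fun x : M ↦ TangentSpace 𝓘(ℝ, E) x)]

/-- Near `p` there is a family of maps which shift the points of a small ball by a given tangent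
vector at `p`, and which are the identity outside of the ball of twice the radius. -/
theorem exists_local_shift [FiniteDimensional ℝ E] (p : M) : ∀ᶠ r in 𝓝[>] (0 : ℝ),
    ∃ κ : TangentSpace 𝓘(ℝ, E) p → M → M,
      (∀ v, ‖v‖ ≤ r → ∀ x, ContinuousAt (fun q : TangentSpace 𝓘(ℝ, E) p × M ↦ κ q.1 q.2) (v, x)) ∧
      (∀ x, κ 0 x = x) ∧
      (∀ x, (∀ v, κ v x = x) ∨ ∃ u : TangentSpace 𝓘(ℝ, E) p, ‖u‖ ≤ 2 * r ∧
        ∃ ρ ∈ Icc (0 : ℝ) 1, ∀ v, κ v x = chartExp p (u + ρ • v)) ∧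
      ∀ u v : TangentSpace 𝓘(ℝ, E) p, ‖u‖ ≤ r → κ v (chartExp p u) = chartExp p (u + v) := by
  classical
  have := finiteDimensional_tangentSpace (E := E) p
  have := FiniteDimensional.proper ℝ (TangentSpace 𝓘(ℝ, E) p)
  obtain ⟨r₀, hr₀, hgood⟩ := nhds_basis_closedBall.eventually_iff.mp
    (eventually_chartLog_chartExp (E := E) p)
  have hlog : ∀ u : TangentSpace 𝓘(ℝ, E) p, ‖u‖ ≤ r₀ → chartLog p (chartExp p u) = u :=
    fun u hu ↦ (hgood (mem_closedBall_zero_iff.mpr hu)).1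
  have hexp : ∀ u : TangentSpace 𝓘(ℝ, E) p, ‖u‖ ≤ r₀ → ContinuousAt (chartExp p) u :=
    fun u hu ↦ (hgood (mem_closedBall_zero_iff.mpr hu)).2.1
  have hsrc : ∀ u : TangentSpace 𝓘(ℝ, E) p, ‖u‖ ≤ r₀ → chartExp p u ∈ (chartAt E p).source :=
    fun u hu ↦ (hgood (mem_closedBall_zero_iff.mpr hu)).2.2
  -- On `W` the coordinate has norm below `3 r` and the shift adds at most `r`; the total `4 r`
  -- stays below `r₀`, where `chartExp` is continuous.
  filter_upwards [Ioo_mem_nhdsGT (show 0 < r₀ / 4 by positivity)] with r hr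
  obtain ⟨hr0, hr4⟩ := hr
  set K : Set M := chartExp p '' closedBall (0 : TangentSpace 𝓘(ℝ, E) p) (2 * r) with hK
  have hKc : IsClosed K := by
    refine ((isCompact_closedBall _ _).image_of_continuousOn fun u hu ↦ ?_).isClosed
    rw [mem_closedBall_zero_iff] at hu
    exact (hexp u (by linarith)).continuousWithinAt
  set W : Set M := (chartAt E p).source ∩ chartLog (E := E) p ⁻¹' ball 0 (3 * r) with hW
  have hWo : IsOpen W := ContinuousOn.isOpen_inter_preimage
    (fun x hx ↦ (continuousAt_chartLog hx).continuousWithinAt) (chartAt E p).open_source isOpen_ball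
  have hWn : ∀ x ∈ W, ‖chartLog (E := E) p x‖ < 3 * r := fun x hx ↦ mem_ball_zero_iff.mp hx.2
  have hKW : K ⊆ W := by
    rintro _ ⟨u, hu, rfl⟩
    rw [mem_closedBall_zero_iff] at hu
    refine ⟨hsrc u (by linarith), ?_⟩
    rw [mem_preimage, hlog u (by linarith), mem_ball_zero_iff]
    linarith
  set ρ : M → ℝ := fun x ↦ max 0 (min 1 (2 - ‖chartLog (E := E) p x‖ / r)) with hρ
  have hρI : ∀ x, ρ x ∈ Icc (0 : ℝ) 1 := fun x ↦
    ⟨le_max_left _ _, max_le zero_le_one (min_le_left _ _)⟩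
  have hρ0 : ∀ x, 2 * r ≤ ‖chartLog (E := E) p x‖ → ρ x = 0 := fun x hx ↦ by
    refine max_eq_left ((min_le_right _ _).trans ?_)
    rw [← le_div_iff₀ hr0] at hx
    linarith
  have hρ1 : ∀ x, ‖chartLog (E := E) p x‖ ≤ r → ρ x = 1 := fun x hx ↦ by
    have : ‖chartLog (E := E) p x‖ / r ≤ 1 := (div_le_one hr0).mpr hx
    rw [hρ]
    simp only
    rw [min_eq_left (by linarith), max_eq_right zero_le_one]
  set κ : TangentSpace 𝓘(ℝ, E) p → M → M :=
    fun v x ↦ if x ∈ W then chartExp p (chartLog p x + ρ x • v) else x with hκ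
  have hκK : ∀ x ∉ K, ∀ v, κ v x = x := fun x hx v ↦ by
    by_cases hxW : x ∈ W
    · have hge : 2 * r ≤ ‖chartLog (E := E) p x‖ := by
        by_contra hlt
        exact hx ⟨chartLog p x, mem_closedBall_zero_iff.mpr (not_le.mp hlt).le,
          chartExp_chartLog hxW.1⟩
      simp only [hκ, hxW, if_true, hρ0 x hge, zero_smul, add_zero]
      exact chartExp_chartLog hxW.1
    · simp [hκ, hxW]
  refine ⟨κ, fun v hv x ↦ ?_, fun x ↦ ?_, fun x ↦ ?_, fun u v hu ↦ ?_⟩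
  · by_cases hxW : x ∈ W
    · have h1 : ContinuousAt (fun q : TangentSpace 𝓘(ℝ, E) p × M ↦ chartLog (E := E) p q.2) (v, x) :=
        (continuousAt_chartLog hxW.1).comp (f := fun q : TangentSpace 𝓘(ℝ, E) p × M ↦ q.2)
          (x := (v, x)) continuousAt_snd
      have h2 : ContinuousAt (fun q : TangentSpace 𝓘(ℝ, E) p × M ↦ ρ q.2) (v, x) :=
        continuousAt_const.max (continuousAt_const.min
          (continuousAt_const.sub (h1.norm.div_const r)))
      have h3 : ContinuousAt (fun q : TangentSpace 𝓘(ℝ, E) p × M ↦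
          chartLog (E := E) p q.2 + ρ q.2 • q.1) (v, x) := h1.add (h2.smul continuousAt_fst)
      have h4 : ‖chartLog (E := E) p x + ρ x • v‖ ≤ r₀ := by
        have h5 : ‖ρ x • v‖ ≤ 1 * r := by
          rw [norm_smul, Real.norm_eq_abs, abs_of_nonneg (hρI x).1]
          exact mul_le_mul (hρI x).2 hv (norm_nonneg _) zero_le_one
        have := norm_add_le (chartLog (E := E) p x) (ρ x • v)
        have := hWn x hxW
        linarith
      refine (ContinuousAt.comp (g := chartExp p) (x := (v, x)) (hexp _ h4) h3).congr ?_
      filter_upwards [(hWo.preimage continuous_snd).mem_nhds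
        (show (v, x) ∈ Prod.snd ⁻¹' W from hxW)] with q hq
      simp [hκ, show q.2 ∈ W from hq]
    · have hxK : x ∉ K := fun h ↦ hxW (hKW h)
      refine (continuousAt_snd (p := (v, x))).congr ?_
      filter_upwards [(hKc.isOpen_compl.preimage continuous_snd).mem_nhds
        (show (v, x) ∈ Prod.snd ⁻¹' Kᶜ from hxK)] with q hq
      exact (hκK q.2 hq q.1).symm
  · by_cases hxW : x ∈ W
    · simp only [hκ, hxW, if_true, smul_zero, add_zero]
      exact chartExp_chartLog hxW.1
    · simp [hκ, hxW]
  · by_cases hxK : x ∈ K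
    · right
      obtain ⟨u, hu, rfl⟩ := hxK
      rw [mem_closedBall_zero_iff] at hu
      refine ⟨u, hu, ρ (chartExp p u), hρI _, fun v ↦ ?_⟩
      simp only [hκ, hKW (mem_image_of_mem _ (mem_closedBall_zero_iff.mpr hu)), if_true,
        hlog u (by linarith)]
    · exact Or.inl (hκK x hxK)
  · have hl := hlog u (by linarith)
    have hmem : chartExp p u ∈ W :=
      hKW (mem_image_of_mem _ (mem_closedBall_zero_iff.mpr (by linarith)))
    have h1 := hρ1 (chartExp p u) (by rwa [hl])
    simp only [hκ, hmem, if_true, h1, one_smul, hl]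

variable [IsContinuousRiemannianBundle E (fun x : M ↦ TangentSpace 𝓘(ℝ, E) x)]
  [IsRiemannianManifold 𝓘(ℝ, E) M]

/-- The constant is `2 · 2`: one factor is lost in the chart at `f p`, one in the chart at `p`. -/
theorem norm_mfderiv_le_of_lipschitzWith {f : M → M} {p : M}
    (hf : MDifferentiableAt 𝓘(ℝ, E) 𝓘(ℝ, E) f p) {Λ : ℝ≥0} (hΛ : LipschitzWith Λ f) :
    ‖mfderiv 𝓘(ℝ, E) 𝓘(ℝ, E) f p‖ ≤ 4 * Λ := by
  refine le_of_forall_pos_le_add fun ε hε ↦ ?_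
  obtain ⟨r, hr, hr0⟩ := ((eventually_edist_map_chartExp hf hε).and self_mem_nhdsWithin).exists
  obtain ⟨w, hw, hw'⟩ := eventually_edist_chartLog (E := E) p
  have hmem : ∀ᶠ u : TangentSpace 𝓘(ℝ, E) p in 𝓝 0, chartExp p u ∈ w := by
    refine (eventually_chartLog_chartExp (E := E) p).self_of_nhds.2.1 ?_
    simpa using hw
  refine ContinuousLinearMap.opNorm_le_of_nhds_zero (by positivity) ?_
  filter_upwards [hmem, eventually_chartLog_chartExp (E := E) p, closedBall_mem_nhds 0 hr0] with
    u hu hlog hur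
  rw [mem_closedBall_zero_iff] at hur
  have h1 := (hr u 0 hur (by simpa using (le_of_lt hr0))).2
  have h2 := (hw' _ hu _ (mem_of_mem_nhds hw)).1
  rw [hlog.1, chartLog_self, sub_zero] at h2
  rw [sub_zero, chartExp_zero, norm_zero, add_zero] at h1
  rw [add_mul, ← ENNReal.ofReal_le_ofReal_iff (by positivity),
    ENNReal.ofReal_add (by positivity) (by positivity)]
  refine h1.trans ?_
  gcongr
  calc 2 * edist (f (chartExp p u)) (f p) ≤ 2 * (Λ * edist (chartExp p u) p) := by
        gcongr
        exact hΛ _ _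
    _ ≤ 2 * (Λ * (2 * ‖u‖ₑ)) := by gcongr
    _ = ENNReal.ofReal (4 * Λ * ‖u‖) := by
        rw [ENNReal.ofReal_mul (by positivity), ENNReal.ofReal_mul (by positivity), ofReal_norm,
          ENNReal.ofReal_coe_nnreal, ENNReal.ofReal_ofNat]
        ring

end LocalShift

/-! ### A path in a vector space that rests near the integers. -/

section Staircase

/-- A continuous function which grows from `0` to `1` on `[1/4, 3/4]`. -/
def ramp (u : ℝ) : ℝ := max 0 (min 1 (2 * u - 1 / 2))

theorem continuous_ramp : Continuous ramp := by unfold ramp; fun_prop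

theorem ramp_mem_Icc (u : ℝ) : ramp u ∈ Icc (0 : ℝ) 1 :=
  ⟨le_max_left _ _, max_le zero_le_one (min_le_left _ _)⟩

theorem ramp_of_le {u : ℝ} (hu : u ≤ 1 / 4) : ramp u = 0 :=
  max_eq_left ((min_le_right _ _).trans (by linarith))

theorem ramp_of_ge {u : ℝ} (hu : 3 / 4 ≤ u) : ramp u = 1 := by
  rw [ramp, min_eq_left (by linarith), max_eq_right zero_le_one]

theorem abs_ramp_sub_ramp_le (u v : ℝ) : |ramp u - ramp v| ≤ 1 := by
  have h1 := ramp_mem_Icc u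
  have h2 := ramp_mem_Icc v
  rw [abs_le]
  constructor <;> linarith [h1.1, h1.2, h2.1, h2.2]

theorem ramp_sub_intCast {t : ℝ} {k : ℤ} (h : |t - k| ≤ 1 / 4) (j : ℤ) :
    ramp (t - j) = ramp (k - j) := by
  rw [abs_le] at h
  rcases le_or_gt k j with hj | hj
  · have : (k : ℝ) ≤ j := by exact_mod_cast hj
    rw [ramp_of_le (by linarith), ramp_of_le (by linarith)]
  · have : (j : ℝ) + 1 ≤ k := by exact_mod_cast hj
    rw [ramp_of_ge (by linarith), ramp_of_ge (by linarith)]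

variable {V : Type*} [NormedAddCommGroup V] [NormedSpace ℝ V]

/-- The path in `V` which is constant near the integers, vanishes at `0` and has the increment `w j`
on `[j, j + 1]`, for `-N ≤ j < N`. -/
def staircase (w : ℤ → V) (N : ℕ) (t : ℝ) : V :=
  ∑ j ∈ Finset.Ico (-(N : ℤ)) N, (ramp (t - j) - ramp (-j)) • w j

variable (w : ℤ → V) (N : ℕ)

theorem continuous_staircase : Continuous (staircase w N) := by
  unfold staircase
  have := continuous_ramp
  fun_prop

theorem staircase_zero : staircase w N 0 = 0 :=
  Finset.sum_eq_zero fun j _ ↦ by rw [zero_sub, sub_self, zero_smul]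

theorem staircase_eq_intCast {t : ℝ} {k : ℤ} (h : |t - k| ≤ 1 / 4) :
    staircase w N t = staircase w N k :=
  Finset.sum_congr rfl fun j _ ↦ by rw [ramp_sub_intCast h]

theorem norm_staircase_le (t : ℝ) :
    ‖staircase w N t‖ ≤ ∑ j ∈ Finset.Ico (-(N : ℤ)) N, ‖w j‖ := by
  refine norm_sum_le_of_le _ fun j _ ↦ ?_
  rw [norm_smul]
  exact mul_le_of_le_one_left (norm_nonneg _) (abs_ramp_sub_ramp_le _ _)

theorem staircase_sub (t t' : ℝ) : staircase w N t' - staircase w N t =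
    ∑ j ∈ Finset.Ico (-(N : ℤ)) N, (ramp (t' - j) - ramp (t - j)) • w j := by
  rw [staircase, staircase, ← Finset.sum_sub_distrib]
  refine Finset.sum_congr rfl fun j _ ↦ ?_
  rw [← sub_smul, sub_sub_sub_cancel_right]

theorem staircase_add_one_sub {k : ℤ} (hk : k ∈ Icc (-(N : ℤ)) (N - 1)) :
    staircase w N ((k + 1 : ℤ) : ℝ) - staircase w N k = w k := by
  rw [staircase_sub, Finset.sum_eq_single k]
  · rw [ramp_of_ge, ramp_of_le]
    · simp
    · norm_num
    · push_cast
      norm_num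
  · intro j _ hjk
    rcases lt_or_gt_of_ne hjk with h | h
    · have : (j : ℝ) + 1 ≤ k := by exact_mod_cast h
      rw [ramp_of_ge (by push_cast; linarith), ramp_of_ge (by linarith), sub_self, zero_smul]
    · have : (k : ℝ) + 1 ≤ j := by exact_mod_cast h
      rw [ramp_of_le (by push_cast; linarith), ramp_of_le (by linarith), sub_self, zero_smul]
  · intro h
    rw [mem_Icc] at hk
    exact absurd (Finset.mem_Ico.mpr ⟨hk.1, by omega⟩) h

/-- Both times lie in `[m - 1, m + 2]`, where only the three increments with `j = m - 1, m, m + 1`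
can be active. -/
theorem norm_map_staircase_sub_le {W : Type*} [NormedAddCommGroup W] [NormedSpace ℝ W]
    (G : V →L[ℝ] W) {B : ℝ} (hB : 0 ≤ B) {m : ℤ} {t t' : ℝ} (hm : m ≤ t') (hm' : t' < m + 1)
    (ht : |t' - t| ≤ 1)
    (hG : ∀ j ∈ Icc (-(N : ℤ)) (N - 1), j ∈ Icc (m - 1) (m + 1) → ‖G (w j)‖ ≤ B) :
    ‖G (staircase w N t' - staircase w N t)‖ ≤ 3 * B := by
  rw [abs_le] at ht
  rw [staircase_sub, map_sum]
  have h1 : ∀ j ∈ Finset.Ico (-(N : ℤ)) N,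
      ‖G ((ramp (t' - j) - ramp (t - j)) • w j)‖ ≤ if j ∈ Finset.Icc (m - 1) (m + 1) then B else 0 := by
    intro j hj
    rw [Finset.mem_Ico] at hj
    split_ifs with h
    · rw [map_smul, norm_smul]
      refine (mul_le_of_le_one_left (norm_nonneg _) (abs_ramp_sub_ramp_le _ _)).trans ?_
      exact hG j ⟨hj.1, by omega⟩ (by simpa using h)
    · rw [Finset.mem_Icc, not_and_or, not_le, not_le] at h
      rcases h with h | h
      · have : (j : ℝ) + 2 ≤ m := by exact_mod_cast (show j + 2 ≤ m by omega)
        rw [ramp_of_ge (by linarith), ramp_of_ge (by linarith), sub_self, zero_smul, map_zero,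
          norm_zero]
      · have : (m : ℝ) + 2 ≤ j := by exact_mod_cast (show m + 2 ≤ j by omega)
        rw [ramp_of_le (by linarith), ramp_of_le (by linarith), sub_self, zero_smul, map_zero,
          norm_zero]
  refine (norm_sum_le_of_le _ h1).trans ?_
  rw [← Finset.sum_filter, Finset.sum_const, nsmul_eq_mul]
  gcongr
  have h2 : (Finset.filter (· ∈ Finset.Icc (m - 1) (m + 1)) (Finset.Ico (-(N : ℤ)) N)).card ≤ 3 := by
    refine (Finset.card_le_card (t := Finset.Icc (m - 1) (m + 1)) fun j hj ↦
      (Finset.mem_filter.mp hj).2).trans_eq ?_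
    rw [Int.card_Icc]
    omega
  exact_mod_cast h2

theorem staircase_eq_of_notMem {m : ℤ} {t t' : ℝ} (hm : m ≤ t') (hm' : t' < m + 1)
    (ht : |t' - t| ≤ 1) (hmN : m ∉ Icc (-(N : ℤ) - 1) (N + 1)) :
    staircase w N t' = staircase w N t := by
  have h := norm_map_staircase_sub_le w N (ContinuousLinearMap.id ℝ V) le_rfl hm hm' ht
    (fun j hj hj' ↦ absurd ⟨by linarith [hj.1, hj'.2], by linarith [hj.2, hj'.1]⟩ hmN)
  rw [mul_zero, norm_le_zero_iff] at h
  exact sub_eq_zero.mp h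

end Staircase

/-! ### Chain rule along the orbit, and invariance of the field. -/

section DerivTo

variable {E : Type*} [NormedAddCommGroup E] [NormedSpace ℝ E]
  {M : Type*} [EMetricSpace M] [ChartedSpace E M]

theorem mfderivTo_comp_apply {f g h : M → M} (hfg : ∀ x, f (g x) = h x) {x y z : M} (hg : g x = y)
    (hf : f y = z) (hh : h x = z) (hgd : MDifferentiableAt 𝓘(ℝ, E) 𝓘(ℝ, E) g x)
    (hfd : MDifferentiableAt 𝓘(ℝ, E) 𝓘(ℝ, E) f y) (v : TangentSpace 𝓘(ℝ, E) x) :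
    mfderivTo 𝓘(ℝ, E) f hf (mfderivTo 𝓘(ℝ, E) g hg v) = mfderivTo 𝓘(ℝ, E) h hh v := by
  obtain rfl : f ∘ g = h := funext hfg
  subst hg
  subst hf
  have := mfderiv_comp (I := 𝓘(ℝ, E)) (I' := 𝓘(ℝ, E)) (I'' := 𝓘(ℝ, E)) x hfd hgd
  exact (congrArg (fun D : E →L[ℝ] E ↦ D v) this).symm

theorem mfderivTo_of_eq_id {f : M → M} (hf : ∀ x, f x = x) {x : M} (h : f x = x)
    (v : TangentSpace 𝓘(ℝ, E) x) : mfderivTo 𝓘(ℝ, E) f h v = v := by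
  obtain rfl : f = id := funext hf
  exact congrArg (fun D : E →L[ℝ] E ↦ D v) (mfderiv_id (I := 𝓘(ℝ, E)) (x := x))

variable {Φ : Flow ℝ M} {X : (x : M) → TangentSpace 𝓘(ℝ, E) x}

theorem hasMFDerivAt_flow_zero (hΦ : ∀ x, IsMIntegralCurve (fun t ↦ Φ t x) X) (x : M) :
    HasMFDerivAt 𝓘(ℝ, ℝ) 𝓘(ℝ, E) (fun s ↦ Φ s x) 0
      ((1 : ℝ →L[ℝ] ℝ).smulRight (X x : E) : ℝ →L[ℝ] E) := by
  let X' : M → E := X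
  have h1 : HasMFDerivAt 𝓘(ℝ, ℝ) 𝓘(ℝ, E) (fun s ↦ Φ s x) 0
    ((1 : ℝ →L[ℝ] ℝ).smulRight (X' (Φ 0 x)) : ℝ →L[ℝ] E) := hΦ x 0
  rwa [Φ.map_zero_apply] at h1

/-- Differentiate `Φ t (Φ s x) = Φ s (Φ t x)` at `s = 0`. -/
theorem mfderivTo_flow_field (hΦ : ∀ x, IsMIntegralCurve (fun t ↦ Φ t x) X)
    (hd : ∀ t, MDifferentiable 𝓘(ℝ, E) 𝓘(ℝ, E) (Φ t)) {t : ℝ} {x y : M} (h : Φ t x = y) :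
    mfderivTo 𝓘(ℝ, E) (Φ t) h (X x) = X y := by
  subst h
  let D : E →L[ℝ] E := mfderiv 𝓘(ℝ, E) 𝓘(ℝ, E) (Φ t) x
  have h1 : HasMFDerivAt 𝓘(ℝ, E) 𝓘(ℝ, E) (Φ t) (Φ 0 x) D := by
    rw [Φ.map_zero_apply]
    exact (hd t x).hasMFDerivAt
  have h2 := HasMFDerivAt.comp (0 : ℝ) h1 (hasMFDerivAt_flow_zero hΦ x)
  have h3 : (Φ t ∘ fun s ↦ Φ s x) = fun s ↦ Φ s (Φ t x) := by
    funext s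
    rw [Function.comp_apply, ← Φ.map_add, ← Φ.map_add, add_comm]
  have h4 : HasFDerivWithinAt (writtenInExtChartAt 𝓘(ℝ, ℝ) 𝓘(ℝ, E) 0 (Φ t ∘ fun s ↦ Φ s x))
    (D.comp ((1 : ℝ →L[ℝ] ℝ).smulRight (X x : E))) (range 𝓘(ℝ, ℝ)) (0 : ℝ) := h2.2
  have h5 : HasFDerivWithinAt (writtenInExtChartAt 𝓘(ℝ, ℝ) 𝓘(ℝ, E) 0 (fun s ↦ Φ s (Φ t x)))
    ((1 : ℝ →L[ℝ] ℝ).smulRight (X (Φ t x) : E)) (range 𝓘(ℝ, ℝ)) (0 : ℝ) :=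
    (hasMFDerivAt_flow_zero hΦ (Φ t x)).2
  rw [ModelWithCorners.range_eq_univ, hasFDerivWithinAt_univ] at h4 h5
  rw [h3] at h4
  have h6 := congrArg (fun G : ℝ →L[ℝ] E ↦ G 1) (h4.unique h5)
  have h7 : D ((1 : ℝ) • (X x : E)) = (1 : ℝ) • (X (Φ t x) : E) := h6
  exact (congrArg D (one_smul ℝ (X x : E))).symm.trans (h7.trans (one_smul ℝ _))

variable [IsManifold 𝓘(ℝ, E) 1 M] [RiemannianBundle (fun x : M ↦ TangentSpace 𝓘(ℝ, E) x)]
  [IsContinuousRiemannianBundle E (fun x : M ↦ TangentSpace 𝓘(ℝ, E) x)]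
  [IsRiemannianManifold 𝓘(ℝ, E) M]

theorem norm_mfderivTo_le {f : M → M} {x y : M} (h : f x = y)
    (hf : MDifferentiableAt 𝓘(ℝ, E) 𝓘(ℝ, E) f x) {Λ : ℝ≥0} (hΛ : LipschitzWith Λ f) :
    ‖mfderivTo 𝓘(ℝ, E) f h‖ ≤ 4 * Λ := by
  subst h
  exact norm_mfderiv_le_of_lipschitzWith hf hΛ

end DerivTo

/-! ### Construction of smooth methods by perturbing the flow. -/

section ControlledFlow

variable {E : Type*} [NormedAddCommGroup E] [NormedSpace ℝ E]
  {M : Type*} [EMetricSpace M] [ChartedSpace E M]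

/-- The uniform estimates for a flow, and the smoothing procedure on the manifold, that are needed
for the construction of smooth methods. -/
structure ControlledFlow (X : (x : M) → TangentSpace 𝓘(ℝ, E) x) (Φ : Flow ℝ M) (Λ C : ℝ≥0) :
    Prop where
  integralCurve : ∀ x, IsMIntegralCurve (fun t ↦ Φ t x) X
  mdifferentiable : ∀ t, MDifferentiable 𝓘(ℝ, E) 𝓘(ℝ, E) (Φ t)
  lipschitz : ∀ t, |t| ≤ 2 → LipschitzWith Λ (Φ t)
  drift : ∀ s t x, edist (Φ s x) (Φ t x) ≤ C * ‖s - t‖ₑ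
  approx : ∀ F : ℝ × M → M, Continuous F → ∀ a > 0, (∀ t x, |t| < a → F (t, x) = x) →
    ∀ ε : ENNReal, 0 < ε → ∃ G : ℝ × M → M, ContMDiff (𝓘(ℝ, ℝ).prod 𝓘(ℝ, E)) 𝓘(ℝ, E) ∞ G ∧
      (∀ x, G (0, x) = x) ∧ ∀ q, edist (G q) (F q) < ε

namespace ControlledFlow

variable {X : (x : M) → TangentSpace 𝓘(ℝ, E) x} {Φ : Flow ℝ M} {Λ C : ℝ≥0}

theorem drift_ofReal (h : ControlledFlow X Φ Λ C) {s t a : ℝ} (hst : |s - t| ≤ a) (x : M) :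
    edist (Φ s x) (Φ t x) ≤ ENNReal.ofReal (C * a) := by
  refine (h.drift s t x).trans ?_
  rw [ENNReal.ofReal_mul C.coe_nonneg, ENNReal.ofReal_coe_nnreal, ← ofReal_norm]
  gcongr
  exact hst

theorem lipschitz_ofReal (h : ControlledFlow X Φ Λ C) {t a : ℝ} (ht : |t| ≤ 2) {x y : M}
    (hxy : edist x y ≤ ENNReal.ofReal a) :
    edist (Φ t x) (Φ t y) ≤ ENNReal.ofReal (Λ * a) := by
  refine (h.lipschitz t ht x y).trans ?_
  rw [ENNReal.ofReal_mul Λ.coe_nonneg, ENNReal.ofReal_coe_nnreal]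
  gcongr

/-- The flow, composed with slowly moving perturbations of the identity which stand still at integer
times, is approximated by smooth methods. -/
theorem exists_smooth_method (h : ControlledFlow X Φ Λ C) {θ : ℝ → M → M}
    (hθ : Continuous fun q : ℝ × M ↦ θ q.1 q.2) (hθ0 : ∀ x, θ 0 x = x)
    (hθk : ∀ (t : ℝ) (k : ℤ), |t - k| ≤ 1 / 4 → θ t = θ k) {B d : ℝ} (hB : 0 ≤ B) (hd : 0 < d)
    (hstep : ∀ t t' x, |t' - t| ≤ 1 →
      edist (Φ t' (θ t' x)) (Φ t' (θ t x)) ≤ ENNReal.ofReal (B * d)) :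
    ∃ Ψ : ℝ → M → M, IsMethod Φ Ψ ((B + 1) * d) ∧
      ContMDiff (𝓘(ℝ, ℝ).prod 𝓘(ℝ, E)) 𝓘(ℝ, E) ∞ (fun q : ℝ × M ↦ Ψ q.1 q.2) ∧
      ∀ (k : ℤ) x, edist (Ψ k x) (Φ k (θ k x)) ≤ ENNReal.ofReal d := by
  -- `η ≤ 1 / 4` keeps `σ k` in the interval around `k` on which `θ` is constant; the second bound
  -- makes a time error of `2 η` cost at most `d / 4` in space.
  set η : ℝ := min (1 / 4) (d / (8 * (C + 1))) with hη
  have hη0 : 0 < η := lt_min (by norm_num) (by positivity)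
  have hη4 : η ≤ 1 / 4 := min_le_left _ _
  have hCη : C * (2 * η) ≤ d / 4 := by
    have h1 : η ≤ d / (8 * (C + 1)) := min_le_right _ _
    rw [le_div_iff₀ (by positivity)] at h1
    nlinarith [C.coe_nonneg]
  set ε : ℝ := d / (4 * (Λ + 1)) with hε
  have hε0 : 0 < ε := by positivity
  have hΛε : (1 + Λ) * ε = d / 4 := by
    rw [hε]
    field_simp
    ring
  -- A time change that stops on `[-η, η]`, so that the map to be smoothed is the identity near time
  -- `0` and the smoothing can keep it there. It is `1`-Lipschitz and within `η` of the true time.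
  set σ : ℝ → ℝ := fun t ↦ t - max (-η) (min η t) with hσ
  have hσc : Continuous σ := by fun_prop
  have hσ0 : ∀ t, |t| < η → σ t = 0 := fun t ht ↦ by
    rw [abs_lt] at ht
    rw [hσ]
    simp only
    rw [min_eq_right ht.2.le, max_eq_right ht.1.le, sub_self]
  have hσt : ∀ t, |σ t - t| ≤ η := fun t ↦ by
    rw [hσ, abs_le]
    simp only
    constructor
    · have : max (-η) (min η t) ≤ η := max_le (by linarith) (min_le_left _ _)
      linarith
    · have : -η ≤ max (-η) (min η t) := le_max_left _ _
      linarith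
  have hσσ : ∀ s t, |σ s - σ t| ≤ |s - t| := fun s t ↦ by
    have hmono : ∀ a b, a ≤ b → 0 ≤ σ b - σ a ∧ σ b - σ a ≤ b - a := fun a b hab ↦ by
      have h1 : max (-η) (min η a) ≤ max (-η) (min η b) :=
        max_le_max le_rfl (min_le_min le_rfl hab)
      have h2 : max (-η) (min η b) - max (-η) (min η a) ≤ b - a := by
        rw [sub_le_iff_le_add]
        refine max_le ?_ ?_
        · have := le_max_left (-η) (min η a)
          linarith
        · rcases le_total η a with h | h
          · have h3 : η ≤ max (-η) (min η a) := by rw [min_eq_left h]; exact le_max_right _ _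
            have := min_le_left η b
            linarith
          · have h3 : a ≤ max (-η) (min η a) := by rw [min_eq_right h]; exact le_max_right _ _
            have := min_le_right η b
            linarith
      constructor <;> simp only [hσ] <;> linarith
    rcases le_total s t with hst | hst
    · rw [abs_sub_comm, abs_sub_comm s t, abs_of_nonneg (hmono s t hst).1,
        abs_of_nonneg (sub_nonneg.mpr hst)]
      exact (hmono s t hst).2
    · rw [abs_of_nonneg (hmono t s hst).1, abs_of_nonneg (sub_nonneg.mpr hst)]
      exact (hmono t s hst).2
  set F : ℝ × M → M := fun q ↦ Φ (σ q.1) (θ (σ q.1) q.2) with hF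
  have hFc : Continuous F := by
    have h1 : Continuous fun q : ℝ × M ↦ θ (σ q.1) q.2 :=
      hθ.comp ((hσc.comp continuous_fst).prodMk continuous_snd)
    exact Φ.cont'.comp ((hσc.comp continuous_fst).prodMk h1)
  obtain ⟨G, hG, hG0, hGF⟩ := h.approx F hFc η hη0
    (fun t x ht ↦ by simp only [hF, hσ0 t ht, Φ.map_zero_apply, hθ0]) (ENNReal.ofReal ε)
    (by simpa using hε0)
  refine ⟨fun t x ↦ G (t, x), ⟨hG0, fun t s hs x ↦ ?_⟩, hG, fun k x ↦ ?_⟩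
  · set y := θ (σ t) x with hy
    have h1 : edist (G (t + s, x)) (F (t + s, x)) ≤ ENNReal.ofReal ε := (hGF _).le
    have h2 : edist (F (t + s, x)) (Φ (σ (t + s)) y) ≤ ENNReal.ofReal (B * d) := by
      refine hstep (σ t) (σ (t + s)) x ((hσσ _ _).trans ?_)
      rw [add_sub_cancel_left]
      exact abs_le.mpr hs
    have h3 : edist (Φ (σ (t + s)) y) (Φ s (Φ (σ t) y)) ≤ ENNReal.ofReal (C * (2 * η)) := by
      rw [← Φ.map_add]
      refine h.drift_ofReal ?_ y
      have h4 := abs_le.mp (hσt (t + s))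
      have h5 := abs_le.mp (hσt t)
      rw [abs_le]
      constructor <;> linarith [h4.1, h4.2, h5.1, h5.2]
    have h4 : edist (Φ s (Φ (σ t) y)) (Φ s (G (t, x))) ≤ ENNReal.ofReal (Λ * ε) := by
      refine h.lipschitz_ofReal ((abs_le.mpr hs).trans one_le_two) ?_
      rw [edist_comm]
      exact (hGF (t, x)).le
    -- The four errors are smoothing at the end, motion of `θ`, the time change, and smoothing at
    -- the start carried along by the flow. All but the second total at most `d / 2`.
    have h5 : edist (G (t + s, x)) (Φ s (G (t, x))) ≤ ENNReal.ofReal ε + ENNReal.ofReal (B * d) +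
        (ENNReal.ofReal (C * (2 * η)) + ENNReal.ofReal (Λ * ε)) :=
      (edist_triangle _ (Φ (σ (t + s)) y) _).trans (add_le_add
        ((edist_triangle _ _ _).trans (add_le_add h1 h2))
        ((edist_triangle _ _ _).trans (add_le_add h3 h4)))
    refine h5.trans_lt ?_
    rw [← ENNReal.ofReal_add (by positivity) (by positivity),
      ← ENNReal.ofReal_add (by positivity) (by positivity),
      ← ENNReal.ofReal_add (by positivity) (by positivity)]
    rw [ENNReal.ofReal_lt_ofReal_iff (by positivity)]
    nlinarith
  · have h1 : edist (G ((k : ℝ), x)) (F ((k : ℝ), x)) ≤ ENNReal.ofReal ε := (hGF _).le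
    have h2 : θ (σ k) = θ k := hθk _ _ ((hσt k).trans hη4)
    have h3 : edist (F ((k : ℝ), x)) (Φ k (θ k x)) ≤ ENNReal.ofReal (C * (2 * η)) := by
      simp only [hF, h2]
      exact h.drift_ofReal ((hσt k).trans (by linarith)) _
    refine (edist_triangle _ _ _).trans ((add_le_add h1 h3).trans ?_)
    rw [← ENNReal.ofReal_add (by positivity) (by positivity)]
    refine ENNReal.ofReal_le_ofReal ?_
    nlinarith [mul_nonneg Λ.coe_nonneg hε0.le]

variable [IsManifold 𝓘(ℝ, E) 1 M] [RiemannianBundle (fun x : M ↦ TangentSpace 𝓘(ℝ, E) x)]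

/-- Over unit time the staircase changes by at most three increments `w j` with `j` near `m = ⌊t'⌋`,
whose images under `DΦ(m)` are bounded by `A`. This gives `3 A d`, the linearization error adds at
most `d`, the charts cost a factor `2`, and the remaining time `t' - m` costs `Λ`. For `m` far
outside `[-N, N]` nothing moves. -/
theorem edist_flow_shift_le (h : ControlledFlow X Φ Λ C) {p : M}
    {w : ℤ → TangentSpace 𝓘(ℝ, E) p} {N : ℕ} {r d ε A : ℝ} (hA : 0 ≤ A) (hd : 0 ≤ d)
    (hε : 0 ≤ ε) (hεr : ε * (6 * r) ≤ d)
    (hw : ∀ m : ℤ, ∀ j ∈ Icc (-(N : ℤ)) (N - 1), j ∈ Icc (m - 1) (m + 1) →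
      ‖mfderiv 𝓘(ℝ, E) 𝓘(ℝ, E) (Φ m) p (w j)‖ ≤ A)
    (hr : ∀ t, ‖d • staircase w N t‖ ≤ r)
    {κ : TangentSpace 𝓘(ℝ, E) p → M → M}
    (hκ : ∀ x, (∀ v, κ v x = x) ∨ ∃ u : TangentSpace 𝓘(ℝ, E) p, ‖u‖ ≤ 2 * r ∧
      ∃ ρ ∈ Icc (0 : ℝ) 1, ∀ v, κ v x = chartExp p (u + ρ • v))
    (hexp : ∀ m ∈ Icc (-(N : ℤ) - 1) (N + 1), ∀ u v : TangentSpace 𝓘(ℝ, E) p,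
      ‖u‖ ≤ 3 * r → ‖v‖ ≤ 3 * r → edist (Φ m (chartExp p u)) (Φ m (chartExp p v)) ≤
        2 * ENNReal.ofReal (‖mfderiv 𝓘(ℝ, E) 𝓘(ℝ, E) (Φ m) p (u - v)‖ + ε * (‖u‖ + ‖v‖)))
    {t t' : ℝ} (ht : |t' - t| ≤ 1) (x : M) :
    edist (Φ t' (κ (d • staircase w N t') x)) (Φ t' (κ (d • staircase w N t) x)) ≤
      ENNReal.ofReal (Λ * (2 * (3 * A + 1)) * d) := by
  set m := ⌊t'⌋ with hm
  have hm1 : (m : ℝ) ≤ t' := Int.floor_le t'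
  have hm2 : t' < m + 1 := Int.lt_floor_add_one t'
  by_cases hmN : m ∈ Icc (-(N : ℤ) - 1) (N + 1)
  swap
  · rw [staircase_eq_of_notMem w N hm1 hm2 ht hmN, edist_self]
    exact zero_le
  rcases hκ x with h1 | ⟨u, hu, ρ, hρ, h1⟩
  · rw [h1, h1, edist_self]
    exact zero_le
  rw [h1, h1]
  have hsplit : ∀ y, Φ t' y = Φ (t' - m) (Φ m y) := fun y ↦ by rw [← Φ.map_add, sub_add_cancel]
  rw [hsplit, hsplit, mul_assoc]
  refine h.lipschitz_ofReal (by rw [abs_le]; constructor <;> linarith) ?_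
  have hρr : ∀ s, ‖ρ • d • staircase w N s‖ ≤ r := fun s ↦ by
    rw [norm_smul, Real.norm_eq_abs, abs_of_nonneg hρ.1]
    exact (mul_le_of_le_one_left (norm_nonneg _) hρ.2).trans (hr s)
  have hn : ∀ s, ‖u + ρ • d • staircase w N s‖ ≤ 3 * r := fun s ↦
    (norm_add_le _ _).trans (by linarith [hρr s])
  refine (hexp m hmN _ _ (hn t') (hn t)).trans ?_
  rw [mul_assoc, ENNReal.ofReal_mul zero_le_two, ENNReal.ofReal_ofNat]
  gcongr
  have h2 : u + ρ • d • staircase w N t' - (u + ρ • d • staircase w N t) =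
      (ρ * d) • (staircase w N t' - staircase w N t) := by
    rw [add_sub_add_left_eq_sub, smul_smul, smul_smul, smul_sub]
  have h3 := norm_map_staircase_sub_le w N (mfderiv 𝓘(ℝ, E) 𝓘(ℝ, E) (Φ m) p) hA hm1 hm2 ht (hw m)
  rw [h2, map_smul, norm_smul, Real.norm_eq_abs, abs_of_nonneg (mul_nonneg hρ.1 hd)]
  have h4 : ρ * d ≤ 1 * d := mul_le_mul_of_nonneg_right hρ.2 hd
  have h5 := mul_le_mul h4 h3 (norm_nonneg _) (by linarith)
  have h6 := mul_le_mul_of_nonneg_left (add_le_add (hn t') (hn t)) hε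
  nlinarith

end ControlledFlow
end ControlledFlow

/-! ### Ingredients of the linearized comparison. -/

section LinearizedSolution

theorem Rep.abs_symm_sub_le {δ : ℝ} {α : ℝ ≃ₜ ℝ} (hα : α ∈ Rep δ) (hδ : δ ≤ 1 / 2) (t : ℝ) :
    |α.symm t - t| ≤ 2 * δ * |t| := by
  obtain ⟨-, h0, h⟩ := hα
  set τ := α.symm t with hτ
  have hατ : α τ = t := α.apply_symm_apply t
  by_cases hτ0 : τ = 0
  · have : t = 0 := by rw [← hατ, hτ0, h0]
    simp [hτ0, this]
  have h1 := h τ 0 hτ0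
  rw [h0, sub_zero, sub_zero, hατ, div_sub_one hτ0, abs_div, div_le_iff₀ (abs_pos.mpr hτ0)] at h1
  rw [abs_sub_comm]
  have h2 : |τ| ≤ |t - τ| + |t| := by
    have := abs_sub_abs_le_abs_sub τ t
    rw [abs_sub_comm τ t] at this
    linarith
  have h3 : 0 ≤ δ := by
    have := (abs_nonneg _).trans h1
    by_contra hneg
    have := mul_neg_of_neg_of_pos (not_le.mp hneg) (abs_pos.mpr hτ0)
    linarith
  have h4 : |τ| ≤ 2 * |t| := by nlinarith [abs_nonneg τ]
  nlinarith

variable {E : Type*} [NormedAddCommGroup E] [NormedSpace ℝ E]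
  {M : Type*} [EMetricSpace M] [ChartedSpace E M]
  {X : (x : M) → TangentSpace 𝓘(ℝ, E) x} {Φ : Flow ℝ M} {Λ C : ℝ≥0}

theorem hasDerivAt_chartLog_flow [IsManifold 𝓘(ℝ, E) 1 M]
    [RiemannianBundle (fun x : M ↦ TangentSpace 𝓘(ℝ, E) x)]
    (hΦ : ∀ x, IsMIntegralCurve (fun t ↦ Φ t x) X) (p : M) :
    HasDerivAt (fun s ↦ chartLog (E := E) p (Φ s p)) (X p) 0 := by
  have h : ∀ q, Φ 0 p = q → HasDerivAt (fun s ↦ chartLog (E := E) q (Φ s p)) (X q) 0 := by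
    rintro _ rfl
    exact hasDerivAt_chartLog_comp (γ := fun s ↦ Φ s p) (t := 0) (v := X (Φ 0 p)) (hΦ p 0)
  exact h p (Φ.map_zero_apply p)

/-- The vector at `p` which the flow moves in time `j + 1` to `z (j + 1)`. -/
def pullBack (Φ : Flow ℝ M) (p : M) (z : (k : ℤ) → TangentSpace 𝓘(ℝ, E) (orbit Φ p k)) (j : ℤ) :
    TangentSpace 𝓘(ℝ, E) p :=
  mfderivTo 𝓘(ℝ, E) (Φ (-((j + 1 : ℤ) : ℝ)))
    (show Φ (-((j + 1 : ℤ) : ℝ)) (orbit Φ p (j + 1)) = p by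
      rw [orbit, ← Φ.map_add, neg_add_cancel, Φ.map_zero_apply]) (z (j + 1))

namespace ControlledFlow

theorem mfderivTo_pullBack (h : ControlledFlow X Φ Λ C) (p : M)
    (z : (k : ℤ) → TangentSpace 𝓘(ℝ, E) (orbit Φ p k)) (m j : ℤ) :
    mfderivTo 𝓘(ℝ, E) (Φ m) (rfl : Φ m p = orbit Φ p m) (pullBack Φ p z j) =
      mfderivTo 𝓘(ℝ, E) (Φ (m - (j + 1))) (show Φ (m - (j + 1)) (orbit Φ p (j + 1)) = orbit Φ p m by
        rw [orbit, orbit, ← Φ.map_add]; push_cast; rw [sub_add_cancel]) (z (j + 1)) :=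
  mfderivTo_comp_apply (fun x ↦ by rw [← Φ.map_add]; push_cast; ring_nf) _ _ _
    (h.mdifferentiable _ _) (h.mdifferentiable _ _) _

theorem mfderivTo_pullBack_self (h : ControlledFlow X Φ Λ C) (p : M)
    (z : (k : ℤ) → TangentSpace 𝓘(ℝ, E) (orbit Φ p k)) (j : ℤ) :
    mfderivTo 𝓘(ℝ, E) (Φ (j + 1 : ℤ)) (rfl : Φ (j + 1 : ℤ) p = orbit Φ p (j + 1))
      (pullBack Φ p z j) = z (j + 1) := by
  rw [h.mfderivTo_pullBack]
  refine mfderivTo_of_eq_id (fun x ↦ ?_) _ _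
  push_cast
  rw [sub_self, Φ.map_zero_apply]

theorem stepDeriv_mfderivTo (h : ControlledFlow X Φ Λ C) (p : M) (k : ℤ)
    (v : TangentSpace 𝓘(ℝ, E) p) :
    stepDeriv 𝓘(ℝ, E) Φ p k (mfderivTo 𝓘(ℝ, E) (Φ k) (rfl : Φ k p = orbit Φ p k) v) =
      mfderivTo 𝓘(ℝ, E) (Φ (k + 1 : ℤ)) (rfl : Φ (k + 1 : ℤ) p = orbit Φ p (k + 1)) v :=
  mfderivTo_comp_apply (fun x ↦ by rw [← Φ.map_add]; push_cast; rw [add_comm]) _ _ _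
    (h.mdifferentiable _ _) (h.mdifferentiable _ _) _

theorem stepDeriv_field (h : ControlledFlow X Φ Λ C) (p : M) (k : ℤ) :
    stepDeriv 𝓘(ℝ, E) Φ p k (X (orbit Φ p k)) = X (orbit Φ p (k + 1)) :=
  mfderivTo_flow_field h.integralCurve h.mdifferentiable _

variable [IsManifold 𝓘(ℝ, E) 1 M] [RiemannianBundle (fun x : M ↦ TangentSpace 𝓘(ℝ, E) x)]
  [IsContinuousRiemannianBundle E (fun x : M ↦ TangentSpace 𝓘(ℝ, E) x)]
  [IsRiemannianManifold 𝓘(ℝ, E) M]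

/-- The net time from `p_{j+1}` to `p_m` lies in `[-2, 0]`, which is why the Lipschitz bound is
required for `|t| ≤ 2`. -/
theorem norm_mfderivTo_pullBack_le (h : ControlledFlow X Φ Λ C) (p : M)
    {z : (k : ℤ) → TangentSpace 𝓘(ℝ, E) (orbit Φ p k)} (hz : ∀ k, ‖z k‖ ≤ 1) {m j : ℤ}
    (hj : j ∈ Icc (m - 1) (m + 1)) :
    ‖mfderivTo 𝓘(ℝ, E) (Φ m) (rfl : Φ m p = orbit Φ p m) (pullBack Φ p z j)‖ ≤ 4 * Λ := by
  rw [h.mfderivTo_pullBack]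
  have h1 : |(m : ℝ) - (j + 1)| ≤ 2 := by
    have h1 : (m : ℝ) - 1 ≤ j := by exact_mod_cast hj.1
    have h2 : (j : ℝ) ≤ m + 1 := by exact_mod_cast hj.2
    rw [abs_le]
    constructor <;> linarith
  refine (ContinuousLinearMap.le_opNorm _ _).trans ?_
  refine (mul_le_of_le_one_right (norm_nonneg _) (hz _)).trans ?_
  exact norm_mfderivTo_le _ (h.mdifferentiable _ _) (h.lipschitz _ h1)

theorem eventually_mul_le {a b : ℝ} (hb : 0 < b) : ∀ᶠ d in 𝓝[>] (0 : ℝ), a * d ≤ b := by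
  have h1 : Tendsto (fun d : ℝ ↦ a * d) (𝓝[>] 0) (𝓝 (a * 0)) :=
    ((continuous_const.mul continuous_id).tendsto 0).mono_left nhdsWithin_le_nhds
  rw [mul_zero] at h1
  exact h1.eventually (Iic_mem_nhds hb)

theorem eventually_const_mul {a : ℝ} (ha : 0 < a) {P : ℝ → Prop} (hP : ∀ᶠ r in 𝓝[>] (0 : ℝ), P r) :
    ∀ᶠ d in 𝓝[>] (0 : ℝ), P (a * d) := by
  have h1 : Tendsto (fun d : ℝ ↦ a * d) (𝓝[>] 0) (𝓝[>] 0) := by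
    refine tendsto_nhdsWithin_of_tendsto_nhds_of_eventually_within _ ?_ ?_
    · have h1 : Tendsto (fun d : ℝ ↦ a * d) (𝓝[>] 0) (𝓝 (a * 0)) :=
        ((continuous_const.mul continuous_id).tendsto 0).mono_left nhdsWithin_le_nhds
      rwa [mul_zero] at h1
    · filter_upwards [self_mem_nhdsWithin] with d hd
      exact mul_pos ha hd
  exact h1.eventually hP

theorem exists_chartExp_of_edist_lt (p : M) : ∃ a : ℝ, 0 < a ∧ ∀ q : M, ∀ b : ℝ, b ≤ a →
    edist p q < ENNReal.ofReal b → ∃ u : TangentSpace 𝓘(ℝ, E) p, ‖u‖ ≤ 2 * b ∧ q = chartExp p u := by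
  obtain ⟨w, hw, hw'⟩ := eventually_edist_chartLog (E := E) p
  obtain ⟨r, hr, hrw⟩ := Metric.nhds_basis_eball.mem_iff.mp
    (inter_mem hw (chart_source_mem_nhds E p))
  obtain ⟨r', hr', hrr'⟩ := ENNReal.lt_iff_exists_nnreal_btwn.mp hr
  refine ⟨r', by exact_mod_cast hr', fun q b hb hq ↦ ⟨chartLog p q, ?_, ?_⟩⟩
  all_goals
    have hqr : q ∈ Metric.eball p r := by
      rw [Metric.mem_eball, edist_comm]
      refine hq.trans_le ((ENNReal.ofReal_le_ofReal hb).trans ?_)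
      rw [ENNReal.ofReal_coe_nnreal]
      exact hrr'.le
  · have h1 := (hw' q (hrw hqr).1 p (mem_of_mem_nhds hw)).2
    have hb0 : 0 < b := by
      by_contra hb0
      rw [ENNReal.ofReal_of_nonpos (not_lt.mp hb0)] at hq
      exact not_lt_zero hq
    rw [chartLog_self, sub_zero, edist_comm] at h1
    have h2 := h1.trans (mul_le_mul_right hq.le 2)
    rwa [← ENNReal.ofReal_ofNat 2, ← ENNReal.ofReal_mul zero_le_two, ← ofReal_norm,
      ENNReal.ofReal_le_ofReal_iff (by positivity)] at h2
  · exact (chartExp_chartLog (hrw hqr).2).symm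

end ControlledFlow
end LinearizedSolution

/-! ### Inverse shadowing produces bounded solutions on finite intervals. -/

section BoundedSolution

variable {E : Type*} [NormedAddCommGroup E] [NormedSpace ℝ E] [FiniteDimensional ℝ E]
  {M : Type*} [EMetricSpace M] [ChartedSpace E M]
  {X : (x : M) → TangentSpace 𝓘(ℝ, E) x} {Φ : Flow ℝ M} {Λ C : ℝ≥0}
  [IsManifold 𝓘(ℝ, E) 1 M] [RiemannianBundle (fun x : M ↦ TangentSpace 𝓘(ℝ, E) x)]
  [IsContinuousRiemannianBundle E (fun x : M ↦ TangentSpace 𝓘(ℝ, E) x)]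
  [IsRiemannianManifold 𝓘(ℝ, E) M]

theorem le_two_mul_add_of_ofReal_le {a b c : ℝ} {e : ENNReal} (hb : 0 ≤ b) (hc : 0 ≤ c)
    (h : ENNReal.ofReal a ≤ 2 * e + ENNReal.ofReal b) (he : e ≤ ENNReal.ofReal c) :
    a ≤ 2 * c + b := by
  have h1 := h.trans (add_le_add_left (mul_le_mul_right he 2) _)
  rwa [← ENNReal.ofReal_ofNat 2, ← ENNReal.ofReal_mul zero_le_two,
    ← ENNReal.ofReal_add (by positivity) hb, ENNReal.ofReal_le_ofReal_iff (by positivity)] at h1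

namespace ControlledFlow

set_option maxHeartbeats 600000 in
/-- A trajectory of the perturbed flow which stays close to the orbit of `p` yields a tangent vector
at `p`, and time shifts, whose images under the linearized flow compensate the staircase. -/
theorem exists_small_linear_combination (h : ControlledFlow X Φ Λ C) {L : ℝ} (hL : 0 < L) {p : M}
    {d₀ : ℝ} (hd₀ : 0 < d₀) (hp : InverseShadowsAt 𝓘(ℝ, E) Φ p L d₀)
    {w : ℤ → TangentSpace 𝓘(ℝ, E) p} {N : ℕ} {A : ℝ} (hA : 0 ≤ A)
    (hw : ∀ m : ℤ, ∀ j ∈ Icc (-(N : ℤ)) (N - 1), j ∈ Icc (m - 1) (m + 1) →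
      ‖mfderiv 𝓘(ℝ, E) 𝓘(ℝ, E) (Φ m) p (w j)‖ ≤ A) :
    ∃ d > 0, ∃ (u : TangentSpace 𝓘(ℝ, E) p) (τ : ℤ → ℝ), ∀ k ∈ Icc (-(N : ℤ)) N,
      ‖mfderiv 𝓘(ℝ, E) 𝓘(ℝ, E) (Φ k) p (u + d • staircase w N k - τ k • X p)‖ ≤
        (2 * (L * (Λ * (2 * (3 * A + 1)) + 1) + 1) + 1) * d := by
  set B : ℝ := Λ * (2 * (3 * A + 1)) with hB
  have hB0 : 0 ≤ B := by positivity
  -- `S d` bounds the time shifts at `|k| ≤ N`, and `R d` below bounds the vectors `u`, `d ξ(k)` and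
  -- the coordinate of `Φ s p`. Both may depend on `N` and `p`, as they affect only how small `d`
  -- must be.
  set S : ℝ := 2 * (L * (B + 1)) * (N + 1) with hS
  have hS0 : 0 < S := by positivity
  set Ξ : ℝ := ∑ j ∈ Finset.Ico (-(N : ℤ)) N, ‖w j‖ with hΞ
  have hΞ0 : 0 ≤ Ξ := Finset.sum_nonneg fun _ _ ↦ norm_nonneg _
  set R : ℝ := 1 + Ξ + 2 * (L * (B + 1)) + S * (‖X p‖ + 1) with hR
  have hLB : 0 < L * (B + 1) := by positivity
  have hSX : 0 ≤ S * (‖X p‖ + 1) := by positivity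
  have hR0 : 0 < R := by linarith
  set Q : ℝ := ∑ k ∈ Finset.Icc (-(N : ℤ)) N, ‖mfderiv 𝓘(ℝ, E) 𝓘(ℝ, E) (Φ k) p‖ with hQ
  have hQ0 : 0 ≤ Q := Finset.sum_nonneg fun _ _ ↦ ContinuousLinearMap.opNorm_nonneg _
  have hQk : ∀ k ∈ Icc (-(N : ℤ)) N, ‖mfderiv 𝓘(ℝ, E) 𝓘(ℝ, E) (Φ k) p‖ ≤ Q := fun k hk ↦
    Finset.single_le_sum (f := fun k : ℤ ↦ ‖mfderiv 𝓘(ℝ, E) 𝓘(ℝ, E) (Φ k) p‖)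
      (fun _ _ ↦ ContinuousLinearMap.opNorm_nonneg _) (Finset.mem_Icc.mpr hk)
  set ε₁ : ℝ := 1 / (6 * R) with hε₁
  have hε₁0 : 0 < ε₁ := by positivity
  have hε₁R : ε₁ * (6 * R) = 1 := by rw [hε₁]; field_simp
  set ε₂ : ℝ := min 1 (1 / (2 * (Q + 1) * S)) with hε₂
  have hε₂0 : 0 < ε₂ := lt_min one_pos (by positivity)
  have hε₂Q : Q * (ε₂ * S) ≤ 1 / 2 := by
    have h1 : ε₂ ≤ 1 / (2 * (Q + 1) * S) := min_le_right _ _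
    rw [le_div_iff₀ (by positivity)] at h1
    nlinarith [mul_pos hε₂0 hS0]
  -- the trajectory of `p` in the chart
  have hcurve := (hasDerivAt_chartLog_flow h.integralCurve p).isLittleO
  rw [Asymptotics.isLittleO_iff] at hcurve
  have hcurve' : ∀ᶠ s : ℝ in 𝓝 0, ‖chartLog (E := E) p (Φ s p) - s • X p‖ ≤ ε₂ * |s| := by
    filter_upwards [hcurve hε₂0] with s hs
    simpa using hs
  have hcont : Tendsto (fun s ↦ Φ s p) (𝓝 0) (𝓝 p) := by
    have h1 : Continuous fun s ↦ Φ s p := Φ.cont'.comp (continuous_id.prodMk continuous_const)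
    have h2 := h1.tendsto 0
    rwa [Φ.map_zero_apply] at h2
  obtain ⟨σ, hσ, hσ'⟩ := Metric.nhds_basis_closedBall.eventually_iff.mp
    (hcurve'.and (hcont.eventually (chart_source_mem_nhds E p)))
  obtain ⟨a, ha, ha'⟩ := exists_chartExp_of_edist_lt (E := E) p
  have hexp : ∀ᶠ r in 𝓝[>] (0 : ℝ), ∀ m ∈ Finset.Icc (-(N : ℤ) - 1) (N + 1),
      ∀ u v : TangentSpace 𝓘(ℝ, E) p, ‖u‖ ≤ r → ‖v‖ ≤ r →
      edist (Φ m (chartExp p u)) (Φ m (chartExp p v)) ≤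
        2 * ENNReal.ofReal (‖mfderiv 𝓘(ℝ, E) 𝓘(ℝ, E) (Φ m) p (u - v)‖ + ε₁ * (‖u‖ + ‖v‖)) ∧
      ENNReal.ofReal ‖mfderiv 𝓘(ℝ, E) 𝓘(ℝ, E) (Φ m) p (u - v)‖ ≤
        2 * edist (Φ m (chartExp p u)) (Φ m (chartExp p v)) +
          ENNReal.ofReal (ε₁ * (‖u‖ + ‖v‖)) :=
    (Filter.eventually_all_finset _).mpr fun m _ ↦
      eventually_edist_map_chartExp (h.mdifferentiable m p) hε₁0
  have hpos : ∀ᶠ d in 𝓝[>] (0 : ℝ), 0 < d := self_mem_nhdsWithin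
  obtain ⟨d, hd0, hd1, hd2, hd3, hd4, hdκ, hdexp⟩ := (hpos.and
    ((eventually_mul_le (a := B + 1) hd₀).and ((eventually_mul_le (a := L * (B + 1))
    (show (0 : ℝ) < 1 / 2 by norm_num)).and ((eventually_mul_le (a := L * (B + 1)) ha).and
    ((eventually_mul_le (a := S) hσ).and ((eventually_const_mul hR0
    (exists_local_shift (E := E) p)).and
    (eventually_const_mul (show 0 < 3 * R by positivity) hexp))))))).exists
  obtain ⟨κ, hκc, hκ0, hκ, hκe⟩ := hdκ
  have hΞd : ∀ t, ‖d • staircase w N t‖ ≤ R * d := fun t ↦ by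
    rw [norm_smul, Real.norm_eq_abs, abs_of_pos hd0, mul_comm]
    gcongr
    exact (norm_staircase_le w N t).trans (by linarith)
  have hεRd : ε₁ * (6 * (R * d)) = d := by linear_combination d * hε₁R
  obtain ⟨Ψ, hΨ, hΨs, hΨk⟩ := h.exists_smooth_method (θ := fun t ↦ κ (d • staircase w N t))
    (B := B) (d := d) (by
      rw [continuous_iff_continuousAt]
      rintro ⟨t, x⟩
      refine ContinuousAt.comp (g := fun q : TangentSpace 𝓘(ℝ, E) p × M ↦ κ q.1 q.2)
        (f := fun q : ℝ × M ↦ (d • staircase w N q.1, q.2)) (hκc _ (hΞd t) x) ?_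
      exact ((((continuous_staircase w N).const_smul d).comp continuous_fst).prodMk
        continuous_snd).continuousAt)
    (fun x ↦ by simp only [staircase_zero, smul_zero, hκ0])
    (fun t k htk ↦ by simp only [staircase_eq_intCast w N htk]) hB0 hd0
    (fun t t' x ht ↦ h.edist_flow_shift_le hA hd0.le hε₁0.le hεRd.le hw hΞd hκ
      (fun m hm u v hu hv ↦ (hdexp m (Finset.mem_Icc.mpr hm) u v (by rwa [mul_assoc])
        (by rwa [mul_assoc])).1) ht x)
  -- The smoothed perturbation is a `(B + 1) d`-method, so it shadows within `L (B + 1) d`.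
  obtain ⟨q, α, hα, hq⟩ := hp ((B + 1) * d) (by positivity) hd1 Ψ hΨ hΨs
  rw [← mul_assoc] at hα hq
  have hq0 : edist p q < ENNReal.ofReal (L * (B + 1) * d) := by
    have := hq 0
    rwa [Φ.map_zero_apply, hα.2.1, hΨ.1] at this
  obtain ⟨u, hu, rfl⟩ := ha' q _ hd3 hq0
  have huR : ‖u‖ ≤ R * d := by
    refine hu.trans ?_
    rw [← mul_assoc]
    gcongr
    linarith
  -- At time `α.symm k` the method is at its own integer time `k`, up to `d` at `Φ k (chartExp p (u
  -- + d ξ(k)))`, while the exact orbit is at `Φ k (Φ s p)` with `s = α.symm k - k`.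
  refine ⟨d, hd0, u, fun k ↦ α.symm k - k, fun k hk ↦ ?_⟩
  set s : ℝ := α.symm k - k with hs
  have hkN : |(k : ℝ)| ≤ N + 1 := by
    have h1 : (-(N : ℝ)) ≤ k := by exact_mod_cast hk.1
    have h2 : (k : ℝ) ≤ N := by exact_mod_cast hk.2
    rw [abs_le]
    constructor <;> linarith
  have hsS : |s| ≤ S * d := by
    refine (Rep.abs_symm_sub_le hα hd2 k).trans ?_
    calc 2 * (L * (B + 1) * d) * |(k : ℝ)| ≤ 2 * (L * (B + 1) * d) * (N + 1) := by gcongr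
      _ = S * d := by rw [hS]; ring
  obtain ⟨hs1, hs2⟩ := hσ' (show s ∈ Metric.closedBall 0 σ by simpa using hsS.trans hd4)
  set v := chartLog (E := E) p (Φ s p) with hv
  have hev : chartExp p v = Φ s p := chartExp_chartLog hs2
  have hvR : ‖v‖ ≤ R * d := by
    have h1 : ‖v‖ ≤ ε₂ * |s| + |s| * ‖X p‖ := by
      have := norm_le_norm_add_norm_sub' v (s • X p)
      rw [norm_smul, Real.norm_eq_abs] at this
      linarith
    have h2 : ε₂ * |s| ≤ 1 * |s| := by gcongr; exact min_le_left _ _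
    calc ‖v‖ ≤ |s| * (‖X p‖ + 1) := by linarith
      _ ≤ S * d * (‖X p‖ + 1) := by gcongr
      _ = S * (‖X p‖ + 1) * d := by ring
      _ ≤ R * d := by gcongr; linarith
  set u' := u + d • staircase w N k with hu'
  have hu'R : ‖u'‖ ≤ 2 * (R * d) := (norm_add_le _ _).trans (by linarith [hΞd k])
  have hRd : 0 < R * d := by positivity
  have hkN' : k ∈ Finset.Icc (-(N : ℤ) - 1) (N + 1) :=
    Finset.mem_Icc.mpr ⟨by linarith [hk.1], by linarith [hk.2]⟩
  have h1 := (hdexp k hkN' u' v (by linarith) (by linarith)).2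
  have h2 : edist (Φ k (chartExp p u')) (Φ k (chartExp p v)) ≤
      ENNReal.ofReal ((L * (B + 1) + 1) * d) := by
    have h3 := hq (α.symm k)
    rw [α.apply_symm_apply] at h3
    have h4 := hΨk k (chartExp p u)
    simp only [hκe u _ huR] at h4
    rw [hev, ← Φ.map_add, hs, add_sub_cancel, edist_comm, add_mul, one_mul,
      ENNReal.ofReal_add (by positivity) hd0.le]
    exact (edist_triangle _ _ _).trans (add_le_add h3.le h4)
  have h3 : ‖mfderiv 𝓘(ℝ, E) 𝓘(ℝ, E) (Φ k) p (u' - v)‖ ≤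
      2 * ((L * (B + 1) + 1) * d) + ε₁ * (‖u'‖ + ‖v‖) :=
    le_two_mul_add_of_ofReal_le (by positivity) (by positivity) h1 h2
  have h4 : ε₁ * (‖u'‖ + ‖v‖) ≤ d / 2 := by
    calc ε₁ * (‖u'‖ + ‖v‖) ≤ ε₁ * (3 * (R * d)) := by gcongr; linarith
      _ = d / 2 := by linarith
  have h5 : ‖mfderiv 𝓘(ℝ, E) 𝓘(ℝ, E) (Φ k) p (v - s • X p)‖ ≤ d / 2 := by
    calc _ ≤ ‖mfderiv 𝓘(ℝ, E) 𝓘(ℝ, E) (Φ k) p‖ * ‖v - s • X p‖ :=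
          ContinuousLinearMap.le_opNorm _ _
      _ ≤ Q * (ε₂ * (S * d)) := by
          gcongr
          · exact hQk k hk
          · exact hs1.trans (by gcongr)
      _ = Q * (ε₂ * S) * d := by ring
      _ ≤ 1 / 2 * d := by gcongr
      _ = d / 2 := by ring
  have h6 : u' - s • X p = (u' - v) + (v - s • X p) := by abel
  -- The bound is `2 (L (B + 1) + 1) d` from shadowing, `d / 2` from linearizing `Φ k`, and `d / 2`
  -- from replacing the coordinate of `Φ s p` by `s X(p)`.
  rw [h6, map_add]
  refine (norm_add_le _ _).trans ?_
  linarith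

/-- The vectors `DΦ(k)(u + d ξ(k) - τ_k X(p)) / d` solve the system: the increment of `ξ` produces
`z (k + 1)` and that of `τ` the multiple of `X`. The bound is free of `N`, `p` and `d₀`. -/
theorem exists_bounded_solution (h : ControlledFlow X Φ Λ C) {L : ℝ} (hL : 0 < L) {p : M}
    {d₀ : ℝ} (hd₀ : 0 < d₀) (hp : InverseShadowsAt 𝓘(ℝ, E) Φ p L d₀)
    {z : (k : ℤ) → TangentSpace 𝓘(ℝ, E) (orbit Φ p k)} (hz : ∀ k, ‖z k‖ ≤ 1) (N : ℕ) :
    ∃ (s : ℤ → ℝ) (x : (k : ℤ) → TangentSpace 𝓘(ℝ, E) (orbit Φ p k)),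
      (∀ k ∈ Icc (-(N : ℤ)) (N - 1),
        x (k + 1) = stepDeriv 𝓘(ℝ, E) Φ p k (x k) + s k • X (orbit Φ p (k + 1)) + z (k + 1)) ∧
      ∀ k ∈ Icc (-(N : ℤ)) N,
        ‖x k‖ ≤ 2 * (L * (Λ * (2 * (3 * (4 * Λ) + 1)) + 1) + 1) + 1 := by
  obtain ⟨d, hd, u, τ, hbound⟩ := h.exists_small_linear_combination hL hd₀ hp
    (w := pullBack Φ p z) (N := N) (A := 4 * Λ) (by positivity)
    (fun m j _ hj ↦ h.norm_mfderivTo_pullBack_le p hz hj)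
  set ξ := staircase (pullBack Φ p z) N with hξ
  let F : (k : ℤ) → TangentSpace 𝓘(ℝ, E) p →L[ℝ] TangentSpace 𝓘(ℝ, E) (orbit Φ p k) := fun k ↦
    mfderivTo 𝓘(ℝ, E) (Φ k) (rfl : Φ k p = orbit Φ p k)
  refine ⟨fun k ↦ d⁻¹ * (τ k - τ (k + 1)), fun k ↦ d⁻¹ • F k (u + d • ξ k - τ k • X p),
    fun k hk ↦ ?_, fun k hk ↦ ?_⟩
  · have h1 : ξ ((k + 1 : ℤ) : ℝ) = ξ k + pullBack Φ p z k := by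
      rw [← staircase_add_one_sub (pullBack Φ p z) N hk, hξ, add_sub_cancel]
    have h2 : F (k + 1) (pullBack Φ p z k) = z (k + 1) := h.mfderivTo_pullBack_self p z k
    have h3 : F (k + 1) (X p) = X (orbit Φ p (k + 1)) :=
      mfderivTo_flow_field h.integralCurve h.mdifferentiable _
    have h4 : ∀ v, stepDeriv 𝓘(ℝ, E) Φ p k (F k v) = F (k + 1) v := h.stepDeriv_mfderivTo p k
    have h5 : u + d • ξ ((k + 1 : ℤ) : ℝ) - τ (k + 1) • X p =
        (u + d • ξ k - τ k • X p) + (τ k - τ (k + 1)) • X p + d • pullBack Φ p z k := by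
      rw [h1, smul_add, sub_smul]
      abel
    beta_reduce
    rw [h5, map_add, map_add, map_smul, map_smul, map_smul, h2, h3, h4, smul_add, smul_add,
      smul_smul, inv_smul_smul₀ hd.ne']
  · have h1 : ‖F k (u + d • ξ k - τ k • X p)‖ ≤ _ := hbound k hk
    rw [norm_smul, norm_inv, Real.norm_eq_abs, abs_of_pos hd, inv_mul_le_iff₀ hd, mul_comm d]
    exact h1

end ControlledFlow
end BoundedSolution

/-! ### A flow on a closed manifold is controlled. -/

section ClosedManifold

variable {E : Type*} [NormedAddCommGroup E] [NormedSpace ℝ E] [FiniteDimensional ℝ E]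
  {M : Type*} [EMetricSpace M] [ChartedSpace E M] [IsManifold 𝓘(ℝ, E) ∞ M] [CompactSpace M]
  {Φ : Flow ℝ M} {X : (x : M) → TangentSpace 𝓘(ℝ, E) x}

theorem exists_smooth_approx_of_eq_near_zero {F : ℝ × M → M} (hF : Continuous F) {a : ℝ}
    (ha : 0 < a) (hFa : ∀ t x, |t| < a → F (t, x) = x) {ε : ENNReal} (hε : 0 < ε) :
    ∃ G : ℝ × M → M, ContMDiff (𝓘(ℝ, ℝ).prod 𝓘(ℝ, E)) 𝓘(ℝ, E) ∞ G ∧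
      (∀ x, G (0, x) = x) ∧ ∀ q, edist (G q) (F q) < ε := by
  have hopen : IsOpen {q : ℝ × M | |q.1| < a} := isOpen_lt (by fun_prop) continuous_const
  obtain ⟨G, hG, hGF, hGS⟩ := exists_contMDiff_edist_lt (J := 𝓘(ℝ, ℝ).prod 𝓘(ℝ, E)) hF
    (S := {q : ℝ × M | q.1 = 0}) (U := {q : ℝ × M | |q.1| < a})
    (isClosed_eq continuous_fst continuous_const) hopen
    (fun q hq ↦ by simpa [show q.1 = 0 from hq] using ha) (fun q hq ↦ by
      refine (contMDiffAt_snd (I := 𝓘(ℝ, ℝ)) (J := 𝓘(ℝ, E))).congr_of_eventuallyEq ?_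
      filter_upwards [hopen.mem_nhds hq] with q' hq'
      exact hFa q'.1 q'.2 hq') hε
  refine ⟨G, hG, fun x ↦ ?_, hGF⟩
  rw [hGS (show ((0 : ℝ), x) ∈ {q : ℝ × M | q.1 = 0} from rfl)]
  exact hFa 0 x (by simpa using ha)

variable [RiemannianBundle (fun x : M ↦ TangentSpace 𝓘(ℝ, E) x)]
  [IsContinuousRiemannianBundle E (fun x : M ↦ TangentSpace 𝓘(ℝ, E) x)]
  [IsRiemannianManifold 𝓘(ℝ, E) M]

theorem exists_controlledFlow
    (hX : ContMDiff 𝓘(ℝ, E) 𝓘(ℝ, E).tangent 1 (fun x ↦ (⟨x, X x⟩ : TangentBundle 𝓘(ℝ, E) M)))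
    (hΦ : ∀ x, IsMIntegralCurve (fun t ↦ Φ t x) X) : ∃ Λ C : ℝ≥0, ControlledFlow X Φ Λ C := by
  obtain ⟨C, hC⟩ := exists_edist_flow_flow_le hX hΦ
  obtain ⟨Λ, hΛ⟩ := exists_lipschitzWith_flow hX hΦ 2
  exact ⟨Λ, C, hΦ, fun t ↦ (contMDiff_flow hX hΦ t).mdifferentiable one_ne_zero, hΛ, hC,
    fun F hF a ha hFa ε hε ↦ exists_smooth_approx_of_eq_near_zero hF ha hFa hε⟩

end ClosedManifold

/-! ### Limits of tangent vectors and functionals over moving base points. -/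

section TangentContinuity

variable {E : Type*} [NormedAddCommGroup E] [NormedSpace ℝ E]
  {M : Type*} [EMetricSpace M] [ChartedSpace E M] [IsManifold 𝓘(ℝ, E) 1 M]

theorem tendsto_continuousLinearMapAt {ι : Type*} {l : Filter ι} {z : ι → TangentBundle 𝓘(ℝ, E) M}
    {z₀ : TangentBundle 𝓘(ℝ, E) M} (hz : Tendsto z l (𝓝 z₀)) :
    Tendsto (fun i ↦ (trivializationAt E (TangentSpace 𝓘(ℝ, E)) z₀.1).continuousLinearMapAt ℝ
      (z i).1 (z i).2) l (𝓝 (ofTangent z₀.1 z₀.2)) := by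
  set e := trivializationAt E (TangentSpace 𝓘(ℝ, E) (M := M)) z₀.1 with he
  have hmem : z₀ ∈ e.source := FiberBundle.mem_trivializationAt_proj_source
  have h1 := (continuous_snd.tendsto _).comp ((e.continuousAt hmem).tendsto.comp hz)
  have h2 : ∀ z ∈ e.source, (e z).2 = e.continuousLinearMapAt ℝ z.1 z.2 := fun z hz ↦
    (e.continuousLinearMapAt_apply_of_mem (R := ℝ) (b := z.1) (e.mem_source.mp hz) z.2).symm
  have h3 : (e z₀).2 = ofTangent z₀.1 z₀.2 := h2 z₀ hmem
  rw [← h3]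
  refine h1.congr' ?_
  filter_upwards [hz (e.open_source.mem_nhds hmem)] with i hi
  exact h2 (z i) hi

theorem tendsto_symmL (x : M) (v : E) :
    Tendsto (fun y ↦ (⟨y, (trivializationAt E (TangentSpace 𝓘(ℝ, E)) x).symmL ℝ y v⟩ :
      TangentBundle 𝓘(ℝ, E) M)) (𝓝 x) (𝓝 ⟨x, toTangent x v⟩) := by
  set e := trivializationAt E (TangentSpace 𝓘(ℝ, E) (M := M)) x with he
  have hmem : x ∈ e.baseSet := FiberBundle.mem_baseSet_trivializationAt' x
  have h1 : ContinuousAt (fun z : M × E ↦ TotalSpace.mk' E z.1 (e.symm z.1 z.2)) (x, v) :=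
    e.continuousOn_symm.continuousAt ((e.open_baseSet.prod isOpen_univ).mem_nhds ⟨hmem, trivial⟩)
  have h2 := h1.tendsto.comp ((continuous_id.prodMk (continuous_const (y := v))).tendsto x)
  have h3 : toTangent x v = e.symm x v := e.symmL_apply (R := ℝ) hmem v
  rw [h3]
  refine h2.congr' ?_
  filter_upwards [e.open_baseSet.mem_nhds hmem] with y hy
  exact congrArg (TotalSpace.mk' E y) (e.symmL_apply (R := ℝ) hy v).symm

theorem tendsto_mfderiv_symmL {f : M → M} (hf : ContMDiff 𝓘(ℝ, E) 𝓘(ℝ, E) 1 f) (x : M) (v : E) :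
    Tendsto (fun y ↦ (trivializationAt E (TangentSpace 𝓘(ℝ, E)) (f x)).continuousLinearMapAt ℝ
        (f y) (mfderiv 𝓘(ℝ, E) 𝓘(ℝ, E) f y
          ((trivializationAt E (TangentSpace 𝓘(ℝ, E)) x).symmL ℝ y v))) (𝓝 x)
      (𝓝 (ofTangent (f x) (mfderiv 𝓘(ℝ, E) 𝓘(ℝ, E) f x (toTangent x v)))) :=
  tendsto_continuousLinearMapAt
    (z := fun y ↦ (⟨f y, mfderiv 𝓘(ℝ, E) 𝓘(ℝ, E) f y
      ((trivializationAt E (TangentSpace 𝓘(ℝ, E)) x).symmL ℝ y v)⟩ : TangentBundle 𝓘(ℝ, E) M))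
    (z₀ := ⟨f x, mfderiv 𝓘(ℝ, E) 𝓘(ℝ, E) f x (toTangent x v)⟩)
    (((hf.continuous_tangentMap le_rfl).tendsto _).comp (tendsto_symmL x v))

end TangentContinuity

section Dual

variable {V : Type*} [NormedAddCommGroup V] [NormedSpace ℝ V]

theorem norm_inv_smul_dual (c : ℝ) (φ : V →L[ℝ] ℝ) : ‖c⁻¹ • φ‖ = |c|⁻¹ * ‖φ‖ := by
  rw [norm_smul, norm_inv, Real.norm_eq_abs]

/-- A bounded sequence of functionals on a finite-dimensional space converges in norm along a
nonprincipal ultrafilter. -/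
theorem exists_dual_limit [FiniteDimensional ℝ V] {φ : ℕ → V →L[ℝ] ℝ} {C : ℝ}
    (h : ∀ᶠ n in (hyperfilter ℕ : Filter ℕ), ‖φ n‖ ≤ C) :
    ∃ φ₀ : V →L[ℝ] ℝ, ‖φ₀‖ ≤ C ∧
      (∀ (v : ℕ → V) (w : V), Tendsto v (hyperfilter ℕ) (𝓝 w) →
        Tendsto (fun n ↦ φ n (v n)) (hyperfilter ℕ) (𝓝 (φ₀ w))) ∧
      ∀ c : ℝ, (∀ᶠ n in (hyperfilter ℕ : Filter ℕ), c ≤ ‖φ n‖) → c ≤ ‖φ₀‖ := by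
  have : ProperSpace (V →L[ℝ] ℝ) := FiniteDimensional.proper ℝ _
  obtain ⟨φ₀, h0, h1⟩ := exists_tendsto_hyperfilter h
  exact ⟨φ₀, h0, fun v w hv ↦ (isBoundedBilinearMap_apply (𝕜 := ℝ).continuous.tendsto (φ₀, w)).comp
    (h1.prodMk_nhds hv), fun c hc ↦ ge_of_tendsto h1.norm hc⟩

end Dual

section Reindex

variable {E : Type*} [NormedAddCommGroup E] [NormedSpace ℝ E]
  {M : Type*} [EMetricSpace M] [ChartedSpace E M]

/-- Absorbs the cast between the indices `j + i + 1` and `j + (i + 1)`. -/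
theorem adjoint_orbit_reindex {Φ : Flow ℝ M} {p : M} {k k' : ℤ} (hk : k' = k + 1)
    {ψ : ∀ k, TangentSpace 𝓘(ℝ, E) (orbit Φ p k) →L[ℝ] ℝ}
    (h : ψ k = (ψ (k + 1)).comp (stepDeriv 𝓘(ℝ, E) Φ p k)) (hkk' : Φ 1 (orbit Φ p k) = orbit Φ p k') :
    ψ k = (ψ k').comp (mfderivTo 𝓘(ℝ, E) (Φ 1) hkk') := by
  subst hk
  exact h

end Reindex

/-! ### Uniform expansivity of the adjoint equation by compactness. -/

section Compactness

variable {E : Type*} [NormedAddCommGroup E] [NormedSpace ℝ E]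
  {M : Type*} [EMetricSpace M] [ChartedSpace E M] [IsManifold 𝓘(ℝ, E) 1 M]

theorem tendsto_mfderivTo_symmL {f : M → M} (hf : ContMDiff 𝓘(ℝ, E) 𝓘(ℝ, E) 1 f) {x x' : M}
    (h : f x = x') (v : E) {ι : Type*} {l : Filter ι} {y y' : ι → M} (hy : Tendsto y l (𝓝 x))
    (hyy' : ∀ i, f (y i) = y' i) :
    Tendsto (fun i ↦ (trivializationAt E (TangentSpace 𝓘(ℝ, E)) x').continuousLinearMapAt ℝ
        (y' i) (mfderivTo 𝓘(ℝ, E) f (hyy' i)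
          ((trivializationAt E (TangentSpace 𝓘(ℝ, E)) x).symmL ℝ (y i) v))) l
      (𝓝 (ofTangent x' (mfderivTo 𝓘(ℝ, E) f h (toTangent x v)))) := by
  subst h
  obtain rfl : (fun i ↦ f (y i)) = y' := funext hyy'
  exact (tendsto_mfderiv_symmL hf x v).comp hy

/-- A functional on the tangent space at `y`, transported to the tangent space at `x` by the
trivialization at `x`. -/
def transport (x y : M) (a : TangentSpace 𝓘(ℝ, E) y →L[ℝ] ℝ) : TangentSpace 𝓘(ℝ, E) x →L[ℝ] ℝ :=
  a.comp (((trivializationAt E (TangentSpace 𝓘(ℝ, E)) x).symmL ℝ y).comp (ofTangent x))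

theorem transport_toTangent {x y : M} (hy : y ∈ (chartAt E x).source)
    (a : TangentSpace 𝓘(ℝ, E) y →L[ℝ] ℝ) (w : TangentSpace 𝓘(ℝ, E) y) :
    transport x y a (toTangent x ((trivializationAt E (TangentSpace 𝓘(ℝ, E)) x).continuousLinearMapAt
      ℝ y w)) = a w := by
  have h1 : (trivializationAt E (TangentSpace 𝓘(ℝ, E)) x).symmL ℝ y
      ((trivializationAt E (TangentSpace 𝓘(ℝ, E)) x).continuousLinearMapAt ℝ y w) = w :=
    (trivializationAt E (TangentSpace 𝓘(ℝ, E)) x).symmL_continuousLinearMapAt (by simpa using hy) w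
  rw [transport, ContinuousLinearMap.comp_apply, ContinuousLinearMap.comp_apply,
    ofTangent_toTangent, h1]

variable [RiemannianBundle (fun x : M ↦ TangentSpace 𝓘(ℝ, E) x)]
  [IsContinuousRiemannianBundle E (fun x : M ↦ TangentSpace 𝓘(ℝ, E) x)]

theorem eventually_norm_transport (x : M) : ∀ᶠ y in 𝓝 x, ∀ a : TangentSpace 𝓘(ℝ, E) y →L[ℝ] ℝ,
    ‖transport x y a‖ ≤ 2 * ‖a‖ ∧ ‖a‖ ≤ 2 * ‖transport x y a‖ := by
  filter_upwards [eventually_norm_symmL_le (E := E) x, eventually_norm_toTangent_le (E := E) x,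
    chart_source_mem_nhds E x] with y h1 h2 hy a
  constructor
  · refine ContinuousLinearMap.opNorm_le_bound _ (by positivity) fun v ↦ ?_
    have h3 := h1 (ofTangent x v)
    rw [toTangent_ofTangent] at h3
    calc ‖transport x y a v‖ ≤ ‖a‖ * ‖(trivializationAt E (TangentSpace 𝓘(ℝ, E)) x).symmL ℝ y
          (ofTangent x v)‖ := a.le_opNorm _
      _ ≤ ‖a‖ * (2 * ‖v‖) := by gcongr
      _ = 2 * ‖a‖ * ‖v‖ := by ring
  · refine ContinuousLinearMap.opNorm_le_bound _ (by positivity) fun w ↦ ?_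
    rw [← transport_toTangent hy a w]
    refine ((transport x y a).le_opNorm _).trans ?_
    rw [mul_comm 2, mul_assoc]
    gcongr
    exact h2 w

variable [FiniteDimensional ℝ E] [CompactSpace M] {Φ : Flow ℝ M}
  {X : (x : M) → TangentSpace 𝓘(ℝ, E) x}

/-- If no orbit carries a nontrivial bounded solution of the adjoint equation that vanishes on the
field, then the adjoint equation is uniformly expansive. -/
theorem exists_adjointExpansive (hf : ContMDiff 𝓘(ℝ, E) 𝓘(ℝ, E) 1 (Φ 1))
    (hX : Continuous (fun x ↦ (⟨x, X x⟩ : TangentBundle 𝓘(ℝ, E) M)))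
    (hno : ∀ q (φ : ∀ k, TangentSpace 𝓘(ℝ, E) (orbit Φ q k) →L[ℝ] ℝ),
      (∀ k, φ k (X (orbit Φ q k)) = 0) →
      (∀ k, φ k = (φ (k + 1)).comp (stepDeriv 𝓘(ℝ, E) Φ q k)) → ∀ C : ℝ, (∀ k, ‖φ k‖ ≤ C) →
      φ 0 = 0) :
    ∃ N : ℕ, ∀ p, AdjointExpansive (stepDeriv 𝓘(ℝ, E) Φ p) (fun k ↦ X (orbit Φ p k)) N := by
  by_contra! hcon
  simp only [AdjointExpansive, not_forall, not_exists, not_and, not_le] at hcon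
  -- For each `n` there is an adjoint solution on a window of radius `n` that nowhere reaches twice
  -- its central size. Recentred, normalized and passed to the limit, these give a nonzero bounded
  -- solution on a whole orbit.
  choose p j ψ hrel hfield hlt using hcon
  set x : ℕ → M := fun n ↦ orbit Φ (p n) (j n) with hx
  obtain ⟨q, -, hq⟩ := isCompact_univ.ultrafilter_le_nhds' ((hyperfilter ℕ).map x) univ_mem
  have hxq : Tendsto x (hyperfilter ℕ) (𝓝 q) := hq
  set y : ℕ → ℤ → M := fun n i ↦ orbit Φ (p n) (j n + i) with hy
  have hyx : ∀ n i, y n i = Φ i (x n) := fun n i ↦ by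
    simp only [hy, hx, orbit, ← Φ.map_add]
    push_cast
    rw [add_comm]
  have hyq : ∀ i, Tendsto (fun n ↦ y n i) (hyperfilter ℕ) (𝓝 (orbit Φ q i)) := fun i ↦ by
    have h1 : Continuous fun x ↦ Φ (i : ℝ) x := Φ.cont'.comp (continuous_const.prodMk continuous_id)
    simp only [hyx]
    exact (h1.tendsto q).comp hxq
  have hy1 : ∀ i n, Φ 1 (y n i) = y n (i + 1) := fun i n ↦ by
    rw [hyx, hyx, ← Φ.map_add]
    push_cast
    rw [add_comm]
  have hψ0 : ∀ n, 0 < ‖ψ n (j n)‖ := fun n ↦ by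
    have := hlt n (j n) ⟨by omega, by omega⟩
    linarith [norm_nonneg (ψ n (j n))]
  let a : (n : ℕ) → (i : ℤ) → TangentSpace 𝓘(ℝ, E) (y n i) →L[ℝ] ℝ := fun n i ↦
    ‖ψ n (j n)‖⁻¹ • ψ n (j n + i)
  have hanorm : ∀ n i, ‖a n i‖ = ‖ψ n (j n)‖⁻¹ * ‖ψ n (j n + i)‖ := fun n i ↦ by
    simp only [a]
    rw [norm_inv_smul_dual (V := TangentSpace 𝓘(ℝ, E) (y n i)), abs_norm]
  have ha0 : ∀ n, ‖a n 0‖ = 1 := fun n ↦ by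
    have h1 : ∀ k, k = j n → ‖ψ n k‖ = ‖ψ n (j n)‖ := by rintro _ rfl; rfl
    rw [hanorm, h1 _ (add_zero _), inv_mul_cancel₀ (hψ0 n).ne']
  have hev : ∀ i : ℤ, ∀ᶠ n : ℕ in (hyperfilter ℕ : Filter ℕ), -(n : ℤ) ≤ i ∧ i ≤ n - 1 := fun i ↦ by
    filter_upwards [eventually_hyperfilter_ge (i.natAbs + 1)] with n hn
    constructor <;> omega
  have ha2 : ∀ i, ∀ᶠ n in (hyperfilter ℕ : Filter ℕ), ‖a n i‖ ≤ 2 := fun i ↦ by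
    filter_upwards [hev i] with n hn
    rw [hanorm, inv_mul_le_iff₀ (hψ0 n), mul_comm]
    exact (hlt n (j n + i) ⟨by omega, by omega⟩).le
  have haX : ∀ i, ∀ᶠ n in (hyperfilter ℕ : Filter ℕ), a n i (X (y n i)) = 0 := fun i ↦ by
    filter_upwards [hev i] with n hn
    have h1 := hfield n (j n + i) ⟨by omega, by omega⟩
    simp only [a]
    rw [smul_apply, h1, smul_zero]
  have harel : ∀ i, ∀ᶠ n in (hyperfilter ℕ : Filter ℕ),
      a n i = (a n (i + 1)).comp (mfderivTo 𝓘(ℝ, E) (Φ 1) (hy1 i n)) := fun i ↦ by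
    filter_upwards [hev i] with n hn
    have h1 := adjoint_orbit_reindex (add_assoc (j n) i 1).symm
      (hrel n (j n + i) ⟨by omega, by omega⟩) (hy1 i n)
    simp only [a]
    rw [ContinuousLinearMap.smul_comp, h1]
  -- The bound `4` is `2` from the failed expansivity times `2` from the transport to the fixed
  -- tangent space; in the same way the central norm `1` leaves at least `1 / 2` in the limit.
  have hlim : ∀ i, ∃ φ : TangentSpace 𝓘(ℝ, E) (orbit Φ q i) →L[ℝ] ℝ, ‖φ‖ ≤ 4 ∧
      (∀ (v : ℕ → TangentSpace 𝓘(ℝ, E) (orbit Φ q i)) (w : TangentSpace 𝓘(ℝ, E) (orbit Φ q i)),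
        Tendsto v (hyperfilter ℕ) (𝓝 w) →
        Tendsto (fun n ↦ transport (orbit Φ q i) (y n i) (a n i) (v n)) (hyperfilter ℕ)
          (𝓝 (φ w))) ∧
      ∀ c : ℝ, (∀ᶠ n in (hyperfilter ℕ : Filter ℕ), c ≤
        ‖transport (orbit Φ q i) (y n i) (a n i)‖) → c ≤ ‖φ‖ := fun i ↦ by
    have := finiteDimensional_tangentSpace (E := E) (orbit Φ q i)
    refine exists_dual_limit (V := TangentSpace 𝓘(ℝ, E) (orbit Φ q i)) ?_
    filter_upwards [ha2 i, (hyq i).eventually (eventually_norm_transport (E := E) _)] with n h1 h2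
    exact (h2 _).1.trans (by linarith)
  choose φ hφ4 hφ hφn using hlim
  have hfar : φ 0 = 0 := by
    refine hno q φ (fun i ↦ ?_) (fun i ↦ ?_) 4 hφ4
    · have h1 := tendsto_continuousLinearMapAt ((hX.tendsto _).comp (hyq i))
      have h2 := hφ i _ _ (((toTangent (orbit Φ q i)).continuous.tendsto _).comp h1)
      rw [toTangent_ofTangent] at h2
      refine tendsto_nhds_unique h2 (tendsto_const_nhds.congr' ?_)
      filter_upwards [haX i, (hyq i).eventually (chart_source_mem_nhds E _)] with n h3 h4
      exact (h3.symm.trans (transport_toTangent h4 (a n i) (X (y n i))).symm)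
    · ext v
      have h1 := tendsto_mfderivTo_symmL hf (orbit_succ Φ q i) (ofTangent _ v) (hyq i) (hy1 i)
      have h2 := hφ (i + 1) _ _
        (((toTangent (orbit Φ q (i + 1))).continuous.tendsto _).comp h1)
      rw [toTangent_ofTangent, toTangent_ofTangent] at h2
      have h3 := hφ i _ _ (tendsto_const_nhds (x := v))
      refine tendsto_nhds_unique h3 (h2.congr' ?_)
      filter_upwards [harel i, (hyq (i + 1)).eventually (chart_source_mem_nhds E _)] with n h4 h5
      refine (transport_toTangent h5 (a n (i + 1)) _).trans ?_
      rw [h4]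
      rfl
  have h1 : (1 : ℝ) / 2 ≤ ‖φ 0‖ := by
    refine hφn 0 _ ?_
    filter_upwards [(hyq 0).eventually (eventually_norm_transport (E := E) _)] with n h2
    have h3 := (h2 (a n 0)).2
    rw [ha0] at h3
    linarith
  rw [hfar, ContinuousLinearMap.opNorm_zero] at h1
  linarith

end Compactness

/-! ### Consequences of shadowing for a controlled flow. -/

section Conclusion

variable {E : Type*} [NormedAddCommGroup E] [NormedSpace ℝ E]
  {M : Type*} [EMetricSpace M] [ChartedSpace E M]
  {X : (x : M) → TangentSpace 𝓘(ℝ, E) x} {Φ : Flow ℝ M} {Λ C : ℝ≥0}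
  [RiemannianBundle (fun x : M ↦ TangentSpace 𝓘(ℝ, E) x)]

theorem ControlledFlow.projectedSolvable [FiniteDimensional ℝ E] (h : ControlledFlow X Φ Λ C) {L : ℝ}
    (hL : SolvableOnIntervals 𝓘(ℝ, E) X Φ L) : ProjectedSolvable 𝓘(ℝ, E) X Φ L := by
  intro p b hb hb1
  have := fun k ↦ finiteDimensional_tangentSpace (E := E) (orbit Φ p k)
  exact BoundedlySolvable.projected (T := fun k ↦ TangentSpace 𝓘(ℝ, E) (orbit Φ p k))
    (A := stepDeriv 𝓘(ℝ, E) Φ p) (X := fun k ↦ X (orbit Φ p k)) (hL p) (h.stepDeriv_field p) b hb hb1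

variable [IsManifold 𝓘(ℝ, E) 1 M]
  [IsContinuousRiemannianBundle E (fun x : M ↦ TangentSpace 𝓘(ℝ, E) x)]
  [IsRiemannianManifold 𝓘(ℝ, E) M]

theorem ControlledFlow.norm_stepDeriv_le (h : ControlledFlow X Φ Λ C) (p : M) (k : ℤ) :
    ‖stepDeriv 𝓘(ℝ, E) Φ p k‖ ≤ 4 * Λ :=
  norm_mfderivTo_le _ (h.mdifferentiable 1 _) (h.lipschitz 1 (by norm_num))

variable [FiniteDimensional ℝ E]

theorem ControlledFlow.exists_solvableOnIntervals (h : ControlledFlow X Φ Λ C)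
    (hS : UniformLISP 𝓘(ℝ, E) Φ) : ∃ L, SolvableOnIntervals 𝓘(ℝ, E) X Φ L := by
  obtain ⟨L, d₀, hL, hd₀, hp⟩ := hS
  exact ⟨_, fun p z hz N ↦ h.exists_bounded_solution hL hd₀ (hp p) hz N⟩

/-- Shadowing constants that depend on `p` suffice here, because the conclusion contains no
constant. -/
theorem ControlledFlow.eq_zero_of_adjoint_bounded (h : ControlledFlow X Φ Λ C)
    (hS : LISP 𝓘(ℝ, E) Φ) (p : M) (φ : ∀ k, TangentSpace 𝓘(ℝ, E) (orbit Φ p k) →L[ℝ] ℝ)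
    (hφX : ∀ k, φ k (X (orbit Φ p k)) = 0)
    (hφ : ∀ k, φ k = (φ (k + 1)).comp (stepDeriv 𝓘(ℝ, E) Φ p k)) (B : ℝ)
    (hB : ∀ k, ‖φ k‖ ≤ B) : φ 0 = 0 := by
  obtain ⟨L, d₀, hL, hd₀, hp⟩ := hS p
  have := fun k ↦ finiteDimensional_tangentSpace (E := E) (orbit Φ p k)
  have : ∀ k, CompleteSpace (TangentSpace 𝓘(ℝ, E) (orbit Φ p k)) :=
    fun k ↦ FiniteDimensional.complete ℝ _
  have hsol : BoundedlySolvable (T := fun k ↦ TangentSpace 𝓘(ℝ, E) (orbit Φ p k))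
      (stepDeriv 𝓘(ℝ, E) Φ p) (fun k ↦ X (orbit Φ p k))
      (2 * (L * (Λ * (2 * (3 * (4 * Λ) + 1)) + 1) + 1) + 1) :=
    fun z hz N ↦ h.exists_bounded_solution hL hd₀ hp hz N
  exact DualEstimate.eq_zero_of_bounded (by positivity) hsol.dualEstimate hφX hφ hB

end Conclusion

/-! ### Uniform solvability on a closed manifold. -/

section Closed

variable {E : Type*} [NormedAddCommGroup E] [NormedSpace ℝ E] [FiniteDimensional ℝ E]
  {M : Type*} [EMetricSpace M] [ChartedSpace E M] [IsManifold 𝓘(ℝ, E) ∞ M] [CompactSpace M]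
  {X : (x : M) → TangentSpace 𝓘(ℝ, E) x} {Φ : Flow ℝ M}
  [RiemannianBundle (fun x : M ↦ TangentSpace 𝓘(ℝ, E) x)]
  [IsContinuousRiemannianBundle E (fun x : M ↦ TangentSpace 𝓘(ℝ, E) x)]
  [IsRiemannianManifold 𝓘(ℝ, E) M]

/-- The final constant comes from the window size and the norm bound `4 Λ`, not from the shadowing
constants of individual points. -/
theorem exists_solvable_of_compact
    (hX : ContMDiff 𝓘(ℝ, E) 𝓘(ℝ, E).tangent 1 (fun x ↦ (⟨x, X x⟩ : TangentBundle 𝓘(ℝ, E) M)))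
    (hΦ : ∀ x, IsMIntegralCurve (fun t ↦ Φ t x) X) (hS : LISP 𝓘(ℝ, E) Φ) :
    ∃ L, SolvableOnIntervals 𝓘(ℝ, E) X Φ L ∧ ProjectedSolvable 𝓘(ℝ, E) X Φ L := by
  obtain ⟨Λ, C, h⟩ := exists_controlledFlow hX hΦ
  obtain ⟨N, hN⟩ := exists_adjointExpansive (contMDiff_flow hX hΦ 1) hX.continuous
    (h.eq_zero_of_adjoint_bounded hS)
  obtain ⟨L, hL, hdual⟩ := exists_dualEstimate_of_adjointExpansive N (max 1 (4 * Λ))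
    (le_max_left _ _)
  have hsol : SolvableOnIntervals 𝓘(ℝ, E) X Φ L := fun p ↦ by
    have := fun k ↦ finiteDimensional_tangentSpace (E := E) (orbit Φ p k)
    exact DualEstimate.boundedlySolvable (T := fun k ↦ TangentSpace 𝓘(ℝ, E) (orbit Φ p k)) hL
      (hdual (fun k ↦ (h.norm_stepDeriv_le p k).trans (le_max_right _ _)) (h.stepDeriv_field p)
        (hN p))
  exact ⟨L, hsol, h.projectedSolvable hsol⟩

end Closed

/-! ### Euclidean space, where (UB) controls the flow. -/

section ContinuousMetric

theorem isContinuousRiemannianBundle_of_contMDiff {B H EB F : Type*}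
    [NormedAddCommGroup EB] [NormedSpace ℝ EB] [TopologicalSpace H] (IB : ModelWithCorners ℝ EB H)
    [TopologicalSpace B] [ChartedSpace H B] [NormedAddCommGroup F] [NormedSpace ℝ F]
    (V : B → Type*) [TopologicalSpace (TotalSpace F V)] [∀ x, NormedAddCommGroup (V x)]
    [∀ x, InnerProductSpace ℝ (V x)] [FiberBundle F V] [VectorBundle ℝ F V] (n : ℕ∞ω)
    [h : IsContMDiffRiemannianBundle IB n F V] : IsContinuousRiemannianBundle F V :=
  let ⟨g, hg, hg'⟩ := h.exists_contMDiff
  ⟨g, hg.continuous, hg'⟩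

instance isContinuousRiemannianBundle_vectorSpace (F : Type*) [NormedAddCommGroup F]
    [InnerProductSpace ℝ F] :
    IsContinuousRiemannianBundle F (fun x : F ↦ TangentSpace 𝓘(ℝ, F) x) :=
  isContinuousRiemannianBundle_of_contMDiff 𝓘(ℝ, F) _ ω

end ContinuousMetric

section Euclidean

theorem exists_contMDiff_approx_vectorSpace {E : Type*} [NormedAddCommGroup E] [NormedSpace ℝ E]
    [FiniteDimensional ℝ E] {F : ℝ × E → E} (hF : Continuous F) {a : ℝ} (ha : 0 < a)
    (hFa : ∀ t x, |t| < a → F (t, x) = x) {ε : ENNReal} (hε : 0 < ε) :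
    ∃ G : ℝ × E → E, ContMDiff (𝓘(ℝ, ℝ).prod 𝓘(ℝ, E)) 𝓘(ℝ, E) ∞ G ∧ (∀ x, G (0, x) = x) ∧
      ∀ q, edist (G q) (F q) < ε := by
  obtain ⟨r, hr, hrε⟩ := ENNReal.lt_iff_exists_nnreal_btwn.mp hε
  have hr0 : (0 : ℝ) < r := by exact_mod_cast hr
  have hopen : IsOpen {q : ℝ × E | |q.1| < a} := isOpen_lt (by fun_prop) continuous_const
  obtain ⟨G, hG, hGF, hGS, -⟩ := hF.exists_contDiff_approx_and_eqOn (ε := fun _ ↦ (r : ℝ)) ⊤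
    continuous_const (fun _ ↦ hr0) (S := {q : ℝ × E | q.1 = 0}) (U := {q : ℝ × E | |q.1| < a})
    (isClosed_eq continuous_fst continuous_const)
    (hopen.mem_nhdsSet.mpr fun q hq ↦ by simpa [show q.1 = 0 from hq] using ha)
    (contDiff_snd.contDiffOn.congr fun q hq ↦ hFa q.1 q.2 hq)
  refine ⟨G, ?_, fun x ↦ ?_, fun q ↦ ?_⟩
  · rw [← modelWithCornersSelf_prod, chartedSpaceSelf_prod]
    exact hG.contMDiff
  · rw [hGS (show ((0 : ℝ), x) ∈ {q : ℝ × E | q.1 = 0} from rfl)]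
    exact hFa 0 x (by simpa using ha)
  · refine lt_trans ?_ hrε
    rw [edist_nndist, ENNReal.coe_lt_coe, ← NNReal.coe_lt_coe]
    exact hGF q

variable {n : ℕ} {X : EuclideanSpace ℝ (Fin n) → EuclideanSpace ℝ (Fin n)}
  {Φ : Flow ℝ (EuclideanSpace ℝ (Fin n))}

/-- The Taylor estimate with `h₁ = 0` shows that `fderiv` is a true derivative and not the default
value `0`; only then does its bound give a Lipschitz constant. -/
theorem UniformlyBounded.hasFDerivAt (h : UniformlyBounded X Φ) {t : ℝ} (ht : t ∈ Icc (-1 : ℝ) 1)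
    (x : EuclideanSpace ℝ (Fin n)) : HasFDerivAt (Φ t) (fderiv ℝ (Φ t) x) x := by
  obtain ⟨g, -, hg, htaylor⟩ := h.taylor
  rw [hasFDerivAt_iff_isLittleO_nhds_zero, Asymptotics.isLittleO_iff]
  intro c hc
  lift c to ℝ≥0 using hc.le
  have h1 : ∀ᶠ r in 𝓝[>] (0 : ℝ≥0), g r / r < c := hg.eventually_lt_const (by exact_mod_cast hc)
  rw [eventually_nhdsWithin_iff] at h1
  have h2 : Tendsto (fun y : EuclideanSpace ℝ (Fin n) ↦ ‖y‖₊) (𝓝 0) (𝓝 0) := by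
    simpa using (continuous_nnnorm (E := EuclideanSpace ℝ (Fin n))).tendsto 0
  filter_upwards [h2.eventually h1, Metric.ball_mem_nhds 0 one_pos] with y hy hy1
  rcases eq_or_ne y 0 with rfl | hy0
  · simp
  · have h3 := htaylor x t ht 0 (by norm_num) y (by simpa using hy1)
    simp only [add_zero, zero_smul, sub_zero, nnnorm_zero, zero_add] at h3
    have h4 : 0 < ‖y‖₊ := by simpa using hy0
    have h5 := hy h4
    rw [div_lt_iff₀ h4] at h5
    exact_mod_cast h3.trans h5.le

theorem UniformlyBounded.exists_lipschitzWith (h : UniformlyBounded X Φ) :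
    ∃ Λ : ℝ≥0, ∀ t, |t| ≤ 2 → LipschitzWith Λ (Φ t) := by
  obtain ⟨Q, hQ⟩ := h.deriv_bounded
  have h1 : ∀ t ∈ Icc (-1 : ℝ) 1, LipschitzWith Q.toNNReal (Φ t) := fun t ht ↦
    lipschitzWith_of_nnnorm_fderiv_le (fun x ↦ (h.hasFDerivAt ht x).differentiableAt) fun x ↦
      NNReal.le_toNNReal_of_coe_le (hQ x t ht)
  refine ⟨Q.toNNReal * Q.toNNReal, fun t ht ↦ ?_⟩
  have h2 : t / 2 ∈ Icc (-1 : ℝ) 1 := by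
    rw [abs_le] at ht
    constructor <;> linarith
  have h3 : Φ t = Φ (t / 2) ∘ Φ (t / 2) := by
    ext1 x
    rw [Function.comp_apply, ← Φ.map_add, add_halves]
  rw [h3]
  exact (h1 _ h2).comp (h1 _ h2)

theorem UniformlyBounded.differentiable_flow (h : UniformlyBounded X Φ) (t : ℝ) :
    Differentiable ℝ (Φ t) := by
  obtain ⟨m, hm⟩ := exists_nat_ge |t|
  have h1 : ∀ s ∈ Icc (-1 : ℝ) 1, ∀ k : ℕ, Differentiable ℝ (Φ (k * s)) := fun s hs k ↦ by
    induction k with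
    | zero => simp [Φ.map_zero]
    | succ k ih =>
      have h3 : Φ ((k + 1 : ℕ) * s) = Φ s ∘ Φ (k * s) := by
        ext1 x
        rw [Function.comp_apply, ← Φ.map_add]
        congr 1
        push_cast
        ring
      rw [h3]
      exact Differentiable.comp (fun x ↦ (h.hasFDerivAt hs x).differentiableAt) ih
  have hm0 : (0 : ℝ) < (m + 1 : ℕ) := by positivity
  have h2 := h1 (t / (m + 1 : ℕ)) ?_ (m + 1)
  · rwa [mul_div_cancel₀ _ hm0.ne'] at h2
  · rw [mem_Icc, ← abs_le, abs_div, abs_of_pos hm0, div_le_one hm0]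
    push_cast
    linarith

/-- Condition (UB) provides the uniform estimates for the flow. -/
theorem UniformlyBounded.exists_controlledFlow (h : UniformlyBounded X Φ)
    (hΦ : ∀ x t, HasDerivAt (fun τ ↦ Φ τ x) (X (Φ t x)) t) :
    ∃ Λ C : ℝ≥0, ControlledFlow X Φ Λ C := by
  obtain ⟨Λ, hΛ⟩ := h.exists_lipschitzWith
  obtain ⟨Q, hQ⟩ := h.field_bounded
  refine ⟨Λ, Q.toNNReal, fun x t ↦ (hΦ x t).hasFDerivAt.hasMFDerivAt, fun t ↦
    (h.differentiable_flow t).mdifferentiable, hΛ, fun s t x ↦ ?_,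
    fun F hF a ha hFa ε hε ↦ exists_contMDiff_approx_vectorSpace hF ha hFa hε⟩
  have h1 : LipschitzWith Q.toNNReal (fun τ ↦ Φ τ x) :=
    lipschitzWith_of_nnnorm_deriv_le (fun τ ↦ (hΦ x τ).differentiableAt) fun τ ↦ by
      rw [(hΦ x τ).deriv]
      exact NNReal.le_toNNReal_of_coe_le (hQ _)
  rw [← edist_eq_enorm_sub]
  exact h1 s t

end Euclidean

end InvShadow
end

/-! ### The two cases of the theorem. -/

theorem mainTheorem2 :
    -- the case of the Euclidean space `ℝⁿ`
    (∀ (n : ℕ) (X : EuclideanSpace ℝ (Fin n) → EuclideanSpace ℝ (Fin n))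
      (Φ : Flow ℝ (EuclideanSpace ℝ (Fin n))),
      ContDiff ℝ 1 X →
      (∀ x t, HasDerivAt (fun τ ↦ Φ τ x) (X (Φ t x)) t) →
      (∀ x, X x ≠ 0) →
      InvShadow.UniformlyBounded X Φ →
      InvShadow.UniformLISP 𝓘(ℝ, EuclideanSpace ℝ (Fin n)) Φ →
      ∃ L₁ : ℝ,
        InvShadow.SolvableOnIntervals 𝓘(ℝ, EuclideanSpace ℝ (Fin n)) X Φ L₁ ∧
        InvShadow.ProjectedSolvable 𝓘(ℝ, EuclideanSpace ℝ (Fin n)) X Φ L₁) ∧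
    -- the case of a closed Riemannian manifold
    (∀ (n : ℕ) (M : Type*) [EMetricSpace M] [CompactSpace M]
      [ChartedSpace (EuclideanSpace ℝ (Fin n)) M] [IsManifold (𝓡 n) ∞ M]
      [RiemannianBundle (fun x : M ↦ TangentSpace (𝓡 n) x)]
      [IsContMDiffRiemannianBundle (𝓡 n) ∞ (EuclideanSpace ℝ (Fin n))
        (fun x : M ↦ TangentSpace (𝓡 n) x)]
      [IsRiemannianManifold (𝓡 n) M]
      (X : (x : M) → TangentSpace (𝓡 n) x) (Φ : Flow ℝ M),
      ContMDiff (𝓡 n) (𝓡 n).tangent 1 (fun x ↦ (⟨x, X x⟩ : TangentBundle (𝓡 n) M)) →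
      (∀ x, IsMIntegralCurve (fun t ↦ Φ t x) X) →
      (∀ x, X x ≠ 0) →
      InvShadow.LISP (𝓡 n) Φ →
      ∃ L₁ : ℝ,
        InvShadow.SolvableOnIntervals (𝓡 n) X Φ L₁ ∧
        InvShadow.ProjectedSolvable (𝓡 n) X Φ L₁) := by
  refine ⟨fun n X Φ _ hΦ _ hUB hS ↦ ?_, fun n M _ _ _ _ _ _ _ X Φ hX hΦ _ hS ↦ ?_⟩
  · obtain ⟨Λ, C, h⟩ := hUB.exists_controlledFlow hΦ
    obtain ⟨L, hL⟩ := h.exists_solvableOnIntervals hS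
    exact ⟨L, hL, h.projectedSolvable hL⟩
  · have : IsContinuousRiemannianBundle (EuclideanSpace ℝ (Fin n))
        (fun x : M ↦ TangentSpace (𝓡 n) x) :=
      InvShadow.isContinuousRiemannianBundle_of_contMDiff (𝓡 n) _ ∞
    exact InvShadow.exists_solvable_of_compact hX hΦ hS
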